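/- Let $X$ be an irreducible complex algebraic variety of dimension $n$, and let $\mathcal E=(E_1,\dots,E_{n+1})$ be base-point free linear series on $X$, i.e. $E_i\subset H^0(X,\mathcal L_i)$ is a finite-dimensional space of sections of a line bundle $\mathcal L_i$ without common zeros. Put $\mathbf E=E_1\times\dots\times E_{n+1}$. For $\mathbf s=(s_1,\dots,s_{n+1})\in\mathbf E$ let $Z_{\mathbf s}\subset X$ be the set of common zeros of $s_1,\dots,s_{n+1}$. The consistency variety $R_{\mathcal E}\subset\mathbf E$ is the Zariski closure of $\{\mathbf s\in\mathbf E : Z_{\mathbf s}\neq\varnothing\}$. Assume that $R_{\mathcal E}$ has codimension $1$ in $\mathbf E$. Choose a basis of each $E_i$, so that polynomials on $\mathbf E$ are polynomials in $n+1$ groups of variables, the $i$-th group being the coordinates on $E_i$. A resultant $Res_{\mathcal E}$ is a polynomial $a f^{m}$, where $a\neq 0$ is a constant, $f$ is an irreducible polynomial on $\mathbf E$ with zero set $R_{\mathcal E}$, and $m$ is the (finite) number of points of $Z_{\mathbf s}$ for generic $\mathbf s\in R_{\mathcal E}$. For base-point free linear series $F_1,\dots,F_n$ on $X$, the intersection index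 $[F_1,\dots,F_n]$ is the number of points of $X$ at which $s_1=\dots=s_n=0$, for generic $(s_1,\dots,s_n)\in F_1\times\dots\times F_n$. For $J\subset\{1,\dots,n+1\}$ let $E_J\subset H^0(X,\bigotimes_{j\in J}\mathcal L_j)$ be the span of the products $\bigotimes_{j\in J}s_j$ with $s_j\in E_j$, let $\tau_J$ be the dimension of the image of the Kodaira map $X\to\mathbb P(E_J^*)$, which sends $x$ to the hyperplane of sections in $E_J$ that vanish at $x$, and let $\operatorname{def}(J)=\tau_J-|J|$. The subset $J$ is an essential subcollection if $\operatorname{def}(J)=\min_{I\subset\{1,\dots,n+1\}}\operatorname{def}(I)$ and $\operatorname{def}(I)>\operatorname{def}(J)$ for every proper subset $I\subsetneq J$. Theorem. A resultant $Res_{\mathcal E}$ exists, and the intersection indices $[E_1,\dots,\widehat{E_i},\dots,E_{n+1}]$ are well defined (the generic number of roots exists and is finite). For every $i\in\{1,\dots,n+1\}$, every resultant $Res_{\mathcal E}$ is homogeneous in the $i$-th group of variables, and its degree in that group equals $[E_1,\dots,\widehat{E_i},\dots,E_{n+1}]$. In particular, if $J$ is an essential subcollection of $\mathcal E$ and $i\notin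 J$, then the degree in the $i$-th group of variables is $0$. -/

import Mathlib

open AlgebraicGeometry CategoryTheory
open scoped LinearAlgebra.Projectivization

noncomputable section

namespace LinearSeries

/-! ### Complex schemes, line bundles and linear series -/

section Sections

variable (X : Scheme.{0}) [X.Over (Spec (.of ℂ))]

/-- The complex constants inside the ring of regular functions on an open subset. -/
def scalars (U : X.Opens) : ℂ →+* Γ(X, U) :=
  ((Scheme.ΓSpecIso (.of ℂ)).inv ≫ (X ↘ Spec (.of ℂ)).appTop ≫
    X.presheaf.map (homOfLE (le_top : U ≤ ⊤)).op).hom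

/-- The regular functions on an open subset form a complex vector space. -/
instance instModuleFunctions (U : X.Opens) : Module ℂ Γ(X, U) :=
  Module.compHom Γ(X, U) (scalars X U)

/-- The sections of a sheaf of modules form a complex vector space. -/
instance instModuleSections (L : X.Modules) (U : X.Opens) : Module ℂ Γ(L, U) :=
  Module.compHom Γ(L, U) (scalars X U)

end Sections

variable {X : Scheme.{0}}

/-- Restriction of a section of a sheaf of modules to a smaller open subset. -/
def res (L : X.Modules) {U V : X.Opens} (h : V ≤ U) (s : Γ(L, U)) : Γ(L, V) :=
  L.presheaf.map (homOfLE h).op s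

/-- `e` is a frame of `L` over `U`: multiplication by `e` is an isomorphism `𝒪_U ≅ L|_U`. -/
def IsFrame (L : X.Modules) {U : X.Opens} (e : Γ(L, U)) : Prop :=
  ∀ (V : X.Opens) (h : V ≤ U), Function.Bijective fun f : Γ(X, V) => f • res L h e

/-- A line bundle is a sheaf of modules that is locally isomorphic to the structure sheaf. -/
def IsLineBundle (L : X.Modules) : Prop :=
  ∀ p : X, ∃ (U : X.Opens) (e : Γ(L, U)), p ∈ U ∧ IsFrame L e

/-- The coordinate with respect to the frame `e` of a global section `s`: the regular function `f`
on `U` with `s|_U = f • e`. -/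
def frameCoord (L : X.Modules) {U : X.Opens} {e : Γ(L, U)} (he : IsFrame L e) (s : Γ(L, ⊤)) :
    Γ(X, U) :=
  ((he U le_rfl).surjective (res L le_top s)).choose

theorem frameCoord_smul (L : X.Modules) {U : X.Opens} {e : Γ(L, U)} (he : IsFrame L e)
    (s : Γ(L, ⊤)) : frameCoord L he s • res L le_rfl e = res L le_top s :=
  ((he U le_rfl).surjective (res L le_top s)).choose_spec

/-- The global section `s` of the line bundle `L` vanishes at the point `p`: its coordinate in a
frame around `p` is a function vanishing at `p`. -/
def VanishesAt (L : X.Modules) (s : Γ(L, ⊤)) (p : X) : Prop :=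
  ∃ (U : X.Opens) (e : Γ(L, U)) (he : IsFrame L e),
    p ∈ U ∧ p ∉ X.basicOpen (frameCoord L he s)

variable [X.Over (Spec (.of ℂ))]

variable (X) in
/-- A linear series (linear system): a finite-dimensional space of global sections of a line
bundle. -/
structure LinearSystem where
  L : X.Modules
  isLineBundle : IsLineBundle L
  sections : Submodule ℂ Γ(L, ⊤)
  finiteDimensional : FiniteDimensional ℂ sections

/-- At each point of the variety some section from the linear series does not vanish. The points of
the variety are the closed points of the scheme. -/
def LinearSystem.IsBasePointFree (E : LinearSystem X) : Prop :=
  ∀ p ∈ closedPoints X, ∃ s ∈ E.sections, ¬ VanishesAt E.L s p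

/-! ### Systems of equations and the consistency variety -/

section Systems

variable {ι : Type} (E : ι → LinearSystem X)

/-- The zero set of the system `s_i = 0`, `i ∈ ι`. -/
def zeroSet (s : ∀ i, (E i).sections) : Set X :=
  {p | p ∈ closedPoints X ∧ ∀ i, VanishesAt (E i).L (s i : Γ((E i).L, ⊤)) p}

variable {κ : ι → Type*} [∀ i, Fintype (κ i)] (b : ∀ i, Module.Basis (κ i) ℂ (E i).sections)

/-- The system with given coordinates: `s_i = ∑ₖ c_{i,k} b_{i,k}`. This identifies the affine space
`(Σ i, κ i) → ℂ` with the product of the linear series. -/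
def system (c : (Σ i, κ i) → ℂ) (i : ι) : (E i).sections :=
  ∑ k, c ⟨i, k⟩ • b i k

/-- The incidence variety: pairs of a point and a system that vanishes at it. -/
def incidenceVariety : Set (X × ((Σ i, κ i) → ℂ)) :=
  {q | q.1 ∈ zeroSet E (system E b q.2)}

/-- The consistency variety: the Zariski closure of the set of consistent systems, which is the
projection of the incidence variety. -/
def consistencyVariety : Set ((Σ i, κ i) → ℂ) :=
  MvPolynomial.zeroLocus ℂ (MvPolynomial.vanishingIdeal ℂ (Prod.snd '' incidenceVariety E b))

end Systems

/-- The property `P` holds for the generic point of the subvariety `R` of an affine space: it holds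
on `R` outside a Zariski closed subset that does not contain `R`. -/
def HoldsGenerically {σ : Type*} (R : Set (σ → ℂ)) (P : (σ → ℂ) → Prop) : Prop :=
  ∃ I : Ideal (MvPolynomial σ ℂ), ¬ R ⊆ MvPolynomial.zeroLocus ℂ I ∧
    ∀ c ∈ R, c ∉ MvPolynomial.zeroLocus ℂ I → P c

/-- The codimension of a subvariety of an affine space, as the height of its ideal. -/
def codim {σ : Type*} (R : Set (σ → ℂ)) : ℕ∞ :=
  (MvPolynomial.vanishingIdeal ℂ R).height

section Index

variable {ι : Type} (E : ι → LinearSystem X)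
variable {κ : ι → Type*} [∀ i, Fintype (κ i)] (b : ∀ i, Module.Basis (κ i) ℂ (E i).sections)

/-- The generic system has exactly `N` roots. -/
def IsIntersectionIndex (N : ℕ) : Prop :=
  HoldsGenerically Set.univ fun c =>
    (zeroSet E (system E b c)).Finite ∧ (zeroSet E (system E b c)).ncard = N

/-- The intersection index: the number of roots of the generic system. -/
def intersectionIndex : ℕ :=
  sInf {N | IsIntersectionIndex E b N}

/-- `F` is a resultant: it is, up to a nonzero constant, the `m`-th power of an irreducible
polynomial `f` whose zero set is the consistency variety, where `m` is the number of roots of the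
generic system in the consistency variety. -/
def IsResultant (F : MvPolynomial (Σ i, κ i) ℂ) : Prop :=
  ∃ (f : MvPolynomial (Σ i, κ i) ℂ) (m : ℕ) (a : ℂ),
    Irreducible f ∧
    {c | MvPolynomial.eval c f = 0} = consistencyVariety E b ∧
    (HoldsGenerically (consistencyVariety E b) fun c =>
      (zeroSet E (system E b c)).Finite ∧ (zeroSet E (system E b c)).ncard = m) ∧
    a ≠ 0 ∧ F = MvPolynomial.C a * f ^ m

end Index

/-- The weight that counts the variables of the `i`-th group. -/
def entryWeight {ι : Type} [DecidableEq ι] {κ : ι → Type*} (i : ι) (v : Σ i, κ i) : ℕ :=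
  if v.1 = i then 1 else 0

/-- The degree of a polynomial in the `i`-th group of variables. -/
def entryDegree {ι : Type} [DecidableEq ι] {κ : ι → Type*} (i : ι)
    (F : MvPolynomial (Σ i, κ i) ℂ) : ℕ :=
  MvPolynomial.weightedTotalDegree (entryWeight i) F

/-! ### Products of linear series, Kodaira maps and defects -/

/-- The Zariski topology on the projective space of lines in `V`, with the non-vanishing loci of
homogeneous polynomials in linear forms as basic open sets. -/
@[reducible] def projectiveZariskiTopology (V : Type*) [AddCommGroup V] [Module ℂ V] :
    TopologicalSpace (ℙ ℂ V) :=
  TopologicalSpace.generateFrom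
    {U | ∃ (P : MvPolynomial (Module.Dual ℂ V) ℂ) (d : ℕ), P.IsHomogeneous d ∧
      U = {y | MvPolynomial.eval (fun φ : Module.Dual ℂ V => φ y.rep) P ≠ 0}}

section Defect

variable {ι : Type} (E : ι → LinearSystem X) (J : Finset ι)

/-- An open subset with a frame over it of each of the line bundles `L_j`, `j ∈ J`, hence with the
frame `⊗_j e_j` of their tensor product. -/
structure LocalFrames where
  U : X.Opens
  e : ∀ j : J, Γ((E j).L, U)
  isFrame : ∀ j : J, IsFrame (E j).L (e j)

/-- The section `⊗_j s_j` of the line bundle `⊗_j L_j`, `j ∈ J`, given by its coordinates in all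
the local frames `⊗_j e_j`. -/
def tensorSection (s : ∀ j : J, (E j).sections) (F : LocalFrames E J) : Γ(X, F.U) :=
  ∏ j : J, frameCoord (E j).L (F.isFrame j) (s j : Γ((E j).L, ⊤))

/-- The product `E_J` of the linear series `E_j`, `j ∈ J`: the space of sections of `⊗_j L_j`
spanned by the products `⊗_j s_j` with `s_j ∈ E_j`. A section of `⊗_j L_j` is recorded by the
family of its coordinates in the local frames `⊗_j e_j`. -/
def productSeries : Submodule ℂ (∀ F : LocalFrames E J, Γ(X, F.U)) :=
  Submodule.span ℂ (Set.range (tensorSection E J))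

/-- The section `t` of `⊗_j L_j` vanishes at `p`. -/
def ProductVanishesAt (t : ∀ F : LocalFrames E J, Γ(X, F.U)) (p : X) : Prop :=
  ∀ F : LocalFrames E J, p ∈ F.U → p ∉ X.basicOpen (t F)

/-- `y` is the image of `p` under the Kodaira map of `E_J`: the kernel of the linear form `y` is the
hyperplane of all the sections in `E_J` that vanish at `p`. -/
def IsKodairaImage (p : X) (y : ℙ ℂ (Module.Dual ℂ (productSeries E J))) : Prop :=
  ∀ t : productSeries E J, y.rep t = 0 ↔ ProductVanishesAt E J t p

/-- The image `Y_J` of the Kodaira map of `E_J`. -/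
def kodairaImage : Set (ℙ ℂ (Module.Dual ℂ (productSeries E J))) :=
  {y | ∃ p ∈ closedPoints X, IsKodairaImage E J p y}

/-- The dimension `τ_J` of `Y_J` in its Zariski topology. -/
def tau : ℕ :=
  letI : TopologicalSpace (ℙ ℂ (Module.Dual ℂ (productSeries E J))) :=
    projectiveZariskiTopology _
  ((topologicalKrullDim (kodairaImage E J)).unbotD 0).toNat

/-- The defect of the subcollection `J`. -/
def defect : ℤ :=
  (tau E J : ℤ) - (J.card : ℤ)

/-- The minimal defect of a subcollection (the empty one included). -/
def minimalDefect [Fintype ι] : ℤ :=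
  (Finset.univ : Finset (Finset ι)).inf' Finset.univ_nonempty (defect E)

/-- `J` is an essential subcollection: it has minimal defect, and each of its proper
subcollections has larger defect. -/
def IsEssential [Fintype ι] : Prop :=
  defect E J = minimalDefect E ∧ ∀ I : Finset ι, I ⊂ J → defect E J < defect E I

end Defect

end LinearSeries

end

/-! Around a closed point there is an affine open subset U with frames of all the line bundles on
which one basis section of each series has no zeros. There the system becomes linear equations `∑ₖ
c_{i,k} g_{i,k} = 0` with `g_{i,k₀ i} = 1`. They can be solved for the variables `c_{i,k₀ i}`, so
the incidence variety over U is an affine space over U: its coordinate ring is a polynomial ring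
over `Γ(X, U)` (`incidenceHom`), a domain of transcendence degree at most n + dim 𝐄 - (n + 1). The
kernel of the map from the polynomials on 𝐄 to this ring is the ideal of the consistency variety R,
whatever the chart (`AffineAtlas.ker_inc`).

In codimension 1 this ideal is a height one prime of a factorial ring, hence generated by an
irreducible f. The incidence variety then has the dimension of R, so its projection to R is
generically finite, and a primitive element gives the constant number m of points in a generic fibre
(`generic_fiber_count`). For n of the n + 1 series, the same argument gives the intersection index N
if the projection is dominant; otherwise the generic system has no roots and N = 0.

For the degree, fix generic values of all variables except `t = c_{i,k₀ i}`. At each common root p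
of the other n sections the i-th section vanishes for exactly one t, because `g_{i,k₀ i} = 1`. The N
roots are thus distributed over values of t, and these values are the roots of f as a polynomial in
t. If D is the degree of f in t, there are D distinct roots, all outside the bad locus of R, so each
carries m points and D m = N (`AffineAtlas.exists_degree_mul_eq`). The degree in t is the degree in
the whole i-th group, because f is homogeneous in that group and its leading coefficient in t
involves only the other groups (`AffineAtlas.natDegree_isolateVariable`). The resultant `a f ^ m`
therefore has degree N.

For an essential J, chains of irreducible closed subsets of a Kodaira image have at most n steps,
because they produce algebraically independent rational functions on X. So the full collection has
negative defect, and τ_J < |J|. Each general section lowers the dimension of what is left of the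
Kodaira image of J, so |J| of them have no common zero (`ChainsShorter.exists_disjoint`). If i ∉ J,
these are among the n sections that compute the index, which is then 0. -/

set_option linter.unusedSectionVars false

/-! ### Generic fibres of generically finite dominant maps -/

section FiniteTypeAlgebras

open Polynomial

/-- Nullstellensatz: in a reduced Jacobson ring the maximal ideals intersect in zero, and a residue
field of finite type over ℂ is ℂ. -/
theorem exists_algHom_apply_ne_zero {B : Type*} [CommRing B] [Algebra ℂ B]
    [Algebra.FiniteType ℂ B] [IsReduced B] {x : B} (hx : x ≠ 0) : ∃ ψ : B →ₐ[ℂ] ℂ, ψ x ≠ 0 := by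
  have hJ : IsJacobsonRing B := isJacobsonRing_of_finiteType (A := ℂ)
  have h0 : x ∉ (⊥ : Ideal B).jacobson := by
    rw [(isJacobsonRing_iff.mp hJ) ⊥ Ideal.isRadical_bot]
    simpa using hx
  obtain ⟨m, hm, hxm⟩ : ∃ m : Ideal B, m.IsMaximal ∧ x ∉ m := by
    by_contra! h
    exact h0 (Submodule.mem_sInf.mpr fun m hm => h m hm.2)
  let _ : Field (B ⧸ m) := Ideal.Quotient.field m
  have : Module.Finite ℂ (B ⧸ m) := finite_of_finite_type_of_isJacobsonRing ℂ (B ⧸ m)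
  let e : ℂ ≃ₐ[ℂ] B ⧸ m := AlgEquiv.ofBijective (Algebra.ofId ℂ (B ⧸ m))
    IsAlgClosed.algebraMap_bijective_of_isIntegral
  refine ⟨e.symm.toAlgHom.comp (Ideal.Quotient.mkₐ ℂ m), fun h => hxm ?_⟩
  have h' : e.symm (Ideal.Quotient.mk m x) = 0 := h
  rwa [map_eq_zero_iff _ e.symm.injective, Ideal.Quotient.eq_zero_iff_mem] at h'

theorem exists_pseudo_division {A : Type*} [CommRing A] [IsDomain A] (Q : A[X]) (hQ : Q ≠ 0)
    (P : A[X]) :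
    ∃ (s : ℕ) (H R : A[X]), C (Q.leadingCoeff ^ s) * P = Q * H + R ∧ R.degree < Q.degree := by
  induction h : P.degree using WellFoundedLT.induction generalizing P with
  | ind d ih =>
    subst h
    by_cases hd : P.degree < Q.degree
    · exact ⟨0, 0, P, by simp, hd⟩
    have hP : P ≠ 0 := by
      rintro rfl
      exact hd (by simpa [bot_lt_iff_ne_bot] using hQ)
    have hle : Q.natDegree ≤ P.natDegree := natDegree_le_natDegree (not_lt.mp hd)
    obtain ⟨s, H, R, h1, h2⟩ := ih
      (C Q.leadingCoeff * P - C P.leadingCoeff * X ^ (P.natDegree - Q.natDegree) * Q).degree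
      (by
        have e1 : (C Q.leadingCoeff * P).degree = P.degree :=
          degree_C_mul (leadingCoeff_ne_zero.mpr hQ)
        conv_rhs => rw [← e1]
        apply degree_sub_lt_left
        · rw [e1, degree_mul, degree_C_mul_X_pow _ (leadingCoeff_ne_zero.mpr hP),
            degree_eq_natDegree hP, degree_eq_natDegree hQ]
          norm_cast
          omega
        · exact mul_ne_zero (by simpa using hQ) hP
        · rw [leadingCoeff_mul, leadingCoeff_mul, leadingCoeff_mul_X_pow, leadingCoeff_C,
            leadingCoeff_C, mul_comm]) _ rfl
    refine ⟨s + 1, H + C (Q.leadingCoeff ^ s) * (C P.leadingCoeff * X ^ (P.natDegree - Q.natDegree)),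
      R, ?_, h2⟩
    rw [pow_succ, C_mul]
    linear_combination h1

section Fiber

variable {A B : Type*} [CommRing A] [CommRing B] [IsDomain A] [IsDomain B] [Algebra ℂ A]
  [Algebra ℂ B] [Algebra A B] [IsScalarTower ℂ A B] [FaithfulSMul A B]

/-- By minimality of Q the pseudo-remainder of P vanishes, so Q divides P up to a power of its
leading coefficient, which φ does not kill. Hence a root t of the specialised Q satisfies every
relation of θ, and φ can be extended by θ ↦ t. -/
theorem eval_map_eq_zero_of_aeval_eq_zero {θ : B} {Q : A[X]} {a : A} (hQ : Q ≠ 0)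
    (hlc : Q.leadingCoeff ∣ a) (hQθ : aeval θ Q = 0)
    (hmin : ∀ P : A[X], aeval θ P = 0 → P.degree < Q.degree → P = 0)
    (φ : A →ₐ[ℂ] ℂ) (hφ : φ a ≠ 0) {t : ℂ} (ht : (Q.map φ.toRingHom).eval t = 0)
    {P : A[X]} (hP : aeval θ P = 0) : (P.map φ.toRingHom).eval t = 0 := by
  obtain ⟨s, H, R, h1, h2⟩ := exists_pseudo_division Q hQ P
  have hR : R = 0 := by
    refine hmin R ?_ h2
    have := congrArg (aeval θ) h1
    simpa [hP, hQθ] using this.symm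
  have h3 := congrArg (fun F => (F.map φ.toRingHom).eval t) h1
  simp only [hR, add_zero, Polynomial.map_mul, eval_mul, ht, zero_mul, Polynomial.map_C,
    eval_C] at h3
  refine (mul_eq_zero.mp h3).resolve_left fun h => hφ ?_
  obtain ⟨d, rfl⟩ := hlc
  have : φ (Q.leadingCoeff ^ s) = 0 := h
  rw [map_pow] at this
  rw [map_mul, eq_zero_of_pow_eq_zero this, zero_mul]

theorem exists_algHom_extension {θ : B} {Q : A[X]} {a : A} (hQ : Q ≠ 0)
    (hlc : Q.leadingCoeff ∣ a) (hQθ : aeval θ Q = 0)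
    (hmin : ∀ P : A[X], aeval θ P = 0 → P.degree < Q.degree → P = 0)
    (hgen : ∀ b : B, ∃ (s : ℕ) (P : A[X]), algebraMap A B (a ^ s) * b = aeval θ P)
    (φ : A →ₐ[ℂ] ℂ) (hφ : φ a ≠ 0) {t : ℂ} (ht : (Q.map φ.toRingHom).eval t = 0) :
    ∃ ψ : B →ₐ[ℂ] ℂ, (∀ x, ψ (algebraMap A B x) = φ x) ∧ ψ θ = t := by
  let ev : A[X] →+* ℂ := eval₂RingHom φ.toRingHom t
  have key {P : A[X]} (hP : aeval θ P = 0) : ev P = 0 := by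
    have := eval_map_eq_zero_of_aeval_eq_zero hQ hlc hQθ hmin φ hφ ht hP
    rwa [Polynomial.eval_map] at this
  have evC (x : A) : ev (C x) = φ x := eval₂_C _ _
  -- `z` is the value forced on `b` by some expression of `b` as a polynomial in θ over a power of
  -- `a`. Once this relation is shown to be total, single-valued, additive and multiplicative, it is
  -- the graph of the extension.
  let Rel (b : B) (z : ℂ) : Prop :=
    ∃ (s : ℕ) (P : A[X]), algebraMap A B (a ^ s) * b = aeval θ P ∧ φ a ^ s * z = ev P
  have total (b : B) : ∃ z, Rel b z := by
    obtain ⟨s, P, h⟩ := hgen b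
    exact ⟨ev P / φ a ^ s, s, P, h, by field_simp⟩
  have uniq {b : B} {z z' : ℂ} (h : Rel b z) (h' : Rel b z') : z = z' := by
    obtain ⟨s, P, h1, h2⟩ := h
    obtain ⟨s', P', h1', h2'⟩ := h'
    have := key (P := C (a ^ s') * P - C (a ^ s) * P') (by
      simp only [map_sub, map_mul, aeval_C, ← h1, ← h1']; ring)
    rw [map_sub, map_mul, map_mul, evC, evC, ← h2, ← h2', map_pow, map_pow] at this
    have h3 : φ a ^ (s + s') ≠ 0 := pow_ne_zero _ hφ
    apply mul_left_cancel₀ h3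
    rw [pow_add]
    linear_combination this
  have rmul {b b' : B} {z z' : ℂ} (h : Rel b z) (h' : Rel b' z') : Rel (b * b') (z * z') := by
    obtain ⟨s, P, h1, h2⟩ := h
    obtain ⟨s', P', h1', h2'⟩ := h'
    refine ⟨s + s', P * P', ?_, ?_⟩
    · rw [map_mul, ← h1, ← h1', pow_add, map_mul]; ring
    · rw [map_mul, ← h2, ← h2', pow_add]; ring
  have radd {b b' : B} {z z' : ℂ} (h : Rel b z) (h' : Rel b' z') : Rel (b + b') (z + z') := by
    obtain ⟨s, P, h1, h2⟩ := h
    obtain ⟨s', P', h1', h2'⟩ := h'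
    refine ⟨s + s', C (a ^ s') * P + C (a ^ s) * P', ?_, ?_⟩
    · rw [map_add, map_mul, map_mul, ← h1, ← h1', pow_add, map_mul, aeval_C, aeval_C]; ring
    · rw [map_add, map_mul, map_mul, ← h2, ← h2', evC, evC, pow_add, map_pow, map_pow]; ring
  have rA (x : A) : Rel (algebraMap A B x) (φ x) :=
    ⟨0, C x, by simp, by rw [evC]; simp⟩
  choose ψ hψ using total
  refine ⟨AlgHom.mk ⟨⟨⟨ψ, ?_⟩, ?_⟩, ?_, ?_⟩ ?_, ?_, ?_⟩
  · exact uniq (hψ 1) (by simpa using rA 1)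
  · exact fun x y => uniq (hψ _) (rmul (hψ x) (hψ y))
  · exact uniq (hψ 0) (by simpa using rA 0)
  · exact fun x y => uniq (hψ _) (radd (hψ x) (hψ y))
  · intro r
    refine uniq (hψ _) ?_
    have := rA (algebraMap ℂ A r)
    rwa [← IsScalarTower.algebraMap_apply, AlgHom.commutes] at this
  · exact fun x => uniq (hψ _) (rA x)
  · exact uniq (hψ _) ⟨0, X, by simp, by simp [ev]⟩

/-- A point over φ is determined by its value at θ, a root of the specialised Q. Nonvanishing of `a`
at φ preserves the degree of Q and its separability, so there are exactly deg Q such roots. -/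
theorem fiber_count_of_generator {θ : B} {Q : A[X]} {a : A} (hQ : Q ≠ 0)
    (hlc : Q.leadingCoeff ∣ a) (hQθ : aeval θ Q = 0)
    (hmin : ∀ P : A[X], aeval θ P = 0 → P.degree < Q.degree → P = 0)
    (hgen : ∀ b : B, ∃ (s : ℕ) (P : A[X]), algebraMap A B (a ^ s) * b = aeval θ P)
    (hsep : ∃ u v : A[X], u * Q + v * derivative Q = C a)
    (φ : A →ₐ[ℂ] ℂ) (hφ : φ a ≠ 0) :
    {ψ : B →ₐ[ℂ] ℂ | ∀ x, ψ (algebraMap A B x) = φ x}.Finite ∧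
      {ψ : B →ₐ[ℂ] ℂ | ∀ x, ψ (algebraMap A B x) = φ x}.ncard = Q.natDegree := by
  classical
  set q := Q.map φ.toRingHom with hq
  have hlc' : φ.toRingHom Q.leadingCoeff ≠ 0 := by
    intro h
    obtain ⟨d, rfl⟩ := hlc
    exact hφ (by rw [map_mul]; exact mul_eq_zero_of_left h _)
  have hdeg : q.natDegree = Q.natDegree := natDegree_map_of_leadingCoeff_ne_zero _ hlc'
  have hq0 : q ≠ 0 := by
    intro h
    apply hlc'
    rw [← coeff_natDegree, ← coeff_map, ← hq, h, coeff_zero]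
  have hqsep : q.Separable := by
    obtain ⟨u, v, h⟩ := hsep
    have h' := congrArg (Polynomial.map φ.toRingHom) h
    simp only [Polynomial.map_add, Polynomial.map_mul, ← derivative_map, Polynomial.map_C] at h'
    refine ⟨C (φ a)⁻¹ * u.map φ.toRingHom, C (φ a)⁻¹ * v.map φ.toRingHom, ?_⟩
    rw [mul_assoc, mul_assoc, ← mul_add, h', ← C_mul]
    have : (φ a)⁻¹ * φ.toRingHom a = 1 := inv_mul_cancel₀ hφ
    rw [this, C_1]
  have evψ {ψ : B →ₐ[ℂ] ℂ} (hψ : ∀ x, ψ (algebraMap A B x) = φ x) (P : A[X]) :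
      ψ (aeval θ P) = (P.map φ.toRingHom).eval (ψ θ) := by
    rw [aeval_def, ← AlgHom.coe_toRingHom ψ, hom_eval₂, Polynomial.eval_map]
    congr 1
    ext x
    exact hψ x
  have hbij : Set.BijOn (fun ψ : B →ₐ[ℂ] ℂ => ψ θ)
      {ψ : B →ₐ[ℂ] ℂ | ∀ x, ψ (algebraMap A B x) = φ x} (q.roots.toFinset : Set ℂ) := by
    refine ⟨?_, ?_, ?_⟩
    · intro ψ hψ
      have := evψ hψ Q
      rw [hQθ, map_zero] at this
      exact Finset.mem_coe.mpr (Multiset.mem_toFinset.mpr ((mem_roots hq0).mpr this.symm))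
    · intro ψ hψ ψ' hψ' h
      ext b
      obtain ⟨s, P, hP⟩ := hgen b
      have e1 := congrArg ψ hP
      have e2 := congrArg ψ' hP
      simp only at h
      rw [evψ hψ, map_mul, hψ] at e1
      rw [evψ hψ', map_mul, hψ', ← h, ← e1] at e2
      refine (mul_left_cancel₀ ?_ e2).symm
      rw [map_pow]
      exact pow_ne_zero _ hφ
    · intro t ht
      have ht' : q.eval t = 0 := by simpa [hq0] using ht
      obtain ⟨ψ, h1, h2⟩ := exists_algHom_extension hQ hlc hQθ hmin hgen φ hφ ht'
      exact ⟨ψ, h1, h2⟩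
  refine ⟨hbij.finite_iff_finite.mpr (Finset.finite_toSet _), ?_⟩
  rw [hbij.injOn.ncard_image.symm, hbij.image_eq, Set.ncard_coe_finset,
    Multiset.toFinset_card_of_nodup (nodup_roots hqsep), ← hdeg]
  exact (IsAlgClosed.splits q).natDegree_eq_card_roots.symm

end Fiber

section GenericFiber

variable {A B : Type*} [CommRing A] [CommRing B] [IsDomain A] [IsDomain B] [Algebra ℂ A]
  [Algebra ℂ B] [Algebra A B] [IsScalarTower ℂ A B] [FaithfulSMul A B]

theorem exists_clear_denominators (A : Type*) {K : Type*} [CommRing A] [IsDomain A] [Field K] [Algebra A K]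
    [IsFractionRing A K] (p : K[X]) :
    ∃ (d : A) (P : A[X]), d ≠ 0 ∧ P.map (algebraMap A K) = C (algebraMap A K d) * p := by
  obtain ⟨d, hd, h⟩ := IsLocalization.integerNormalization_spec (nonZeroDivisors A) p
  refine ⟨d, IsLocalization.integerNormalization (nonZeroDivisors A) p,
    nonZeroDivisors.ne_zero hd, ?_⟩
  rw [h, ← IsScalarTower.algebraMap_smul K, Polynomial.smul_eq_C_mul]

variable [Algebra.FiniteType ℂ B] [Algebra.IsAlgebraic A B]

/-- The fraction field of B is a finite separable extension of that of A; a primitive element and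
its minimal polynomial are brought down to B and A by clearing denominators. -/
theorem exists_generator_data (A B : Type*) [CommRing A] [CommRing B] [IsDomain A] [IsDomain B] [Algebra ℂ A]
  [Algebra ℂ B] [Algebra A B] [IsScalarTower ℂ A B] [FaithfulSMul A B] [Algebra.FiniteType ℂ B] [Algebra.IsAlgebraic A B] :
    ∃ (θ : B) (Q : A[X]) (a : A), a ≠ 0 ∧ Q ≠ 0 ∧ Q.leadingCoeff ∣ a ∧ aeval θ Q = 0 ∧
      (∀ P : A[X], aeval θ P = 0 → P.degree < Q.degree → P = 0) ∧
      (∀ b : B, ∃ (s : ℕ) (P : A[X]), algebraMap A B (a ^ s) * b = aeval θ P) ∧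
      ∃ u v : A[X], u * Q + v * derivative Q = C a := by
  classical
  let K := FractionRing A
  let L := FractionRing B
  have hinj : Function.Injective (algebraMap A L) := by
    rw [IsScalarTower.algebraMap_eq A B L]
    exact (IsFractionRing.injective B L).comp (FaithfulSMul.algebraMap_injective A B)
  have : FaithfulSMul A L := (faithfulSMul_iff_algebraMap_injective A L).mpr hinj
  have : Algebra.FiniteType A B := Algebra.FiniteType.of_restrictScalars_finiteType ℂ A B
  let _ : Algebra K L := FractionRing.liftAlgebra A L
  have : IsScalarTower A K L := inferInstance
  have : Algebra.IsAlgebraic B L := IsLocalization.isAlgebraic L (nonZeroDivisors B)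
  have : Algebra.IsAlgebraic A L := Algebra.IsAlgebraic.trans A B L
  have : Algebra.IsAlgebraic K L := inferInstance
  have h1 : Algebra.EssFiniteType B L := Algebra.EssFiniteType.of_isLocalization L (nonZeroDivisors B)
  have h2 : Algebra.EssFiniteType A L := Algebra.EssFiniteType.comp A B L
  have : Algebra.EssFiniteType K L := Algebra.EssFiniteType.of_comp A K L
  have : FiniteDimensional K L := Algebra.finite_of_essFiniteType_of_isAlgebraic
  have : CharZero K := by
    have : CharZero A := charZero_of_injective_algebraMap (algebraMap ℂ A).injective
    infer_instance
  obtain ⟨α, hα⟩ := Field.exists_primitive_element K L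
  obtain ⟨x, y, hy, hxy⟩ := IsFractionRing.div_surjective (A := B) α
  -- The primitive element is `α = x / y`. With `a₀ = y w` in A, the element `x w = a₀ α` is still
  -- primitive and lies in B.
  obtain ⟨a₀, ha₀, w, hw⟩ := (Algebra.IsAlgebraic.isAlgebraic (R := A) y).exists_nonzero_dvd hy
  have hyL : algebraMap B L y ≠ 0 := by
    simpa using nonZeroDivisors.ne_zero hy
  have hθα : algebraMap B L (x * w) = algebraMap K L (algebraMap A K a₀) * α := by
    rw [← IsScalarTower.algebraMap_apply A K L, IsScalarTower.algebraMap_apply A B L, hw, ← hxy,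
      map_mul, map_mul, mul_div_assoc', eq_div_iff hyL]
    ring
  set θ := x * w with hθdef
  have ha₀K : algebraMap A K a₀ ≠ 0 := by simpa using ha₀
  have hθtop : Algebra.adjoin K {algebraMap B L θ} = ⊤ := by
    have h : IntermediateField.adjoin K {algebraMap B L θ} = ⊤ := by
      rw [eq_top_iff, ← hα, IntermediateField.adjoin_simple_le_iff]
      have : α = algebraMap K L (algebraMap A K a₀)⁻¹ * algebraMap B L θ := by
        rw [hθα, ← mul_assoc, ← map_mul, inv_mul_cancel₀ ha₀K, map_one, one_mul]
      rw [this]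
      exact mul_mem (IntermediateField.algebraMap_mem _ _)
        (IntermediateField.mem_adjoin_simple_self _ _)
    rw [← IntermediateField.adjoin_simple_toSubalgebra_of_isAlgebraic
      (Algebra.IsAlgebraic.isAlgebraic _), h, IntermediateField.top_toSubalgebra]
  have hBL := IsFractionRing.injective B L
  have hAK := IsFractionRing.injective A K
  have aev (P : A[X]) : algebraMap B L (aeval θ P) = aeval (algebraMap B L θ) (P.map (algebraMap A K)) := by
    rw [aeval_map_algebraMap, aeval_algebraMap_apply]
  have hint : IsIntegral K (algebraMap B L θ) := Algebra.IsIntegral.isIntegral _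
  set q := minpoly K (algebraMap B L θ) with hq
  have hqm : q.Monic := minpoly.monic hint
  obtain ⟨d₀, Q, hd₀, hQ⟩ := exists_clear_denominators A q
  have hd₀K : algebraMap A K d₀ ≠ 0 := by simpa using hd₀
  have hlc : Q.leadingCoeff = d₀ := by
    apply hAK
    rw [← leadingCoeff_map_of_injective hAK, hQ, leadingCoeff_mul, leadingCoeff_C, hqm.leadingCoeff,
      mul_one]
  have hQ0 : Q ≠ 0 := by
    rintro rfl
    exact hd₀ (by simpa using hlc.symm)
  have hsep : q.Separable := Algebra.IsSeparable.isSeparable K (algebraMap B L θ)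
  obtain ⟨u, v, huv⟩ := hsep
  obtain ⟨du, U, hdu, hU⟩ := exists_clear_denominators A u
  obtain ⟨dv, V, hdv, hV⟩ := exists_clear_denominators A v
  have hgen1 (b : B) : ∃ (d : A) (P : A[X]), d ≠ 0 ∧ algebraMap A B d * b = aeval θ P := by
    have : algebraMap B L b ∈ Algebra.adjoin K {algebraMap B L θ} := hθtop ▸ Algebra.mem_top
    rw [Algebra.adjoin_singleton_eq_range_aeval] at this
    obtain ⟨p, hp⟩ := this
    obtain ⟨d, P, hd, hP⟩ := exists_clear_denominators A p
    refine ⟨d, P, hd, hBL ?_⟩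
    have hp' : aeval (algebraMap B L θ) p = algebraMap B L b := hp
    rw [aev, hP, aeval_mul, hp', aeval_C, map_mul, ← IsScalarTower.algebraMap_apply A B L,
      ← IsScalarTower.algebraMap_apply A K L]
  choose dd PP hdd hPP using hgen1
  obtain ⟨S, hS⟩ := (‹Algebra.FiniteType ℂ B› : Algebra.FiniteType ℂ B).out
  -- `du` and `dv` clear the Bézout relation of the minimal polynomial and its derivative, `d₀` the
  -- minimal polynomial, and `dd b` the expression in θ of each algebra generator `b`.
  refine ⟨θ, Q, du * dv * d₀ * ∏ b ∈ S, dd b, ?_, hQ0, ?_, ?_, ?_, ?_, ?_⟩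
  · exact mul_ne_zero (mul_ne_zero (mul_ne_zero hdu hdv) hd₀) (Finset.prod_ne_zero_iff.mpr
      fun b _ => hdd b)
  · rw [hlc]
    exact ⟨du * dv * ∏ b ∈ S, dd b, by ring⟩
  · apply hBL
    rw [aev, hQ, map_mul, minpoly.aeval, mul_zero, map_zero]
  · intro P hP hdeg
    by_contra hP0
    have h3 : aeval (algebraMap B L θ) (P.map (algebraMap A K)) = 0 := by rw [← aev, hP, map_zero]
    have h4 := minpoly.degree_le_of_ne_zero K (algebraMap B L θ)
      ((Polynomial.map_ne_zero_iff hAK).mpr hP0) h3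
    have h5 : Q.degree = q.degree := by
      rw [← degree_map_eq_of_injective hAK Q, hQ, degree_C_mul hd₀K]
    rw [degree_map_eq_of_injective hAK, ← hq, ← h5] at h4
    exact absurd hdeg (not_lt.mpr h4)
  · set a := du * dv * d₀ * ∏ b ∈ S, dd b with ha
    intro b
    have hb : b ∈ Algebra.adjoin ℂ (S : Set B) := hS ▸ Algebra.mem_top
    induction hb using Algebra.adjoin_induction with
    | mem b hb =>
      refine ⟨1, C (du * dv * d₀ * ∏ b' ∈ S.erase b, dd b') * PP b, ?_⟩
      rw [map_mul, aeval_C, ← hPP, pow_one, ha, ← Finset.mul_prod_erase S dd hb]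
      simp only [map_mul]
      ring
    | algebraMap r =>
      exact ⟨0, C (algebraMap ℂ A r), by simp [← IsScalarTower.algebraMap_apply]⟩
    | add b b' _ _ h h' =>
      obtain ⟨s, P, h⟩ := h
      obtain ⟨s', P', h'⟩ := h'
      refine ⟨s + s', C (a ^ s') * P + C (a ^ s) * P', ?_⟩
      rw [map_add, map_mul, map_mul, ← h, ← h', pow_add, map_mul, aeval_C, aeval_C]; ring
    | mul b b' _ _ h h' =>
      obtain ⟨s, P, h⟩ := h
      obtain ⟨s', P', h'⟩ := h'
      exact ⟨s + s', P * P', by rw [map_mul, ← h, ← h', pow_add, map_mul]; ring⟩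
  · refine ⟨C (∏ b ∈ S, dd b) * (C dv * U), C (∏ b ∈ S, dd b) * (C du * V), ?_⟩
    apply Polynomial.map_injective _ hAK
    simp only [Polynomial.map_add, Polynomial.map_mul, ← derivative_map, hQ, hU, hV,
      Polynomial.map_C, map_mul, derivative_C_mul]
    linear_combination (C (algebraMap A K (∏ b ∈ S, dd b)) * C (algebraMap A K dv) *
      C (algebraMap A K du) * C (algebraMap A K d₀)) * huv

theorem generic_fiber_count (A B : Type*) [CommRing A] [CommRing B] [IsDomain A] [IsDomain B]
    [Algebra ℂ A] [Algebra ℂ B] [Algebra A B] [IsScalarTower ℂ A B] [FaithfulSMul A B]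
    [Algebra.FiniteType ℂ B] [Algebra.IsAlgebraic A B] :
    ∃ (a : A) (N : ℕ), a ≠ 0 ∧ ∀ φ : A →ₐ[ℂ] ℂ, φ a ≠ 0 →
      {ψ : B →ₐ[ℂ] ℂ | ∀ x, ψ (algebraMap A B x) = φ x}.Finite ∧
      {ψ : B →ₐ[ℂ] ℂ | ∀ x, ψ (algebraMap A B x) = φ x}.ncard = N := by
  obtain ⟨θ, Q, a, ha, hQ, hlc, hQθ, hmin, hgen, hsep⟩ := exists_generator_data A B
  exact ⟨a, Q.natDegree, ha, fun φ hφ =>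
    fiber_count_of_generator hQ hlc hQθ hmin hgen hsep φ hφ⟩

/-- A nonzero algebraic element divides a nonzero element of A; geometrically, the image of a proper
closed subset upstairs is not dense. -/
theorem exists_ne_zero_of_isAlgebraic {x : B} (hx : x ≠ 0) :
    ∃ r : A, r ≠ 0 ∧ ∀ ψ : B →ₐ[ℂ] ℂ, ψ (algebraMap A B r) ≠ 0 → ψ x ≠ 0 := by
  obtain ⟨r, hr, w, hw⟩ := (Algebra.IsAlgebraic.isAlgebraic (R := A) x).exists_nonzero_dvd
    (mem_nonZeroDivisors_of_ne_zero hx)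
  exact ⟨r, hr, fun ψ h hx => h (by rw [hw, map_mul, hx, zero_mul])⟩

end GenericFiber

end FiniteTypeAlgebras

/-! ### Transcendence degree and dimension -/

section TranscendenceDegree

open Algebra

/-- By Noether normalisation A is integral over a polynomial ring in `s = trdeg A` variables, and
going-up lifts a chain of s + 1 primes from there to A. -/
theorem trdeg_le_of_ringKrullDim_le {A : Type*} [CommRing A] [IsDomain A]
    [Algebra ℂ A] [Algebra.FiniteType ℂ A] {n : ℕ} (h : ringKrullDim A ≤ n) : Algebra.trdeg ℂ A ≤ n := by
  obtain ⟨s, g, hg, hi⟩ := exists_integral_inj_algHom_of_fg ℂ A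
  let _ := g.toRingHom.toAlgebra
  have : IsScalarTower ℂ (MvPolynomial (Fin s) ℂ) A := IsScalarTower.of_algHom g
  have : Algebra.IsIntegral (MvPolynomial (Fin s) ℂ) A := ⟨hi⟩
  have : FaithfulSMul (MvPolynomial (Fin s) ℂ) A :=
    (faithfulSMul_iff_algebraMap_injective _ _).mpr hg
  have h1 : Algebra.trdeg ℂ A = s := by
    have h2 := lift_trdeg_add_eq ℂ (MvPolynomial (Fin s) ℂ) A
    rw [(trdeg_eq_zero_iff (R := MvPolynomial (Fin s) ℂ) (A := A)).mpr inferInstance,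
      MvPolynomial.trdeg_of_isDomain] at h2
    apply Cardinal.lift_injective
    rw [← h2]
    simp
  have h3 : (s : WithBot ℕ∞) ≤ ringKrullDim A := by
    have h4 : ringKrullDim (MvPolynomial (Fin s) ℂ) = s := by
      rw [MvPolynomial.ringKrullDim_of_isNoetherianRing]
      simp
    have h5 : (s : WithBot ℕ∞) ≤ Order.krullDim (PrimeSpectrum (MvPolynomial (Fin s) ℂ)) := h4.ge
    obtain ⟨l, hl⟩ := Order.le_krullDim_iff.mp h5
    obtain ⟨q, -, hq, hq'⟩ := Ideal.exists_ideal_over_prime_of_isIntegral l.head.asIdeal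
      (⊥ : Ideal A) (by
        rw [← RingHom.ker_eq_comap_bot, (RingHom.injective_iff_ker_eq_bot _).mp
          (FaithfulSMul.algebraMap_injective (MvPolynomial (Fin s) ℂ) A)]
        exact bot_le)
    have : q.LiesOver l.head.asIdeal := ⟨hq'.symm⟩
    obtain ⟨l', hl', -⟩ := Ideal.exists_ltSeries_of_hasGoingUp l q
    exact Order.le_krullDim_iff.mpr ⟨l', hl'.trans hl⟩
  rw [h1]
  exact_mod_cast h3.trans h

/-- Transcendence degrees add in towers, and finiteness of `d` allows cancellation. -/
theorem isAlgebraic_of_trdeg_le {A B : Type*} [CommRing A] [CommRing B] [IsDomain A] [IsDomain B]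
    [Algebra ℂ A] [Algebra ℂ B] [Algebra A B] [IsScalarTower ℂ A B] [FaithfulSMul A B]
    {d : ℕ} (hB : Algebra.trdeg ℂ B ≤ d) (hA : d ≤ Algebra.trdeg ℂ A) :
    Algebra.IsAlgebraic A B := by
  rw [← trdeg_eq_zero_iff]
  have h := lift_trdeg_add_eq ℂ A B
  have h1 : Cardinal.lift (Algebra.trdeg ℂ B) ≤ (d : Cardinal) := by simpa using hB
  rw [← h] at h1
  have h2 : (d : Cardinal) ≤ Cardinal.lift (Algebra.trdeg ℂ A) := by simpa using hA
  have h3 : Cardinal.lift (Algebra.trdeg ℂ A) = (d : Cardinal) := le_antisymm (le_self_add.trans h1) h2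
  rw [h3] at h1
  have h4 : Cardinal.lift (Algebra.trdeg A B) = 0 := by
    obtain ⟨m, hm⟩ := Cardinal.lt_aleph0.mp
      ((le_add_self.trans h1).trans_lt (Cardinal.natCast_lt_aleph0 (n := d)))
    rw [hm] at h1 ⊢
    norm_cast at h1 ⊢
    omega
  simpa using h4

end TranscendenceDegree

/-! ### The incidence variety over an affine chart -/

section Incidence

variable {ι : Type*} {κ : ι → Type*}

/-- The variables that remain after the distinguished variable of each group is eliminated. -/
abbrev FreeVars (k₀ : ∀ i, κ i) : Type _ := {v : Σ i, κ i // v.2 ≠ k₀ v.1}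

variable [∀ i, Fintype (κ i)] {A : Type*} [CommRing A] [Algebra ℂ A]

open Classical in
/-- The coordinate ring of the incidence variety of the linear forms `∑ₖ cᵢₖ gᵢₖ`, where the
coefficient `g_{i,k₀ i}` is one, is a polynomial ring over `A`; this is its structure as an algebra
over the coordinate ring of the space of systems. -/
noncomputable def incidenceHom (k₀ : ∀ i, κ i) (g : ∀ i, κ i → A) :
    MvPolynomial (Σ i, κ i) ℂ →ₐ[ℂ] MvPolynomial (FreeVars k₀) A :=
  MvPolynomial.aeval fun v => if h : v.2 = k₀ v.1 then
    -∑ k : {k // k ≠ k₀ v.1}, MvPolynomial.C (g v.1 k) * MvPolynomial.X ⟨⟨v.1, k⟩, k.2⟩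
    else MvPolynomial.X ⟨v, h⟩

variable {k₀ : ∀ i, κ i} {g : ∀ i, κ i → A}

open Classical in
theorem incidenceHom_X_base (i : ι) : incidenceHom k₀ g (MvPolynomial.X ⟨i, k₀ i⟩) =
    -∑ k : {k // k ≠ k₀ i}, MvPolynomial.C (g i k) * MvPolynomial.X ⟨⟨i, k⟩, k.2⟩ := by
  rw [incidenceHom, MvPolynomial.aeval_X, dif_pos rfl]

theorem incidenceHom_X_free (v : FreeVars k₀) :
    incidenceHom k₀ g (MvPolynomial.X v.1) = MvPolynomial.X v := by
  rw [incidenceHom, MvPolynomial.aeval_X, dif_neg v.2]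

theorem sum_incidenceHom (hg : ∀ i, g i (k₀ i) = 1) (i : ι) :
    ∑ k, incidenceHom k₀ g (MvPolynomial.X ⟨i, k⟩) * MvPolynomial.C (g i k) = 0 := by
  classical
  rw [Fintype.sum_eq_add_sum_subtype_ne _ (k₀ i), incidenceHom_X_base, hg, map_one, mul_one,
    neg_add_eq_zero]
  refine Finset.sum_congr rfl fun k _ => ?_
  rw [incidenceHom_X_free (k₀ := k₀) ⟨⟨i, k⟩, k.2⟩, mul_comm]

theorem aevalTower_incidenceHom (hg : ∀ i, g i (k₀ i) = 1) {p : A →ₐ[ℂ] ℂ}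
    {c : (Σ i, κ i) → ℂ} (h : ∀ i, ∑ k, c ⟨i, k⟩ * p (g i k) = 0)
    (F : MvPolynomial (Σ i, κ i) ℂ) :
    MvPolynomial.aevalTower p (fun v : FreeVars k₀ => c v.1) (incidenceHom k₀ g F) =
      MvPolynomial.eval c F := by
  classical
  have : (MvPolynomial.aevalTower p (fun v : FreeVars k₀ => c v.1)).comp (incidenceHom k₀ g) =
      MvPolynomial.aeval c := by
    refine MvPolynomial.algHom_ext fun v => ?_
    rw [AlgHom.comp_apply, MvPolynomial.aeval_X]
    by_cases hv : v.2 = k₀ v.1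
    · obtain ⟨i, k⟩ := v
      obtain rfl : k = k₀ i := hv
      have := h i
      rw [Fintype.sum_eq_add_sum_subtype_ne _ (k₀ i), hg, map_one, mul_one] at this
      rw [incidenceHom_X_base, map_neg, map_sum, eq_comm, ← add_eq_zero_iff_eq_neg, ← this]
      simp [mul_comm]
    · rw [incidenceHom_X_free ⟨v, hv⟩, MvPolynomial.aevalTower_X]
  rw [← AlgHom.comp_apply, this]
  rfl

/-- This identifies the fibre of the projection over `c` with the solutions of the system `c` in the
chart: the free coordinates of a point over `c` are prescribed by `c`, and only its restriction to A
can vary. -/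
theorem bijOn_incidence_fiber (hg : ∀ i, g i (k₀ i) = 1) (c : (Σ i, κ i) → ℂ) :
    Set.BijOn (fun ψ : MvPolynomial (FreeVars k₀) A →ₐ[ℂ] ℂ => ψ.comp (IsScalarTower.toAlgHom ℂ A _))
      {ψ | ∀ F, ψ (incidenceHom k₀ g F) = MvPolynomial.eval c F}
      {p | ∀ i, ∑ k, c ⟨i, k⟩ * p (g i k) = 0} := by
  refine ⟨?_, ?_, ?_⟩
  · intro ψ hψ i
    have := congrArg ψ (sum_incidenceHom hg i)
    rw [map_sum, map_zero] at this
    rw [← this]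
    refine Finset.sum_congr rfl fun k _ => ?_
    rw [map_mul, hψ, MvPolynomial.eval_X]
    rfl
  · intro ψ hψ ψ' hψ' h
    refine MvPolynomial.algHom_ext' h fun v => ?_
    rw [← incidenceHom_X_free (g := g) v, hψ, hψ']
  · intro p hp
    refine ⟨MvPolynomial.aevalTower p fun v => c v.1, aevalTower_incidenceHom hg hp, ?_⟩
    ext a
    exact MvPolynomial.aevalTower_C _ _ _

variable [Fintype ι]

theorem card_freeVars [Fintype (FreeVars k₀)] :
    Fintype.card (FreeVars k₀) + Fintype.card ι = Fintype.card (Σ i, κ i) := by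
  classical
  have e : {v : Σ i, κ i // v.2 = k₀ v.1} ≃ ι :=
    { toFun := fun v => v.1.1
      invFun := fun i => ⟨⟨i, k₀ i⟩, rfl⟩
      left_inv := by rintro ⟨⟨i, k⟩, rfl : k = k₀ i⟩; rfl
      right_inv := fun _ => rfl }
  rw [← Fintype.card_congr e, add_comm, ← Fintype.card_sum]
  exact Fintype.card_congr (Equiv.sumCompl _)

/-- One variable is eliminated per group, so the incidence variety has fibre dimension |Σ| - |ι|
over the chart. -/
theorem trdeg_incidence_le [IsDomain A] {n d : ℕ} (hA : Algebra.trdeg ℂ A ≤ n)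
    (hd : n + Fintype.card (Σ i, κ i) ≤ d + Fintype.card ι) :
    Algebra.trdeg ℂ (MvPolynomial (FreeVars k₀) A) ≤ d := by
  classical
  have h := lift_trdeg_add_eq ℂ A (MvPolynomial (FreeVars k₀) A)
  rw [MvPolynomial.trdeg_of_isDomain] at h
  apply Cardinal.lift_le.mp
  rw [← h]
  have h2 := card_freeVars (k₀ := k₀)
  obtain ⟨m, hm⟩ := Cardinal.lt_aleph0.mp (hA.trans_lt Cardinal.natCast_lt_aleph0)
  rw [hm] at hA ⊢
  simp only [Cardinal.mk_fintype, Cardinal.lift_natCast]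
  norm_cast at hA ⊢
  omega

end Incidence

/-! ### Generic fibres of the projection from the incidence variety -/

section IncidenceGeneric

variable {ι : Type*} {κ : ι → Type*} [∀ i, Fintype (κ i)] {A : Type*} [CommRing A] [Algebra ℂ A]
  {k₀ : ∀ i, κ i} {g : ∀ i, κ i → A}

theorem eval_eq_zero_of_mem_ker (hg : ∀ i, g i (k₀ i) = 1) {p : A →ₐ[ℂ] ℂ}
    {c : (Σ i, κ i) → ℂ} (h : ∀ i, ∑ k, c ⟨i, k⟩ * p (g i k) = 0)
    {F : MvPolynomial (Σ i, κ i) ℂ} (hF : F ∈ RingHom.ker (incidenceHom k₀ g)) :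
    MvPolynomial.eval c F = 0 := by
  rw [← aevalTower_incidenceHom hg h, (RingHom.mem_ker).mp hF, map_zero]

variable [IsDomain A]

/-- In a domain the product of `h` with a nonzero image of F is nonzero, so the Nullstellensatz
gives a point where neither vanishes. The factor `h` restricts the test to a dense open part of the
chart, which is what the comparison of two charts requires. -/
theorem mem_ker_of_forall_eval_eq_zero [Finite ι] [Algebra.FiniteType ℂ A]
    (hg : ∀ i, g i (k₀ i) = 1) {h : A}
    (hh : h ≠ 0) {F : MvPolynomial (Σ i, κ i) ℂ}
    (hF : ∀ (p : A →ₐ[ℂ] ℂ) (c : (Σ i, κ i) → ℂ), p h ≠ 0 →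
      (∀ i, ∑ k, c ⟨i, k⟩ * p (g i k) = 0) → MvPolynomial.eval c F = 0) :
    F ∈ RingHom.ker (incidenceHom k₀ g) := by
  rw [RingHom.mem_ker]
  by_contra hne
  have h1 : incidenceHom k₀ g F * MvPolynomial.C h ≠ 0 :=
    mul_ne_zero hne (by simpa using hh)
  have : Algebra.FiniteType ℂ (MvPolynomial (FreeVars k₀) A) :=
    Algebra.FiniteType.trans (S := A) inferInstance inferInstance
  obtain ⟨ψ, hψ⟩ := exists_algHom_apply_ne_zero h1
  rw [map_mul] at hψ
  let c : (Σ i, κ i) → ℂ := fun v => ψ (incidenceHom k₀ g (MvPolynomial.X v))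
  have hc (G : MvPolynomial (Σ i, κ i) ℂ) : ψ (incidenceHom k₀ g G) = MvPolynomial.eval c G := by
    have : ψ.comp (incidenceHom k₀ g) = MvPolynomial.aeval c :=
      MvPolynomial.algHom_ext fun v => by simp [c]
    exact DFunLike.congr_fun this G
  refine left_ne_zero_of_mul hψ ?_
  rw [hc]
  exact hF _ c (right_ne_zero_of_mul hψ) ((bijOn_incidence_fiber hg c).mapsTo hc)

instance isPrime_ker_incidenceHom : (RingHom.ker (incidenceHom k₀ g)).IsPrime :=
  RingHom.ker_isPrime _

theorem exists_rangeEval {c : (Σ i, κ i) → ℂ}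
    (hc : ∀ F ∈ RingHom.ker (incidenceHom k₀ g), MvPolynomial.eval c F = 0) :
    ∃ φ : (incidenceHom k₀ g).range →ₐ[ℂ] ℂ, ∀ F,
      φ ((incidenceHom k₀ g).rangeRestrict F) = MvPolynomial.eval c F := by
  refine ⟨AlgHom.liftOfSurjective (incidenceHom k₀ g).rangeRestrict
    (AlgHom.rangeRestrict_surjective _) (MvPolynomial.aeval c)
    fun F hF => hc F (congrArg Subtype.val ((RingHom.mem_ker).mp hF)), fun F => ?_⟩
  exact AlgHom.liftOfSurjective_apply _ _ _ _ F

variable [Finite ι] [Algebra.FiniteType ℂ A]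
  [Algebra.IsAlgebraic (incidenceHom k₀ g).range (MvPolynomial (FreeVars k₀) A)]

theorem exists_generic_count (hg : ∀ i, g i (k₀ i) = 1) :
    ∃ (N : ℕ) (q : MvPolynomial (Σ i, κ i) ℂ), q ∉ RingHom.ker (incidenceHom k₀ g) ∧
      ∀ c : (Σ i, κ i) → ℂ,
        (∀ F ∈ RingHom.ker (incidenceHom k₀ g), MvPolynomial.eval c F = 0) →
        MvPolynomial.eval c q ≠ 0 →
        {p : A →ₐ[ℂ] ℂ | ∀ i, ∑ k, c ⟨i, k⟩ * p (g i k) = 0}.Finite ∧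
        {p : A →ₐ[ℂ] ℂ | ∀ i, ∑ k, c ⟨i, k⟩ * p (g i k) = 0}.ncard = N := by
  have : Algebra.FiniteType ℂ (MvPolynomial (FreeVars k₀) A) :=
    Algebra.FiniteType.trans (S := A) inferInstance inferInstance
  obtain ⟨a, N, ha, hN⟩ :=
    generic_fiber_count (incidenceHom k₀ g).range (MvPolynomial (FreeVars k₀) A)
  obtain ⟨q, rfl⟩ := AlgHom.rangeRestrict_surjective _ a
  refine ⟨N, q, fun h => ha (Subtype.ext h), fun c hc hq => ?_⟩
  obtain ⟨φ, hφ⟩ := exists_rangeEval hc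
  have h1 := hN φ (by rwa [hφ])
  have hset : {ψ : MvPolynomial (FreeVars k₀) A →ₐ[ℂ] ℂ |
        ∀ x : (incidenceHom k₀ g).range, ψ (algebraMap _ _ x) = φ x} =
      {ψ | ∀ F, ψ (incidenceHom k₀ g F) = MvPolynomial.eval c F} := by
    ext ψ
    constructor
    · intro h F
      rw [← hφ, ← h]
      rfl
    · intro h x
      obtain ⟨F, rfl⟩ := AlgHom.rangeRestrict_surjective _ x
      rw [hφ, ← h]
      rfl
  rw [hset] at h1
  have hb := bijOn_incidence_fiber hg c
  exact ⟨hb.finite_iff_finite.mp h1.1, by rw [← hb.image_eq, hb.injOn.ncard_image, h1.2]⟩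

/-- The part of the incidence variety over the zeros of `h` is a proper closed subset, so over a
generic system it has no points. This moves the roots of generic systems into a prescribed dense
open set. -/
theorem exists_generic_ne_zero (hg : ∀ i, g i (k₀ i) = 1) {h : A} (hh : h ≠ 0) :
    ∃ r : MvPolynomial (Σ i, κ i) ℂ, r ∉ RingHom.ker (incidenceHom k₀ g) ∧
      ∀ c : (Σ i, κ i) → ℂ, MvPolynomial.eval c r ≠ 0 → ∀ p : A →ₐ[ℂ] ℂ,
        (∀ i, ∑ k, c ⟨i, k⟩ * p (g i k) = 0) → p h ≠ 0 := by
  obtain ⟨a, ha, hψ⟩ := exists_ne_zero_of_isAlgebraic (A := (incidenceHom k₀ g).range)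
    (B := MvPolynomial (FreeVars k₀) A) (x := MvPolynomial.C h) (by simpa using hh)
  obtain ⟨r, rfl⟩ := AlgHom.rangeRestrict_surjective _ a
  refine ⟨r, fun h => ha (Subtype.ext h), fun c hc p hp => ?_⟩
  have := hψ (MvPolynomial.aevalTower p fun v => c v.1) (by
    have := aevalTower_incidenceHom hg hp r
    rw [← this] at hc
    exact hc)
  rwa [MvPolynomial.aevalTower_C] at this

end IncidenceGeneric

/-! ### Generic finiteness from dimension counts -/

section IncidenceAlgebraic

variable {ι : Type*} [Fintype ι] {κ : ι → Type*} [∀ i, Fintype (κ i)] {A : Type*} [CommRing A]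
  [Algebra ℂ A] [IsDomain A] {k₀ : ∀ i, κ i} {g : ∀ i, κ i → A}

theorem isAlgebraic_incidence_of_algebraicIndependent {τ : Type*} [Fintype τ] {n : ℕ}
    (hA : Algebra.trdeg ℂ A ≤ n) {x : τ → MvPolynomial (Σ i, κ i) ℂ}
    (hn : n + Fintype.card (Σ i, κ i) ≤ Fintype.card τ + Fintype.card ι)
    (hx : AlgebraicIndependent ℂ fun v => (incidenceHom k₀ g).rangeRestrict (x v)) :
    Algebra.IsAlgebraic (incidenceHom k₀ g).range (MvPolynomial (FreeVars k₀) A) := by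
  refine isAlgebraic_of_trdeg_le (trdeg_incidence_le hA hn) ?_
  have := hx.lift_cardinalMk_le_trdeg
  rw [Cardinal.mk_fintype, Cardinal.lift_natCast] at this
  simpa using this

theorem isAlgebraic_incidence_of_ker_eq_bot {n : ℕ} (hA : Algebra.trdeg ℂ A ≤ n)
    (hn : n ≤ Fintype.card ι) (hker : RingHom.ker (incidenceHom k₀ g) = ⊥) :
    Algebra.IsAlgebraic (incidenceHom k₀ g).range (MvPolynomial (FreeVars k₀) A) := by
  refine isAlgebraic_incidence_of_algebraicIndependent hA (x := MvPolynomial.X) (by omega) ?_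
  have hinj : Function.Injective (incidenceHom k₀ g).rangeRestrict := fun x y h =>
    (RingHom.injective_iff_ker_eq_bot _).mpr hker (congrArg Subtype.val h)
  exact (MvPolynomial.algebraicIndependent_X _ ℂ).map' hinj

theorem notMem_vars_of_dvd {σ : Type*} {f F : MvPolynomial σ ℂ} (hF : F ≠ 0) (h : f ∣ F) {v : σ}
    (hv : v ∉ F.vars) : v ∉ f.vars := by
  classical
  obtain ⟨d, rfl⟩ := h
  intro hvf
  rw [MvPolynomial.vars_def, Multiset.mem_toFinset, ← Multiset.count_pos, ←
    MvPolynomial.degreeOf_def] at hv hvf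
  rw [MvPolynomial.degreeOf_mul_eq (left_ne_zero_of_mul hF) (right_ne_zero_of_mul hF)] at hv
  omega

/-- All variables except one occurring in f stay algebraically independent modulo f, since a
relation among them would be a multiple of f not involving that variable. So the image has at least
|Σ| - 1 independent elements, as many as the dimension of the incidence variety allows. -/
theorem isAlgebraic_incidence_of_ker_eq_span {n : ℕ} (hA : Algebra.trdeg ℂ A ≤ n)
    (hn : n + 1 ≤ Fintype.card ι) {f : MvPolynomial (Σ i, κ i) ℂ} (hf : Irreducible f)
    (hker : RingHom.ker (incidenceHom k₀ g) = Ideal.span {f}) :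
    Algebra.IsAlgebraic (incidenceHom k₀ g).range (MvPolynomial (FreeVars k₀) A) := by
  classical
  obtain ⟨v₀, hv₀⟩ : f.vars.Nonempty := by
    rw [Finset.nonempty_iff_ne_empty]
    intro h
    rw [MvPolynomial.vars_eq_empty_iff_eq_C] at h
    refine hf.not_isUnit ?_
    rw [h]
    refine (isUnit_iff_ne_zero.mpr fun h0 => hf.ne_zero ?_).map MvPolynomial.C
    rw [h, h0, map_zero]
  refine isAlgebraic_incidence_of_algebraicIndependent (τ := {v : Σ i, κ i // v ≠ v₀}) hA
    (x := fun v => MvPolynomial.X v.1) ?_ ?_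
  · have : Fintype.card {v : Σ i, κ i // v ≠ v₀} = Fintype.card (Σ i, κ i) - 1 := by
      simp [Fintype.card_subtype_compl]
    omega
  · rw [algebraicIndependent_iff]
    intro G hG
    by_contra hne
    have hG' : MvPolynomial.rename Subtype.val G ∈ RingHom.ker (incidenceHom k₀ g) := by
      have e : (incidenceHom k₀ g).rangeRestrict.comp (MvPolynomial.rename Subtype.val) =
          MvPolynomial.aeval fun v : {v : Σ i, κ i // v ≠ v₀} =>
            (incidenceHom k₀ g).rangeRestrict (MvPolynomial.X v.1) :=
        MvPolynomial.algHom_ext fun v => by simp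
      exact congrArg Subtype.val ((DFunLike.congr_fun e G).trans hG)
    rw [hker, Ideal.mem_span_singleton] at hG'
    have h1 : MvPolynomial.rename (Subtype.val : {v : Σ i, κ i // v ≠ v₀} → _) G ≠ 0 := by
      rwa [Ne, map_eq_zero_iff _ (MvPolynomial.rename_injective _ Subtype.val_injective)]
    refine notMem_vars_of_dvd h1 hG' (fun h => ?_) hv₀
    obtain ⟨v, -, hv⟩ := MvPolynomial.mem_vars_rename _ _ h
    exact v.2 hv

end IncidenceAlgebraic

/-! ### Gluing the charts -/

section Atlas

variable {ι : Type*} {κ : ι → Type*} [∀ i, Fintype (κ i)] {P : Type*}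

/-- An affine chart of a set of points `P` with families of conditions `Z i c` that are, in terms
of the chart, linear equations with coefficients `c`. -/
structure AffineChart (Z : ∀ i, (κ i → ℂ) → P → Prop) where
  A : Type
  [commRing : CommRing A]
  [isDomain : IsDomain A]
  [algebra : Algebra ℂ A]
  [finiteType : Algebra.FiniteType ℂ A]
  pt : (A →ₐ[ℂ] ℂ) → P
  pt_injective : Function.Injective pt
  k₀ : ∀ i, κ i
  g : ∀ i, κ i → A
  g_base : ∀ i, g i (k₀ i) = 1
  zero_iff : ∀ i c ψ, Z i c (pt ψ) ↔ ∑ k, c k * ψ (g i k) = 0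

attribute [instance] AffineChart.commRing AffineChart.isDomain AffineChart.algebra
  AffineChart.finiteType

/-- A finite cover of an irreducible set of points by affine charts of dimension at most `n`. -/
structure AffineAtlas (Z : ∀ i, (κ i → ℂ) → P → Prop) (n : ℕ) where
  T : Type
  [finite : Finite T]
  base : T
  chart : T → AffineChart Z
  cover : ∀ p, ∃ a, p ∈ Set.range (chart a).pt
  overlap : ∀ a b, ∃ h : (chart a).A, h ≠ 0 ∧
    ∀ ψ : (chart a).A →ₐ[ℂ] ℂ, ψ h ≠ 0 → (chart a).pt ψ ∈ Set.range (chart b).pt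
  trdeg_le : ∀ a, Algebra.trdeg ℂ (chart a).A ≤ n

attribute [instance] AffineAtlas.finite

/-- The points at which all the conditions with the coefficients `c` hold. -/
def commonZeros (Z : ∀ i, (κ i → ℂ) → P → Prop) (c : (Σ i, κ i) → ℂ) : Set P :=
  {p | ∀ i, Z i (fun k => c ⟨i, k⟩) p}

/-- The ideal of the polynomials that vanish on all the consistent coefficients. -/
noncomputable def consistencyIdeal (Z : ∀ i, (κ i → ℂ) → P → Prop) : Ideal (MvPolynomial (Σ i, κ i) ℂ) :=
  MvPolynomial.vanishingIdeal ℂ {c | (commonZeros Z c).Nonempty}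

variable {Z : ∀ i, (κ i → ℂ) → P → Prop}

namespace AffineChart

variable (S : AffineChart Z)

theorem pt_mem_commonZeros_iff {c : (Σ i, κ i) → ℂ} {ψ : S.A →ₐ[ℂ] ℂ} :
    S.pt ψ ∈ commonZeros Z c ↔ ∀ i, ∑ k, c ⟨i, k⟩ * ψ (S.g i k) = 0 :=
  forall_congr' fun i => S.zero_iff i _ ψ

/-- The structure map of the incidence variety over the chart. -/
noncomputable abbrev inc : MvPolynomial (Σ i, κ i) ℂ →ₐ[ℂ] MvPolynomial (FreeVars S.k₀) S.A :=
  incidenceHom S.k₀ S.g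

end AffineChart

namespace AffineAtlas

variable {n : ℕ} (S : AffineAtlas Z n)

/-- A polynomial that vanishes on the incidence variety over one chart vanishes over its overlap
with any other chart, which is dense there. The kernel is therefore the same for all charts and
tests vanishing on all consistent systems. -/
theorem ker_inc [Finite ι] (a : S.T) : RingHom.ker (S.chart a).inc = consistencyIdeal Z := by
  apply le_antisymm
  · intro F hF
    refine MvPolynomial.mem_vanishingIdeal_iff.mpr fun c hc => ?_
    obtain ⟨p, hp⟩ := hc
    obtain ⟨b, ψ, rfl⟩ := S.cover p
    have h1 : F ∈ RingHom.ker (S.chart b).inc := by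
      obtain ⟨h, hh, hab⟩ := S.overlap b a
      refine mem_ker_of_forall_eval_eq_zero (S.chart b).g_base hh fun ψ' c' hψ' hc' => ?_
      obtain ⟨ψ'', h2⟩ := hab ψ' hψ'
      rw [← (S.chart b).pt_mem_commonZeros_iff, ← h2, (S.chart a).pt_mem_commonZeros_iff] at hc'
      exact eval_eq_zero_of_mem_ker (S.chart a).g_base hc' hF
    exact eval_eq_zero_of_mem_ker (S.chart b).g_base
      ((S.chart b).pt_mem_commonZeros_iff.mp hp) h1
  · intro F hF
    refine mem_ker_of_forall_eval_eq_zero (S.chart a).g_base one_ne_zero fun ψ c _ hc => ?_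
    exact MvPolynomial.mem_vanishingIdeal_iff.mp hF c
      ⟨_, (S.chart a).pt_mem_commonZeros_iff.mpr hc⟩

theorem isPrime_consistencyIdeal {n : ℕ} (S : AffineAtlas Z n) [Finite ι] : (consistencyIdeal Z).IsPrime := by
  rw [← S.ker_inc S.base]
  infer_instance

/-- For a generic system no root in any chart lies off the overlap with the base chart, so all roots
can be counted in the base chart. `q` controls that count, and `r a` the roots in chart `a`. -/
theorem exists_generic_ncard [Finite ι]
    (halg : ∀ a, Algebra.IsAlgebraic (S.chart a).inc.range
      (MvPolynomial (FreeVars (S.chart a).k₀) (S.chart a).A)) :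
    ∃ (N : ℕ) (q : MvPolynomial (Σ i, κ i) ℂ), q ∉ consistencyIdeal Z ∧
      ∀ c : (Σ i, κ i) → ℂ, (∀ F ∈ consistencyIdeal Z, MvPolynomial.eval c F = 0) →
        MvPolynomial.eval c q ≠ 0 → commonZeros Z c ⊆ Set.range (S.chart S.base).pt ∧
          (commonZeros Z c).Finite ∧ (commonZeros Z c).ncard = N := by
  have := Fintype.ofFinite S.T
  obtain ⟨N, q, hq, hN⟩ := exists_generic_count (S.chart S.base).g_base
  choose h hh hover using fun a => S.overlap a S.base
  choose r hr hr' using fun a => exists_generic_ne_zero (S.chart a).g_base (hh a)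
  have hP := S.isPrime_consistencyIdeal
  rw [S.ker_inc] at hq
  have hr (a : S.T) : r a ∉ consistencyIdeal Z := S.ker_inc a ▸ hr a
  refine ⟨N, q * ∏ a, r a, ?_, fun c hc hqc => ?_⟩
  · rw [hP.mul_mem_iff_mem_or_mem, hP.prod_mem_iff]
    simpa [hq] using hr
  rw [map_mul, map_prod] at hqc
  have hra (a : S.T) : MvPolynomial.eval c (r a) ≠ 0 :=
    Finset.prod_ne_zero_iff.mp (right_ne_zero_of_mul hqc) a (Finset.mem_univ a)
  have hset : commonZeros Z c = (S.chart S.base).pt '' {p : (S.chart S.base).A →ₐ[ℂ] ℂ |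
      ∀ i, ∑ k, c ⟨i, k⟩ * p ((S.chart S.base).g i k) = 0} := by
    apply Set.Subset.antisymm
    · intro p hp
      obtain ⟨a, ψ, rfl⟩ := S.cover p
      obtain ⟨ψ', h1⟩ := hover a ψ (hr' a c (hra a) ψ ((S.chart a).pt_mem_commonZeros_iff.mp hp))
      rw [← h1] at hp ⊢
      exact ⟨ψ', (S.chart _).pt_mem_commonZeros_iff.mp hp, rfl⟩
    · rintro _ ⟨ψ, hψ, rfl⟩
      exact (S.chart _).pt_mem_commonZeros_iff.mpr hψ
  obtain ⟨h1, h2⟩ := hN c (by rwa [S.ker_inc]) (left_ne_zero_of_mul hqc)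
  rw [hset]
  exact ⟨Set.image_subset_range _ _, h1.image _, by rw [Set.ncard_image_of_injective _ (S.chart _).pt_injective, h2]⟩

/-- The atlas for the subfamily of conditions indexed by `ι'`. -/
def comp {ι' : Type*} (e : ι' → ι) : AffineAtlas (κ := fun j => κ (e j)) (fun j => Z (e j)) n where
  T := S.T
  base := S.base
  chart a :=
    { A := (S.chart a).A
      pt := (S.chart a).pt
      pt_injective := (S.chart a).pt_injective
      k₀ := fun j => (S.chart a).k₀ (e j)
      g := fun j => (S.chart a).g (e j)
      g_base := fun j => (S.chart a).g_base (e j)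
      zero_iff := fun j => (S.chart a).zero_iff (e j) }
  cover := S.cover
  overlap := S.overlap
  trdeg_le := S.trdeg_le

theorem exists_generic_ncard_of_eq_bot [Fintype ι] (hn : n ≤ Fintype.card ι)
    (hJ : consistencyIdeal Z = ⊥) :
    ∃ (N : ℕ) (q : MvPolynomial (Σ i, κ i) ℂ), q ≠ 0 ∧
      ∀ c : (Σ i, κ i) → ℂ,
        MvPolynomial.eval c q ≠ 0 → commonZeros Z c ⊆ Set.range (S.chart S.base).pt ∧
          (commonZeros Z c).Finite ∧ (commonZeros Z c).ncard = N := by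
  obtain ⟨N, q, hq, h⟩ := S.exists_generic_ncard fun a =>
    isAlgebraic_incidence_of_ker_eq_bot (S.trdeg_le a) hn ((S.ker_inc a).trans hJ)
  exact ⟨N, q, by simpa [hJ] using hq, fun c => h c (by simp [hJ])⟩

theorem exists_generic_ncard_of_eq_span {n : ℕ} (S : AffineAtlas Z n) [Fintype ι] (hn : n + 1 ≤ Fintype.card ι)
    {f : MvPolynomial (Σ i, κ i) ℂ} (hf : Irreducible f) (hJ : consistencyIdeal Z = Ideal.span {f}) :
    ∃ (N : ℕ) (q : MvPolynomial (Σ i, κ i) ℂ), ¬ f ∣ q ∧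
      ∀ c : (Σ i, κ i) → ℂ, MvPolynomial.eval c f = 0 →
        MvPolynomial.eval c q ≠ 0 → (commonZeros Z c).Finite ∧ (commonZeros Z c).ncard = N := by
  obtain ⟨N, q, hq, h⟩ := S.exists_generic_ncard fun a =>
    isAlgebraic_incidence_of_ker_eq_span (S.trdeg_le a) hn hf ((S.ker_inc a).trans hJ)
  rw [hJ, Ideal.mem_span_singleton] at hq
  refine ⟨N, q, hq, fun c hc hqc => (h c (fun F hF => ?_) hqc).2⟩
  rw [hJ, Ideal.mem_span_singleton] at hF
  obtain ⟨d, rfl⟩ := hF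
  rw [map_mul, hc, zero_mul]

/-- Either consistent systems are dense and the projection is generically finite, or a nonzero
polynomial vanishes on all of them and the generic number of roots is 0. -/
theorem exists_generic_ncard_of_le_card {n : ℕ} (S : AffineAtlas Z n) [Fintype ι] (hn : n ≤ Fintype.card ι) :
    ∃ (N : ℕ) (q : MvPolynomial (Σ i, κ i) ℂ), q ≠ 0 ∧
      ∀ c : (Σ i, κ i) → ℂ, MvPolynomial.eval c q ≠ 0 →
        (commonZeros Z c).Finite ∧ (commonZeros Z c).ncard = N := by
  by_cases hJ : consistencyIdeal Z = ⊥
  · obtain ⟨N, q, hq, h⟩ := S.exists_generic_ncard_of_eq_bot hn hJ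
    exact ⟨N, q, hq, fun c hc => (h c hc).2⟩
  · obtain ⟨q, hq, hq0⟩ := (Submodule.ne_bot_iff _).mp hJ
    refine ⟨0, q, hq0, fun c hc => ?_⟩
    have : commonZeros Z c = ∅ := by
      rw [← Set.not_nonempty_iff_eq_empty]
      exact fun h => hc (MvPolynomial.mem_vanishingIdeal_iff.mp hq c h)
    simp [this]

end AffineAtlas

end Atlas

/-! ### Weighted homogeneity -/

section Scaling

variable {σ : Type*} (w : σ → ℕ)

/-- The homomorphism `X_v ↦ T^{w v} X_v`, whose coefficients are the weighted homogeneous parts. -/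
noncomputable def weightedScaling : MvPolynomial σ ℂ →ₐ[ℂ] Polynomial (MvPolynomial σ ℂ) :=
  MvPolynomial.aeval fun v => Polynomial.C (MvPolynomial.X v) * Polynomial.X ^ w v

theorem weightedScaling_monomial (s : σ →₀ ℕ) (a : ℂ) :
    weightedScaling w (MvPolynomial.monomial s a) =
      Polynomial.monomial (Finsupp.weight w s) (MvPolynomial.monomial s a) := by
  rw [weightedScaling, MvPolynomial.aeval_monomial, MvPolynomial.monomial_eq,
    ← Polynomial.C_mul_X_pow_eq_monomial, map_mul, Finsupp.weight_apply]
  simp only [Finsupp.prod, Finsupp.sum, mul_pow, Finset.prod_mul_distrib, map_prod, map_pow,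
    ← pow_mul, Finset.prod_pow_eq_pow_sum, smul_eq_mul, mul_assoc]
  simp only [mul_comm (w _)]
  rfl

theorem coeff_weightedScaling (F : MvPolynomial σ ℂ) (k : ℕ) :
    (weightedScaling w F).coeff k = MvPolynomial.weightedHomogeneousComponent w k F := by
  classical
  induction F using MvPolynomial.induction_on' with
  | add p q hp hq => rw [map_add, map_add, Polynomial.coeff_add, hp, hq]
  | monomial s a =>
    rw [weightedScaling_monomial, Polynomial.coeff_monomial]
    split_ifs with h
    · rw [MvPolynomial.IsWeightedHomogeneous.weightedHomogeneousComponent_same]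
      exact MvPolynomial.isWeightedHomogeneous_monomial w s a h
    · rw [MvPolynomial.IsWeightedHomogeneous.weightedHomogeneousComponent_ne _
        (MvPolynomial.isWeightedHomogeneous_monomial w s a rfl)]
      exact fun h' => h h'.symm

theorem eval_weightedScaling (F : MvPolynomial σ ℂ) (c : σ → ℂ) (t : ℂ) :
    ((weightedScaling w F).map (MvPolynomial.eval c)).eval t =
      MvPolynomial.eval (fun v => t ^ w v * c v) F := by
  rw [Polynomial.eval_map]
  induction F using MvPolynomial.induction_on with
  | C a => simp [weightedScaling]
  | add p q hp hq => rw [map_add, Polynomial.eval₂_add, hp, hq, map_add]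
  | mul_X p v hp =>
    rw [map_mul, Polynomial.eval₂_mul, hp, map_mul]
    rw [weightedScaling, MvPolynomial.aeval_X, Polynomial.eval₂_mul, Polynomial.eval₂_C,
      Polynomial.eval₂_X_pow, MvPolynomial.eval_X, MvPolynomial.eval_X]
    ring

theorem weightedScaling_of_isWeightedHomogeneous {F : MvPolynomial σ ℂ} {k : ℕ}
    (h : MvPolynomial.IsWeightedHomogeneous w F k) :
    weightedScaling w F = Polynomial.monomial k F := by
  ext1 j
  rw [coeff_weightedScaling, Polynomial.coeff_monomial]
  split_ifs with hj
  · subst hj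
    exact h.weightedHomogeneousComponent_same
  · exact h.weightedHomogeneousComponent_ne _ (Ne.symm hj)

/-- Highest and lowest exponents of T both add up in a product over a domain. They agree for the
homogeneous polynomial F, hence for each of its factors. -/
theorem isWeightedHomogeneous_of_dvd {f F : MvPolynomial σ ℂ} {k : ℕ} (hF : F ≠ 0)
    (h : MvPolynomial.IsWeightedHomogeneous w F k) (hf : f ∣ F) :
    ∃ D, MvPolynomial.IsWeightedHomogeneous w f D := by
  obtain ⟨e, rfl⟩ := hf
  have h1 := weightedScaling_of_isWeightedHomogeneous w h
  rw [map_mul] at h1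
  have h0 : weightedScaling w f * weightedScaling w e ≠ 0 := by
    rw [h1]
    simpa using hF
  have h2 := Polynomial.natDegree_mul (left_ne_zero_of_mul h0) (right_ne_zero_of_mul h0)
  have h3 := Polynomial.natTrailingDegree_mul (left_ne_zero_of_mul h0) (right_ne_zero_of_mul h0)
  rw [h1, Polynomial.natDegree_monomial_eq _ hF] at h2
  rw [h1, Polynomial.natTrailingDegree_monomial hF] at h3
  have h4 := Polynomial.natTrailingDegree_le_natDegree (weightedScaling w f)
  have h5 := Polynomial.natTrailingDegree_le_natDegree (weightedScaling w e)
  refine ⟨(weightedScaling w f).natDegree, fun s hs => ?_⟩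
  classical
  by_contra hne
  have h6 : ((weightedScaling w f).coeff (Finsupp.weight w s)).coeff s = f.coeff s := by
    rw [coeff_weightedScaling, MvPolynomial.coeff_weightedHomogeneousComponent, if_pos rfl]
  rcases lt_or_gt_of_ne hne with h7 | h7
  · rw [Polynomial.coeff_eq_zero_of_lt_natTrailingDegree (by omega)] at h6
    exact hs h6.symm
  · rw [Polynomial.coeff_eq_zero_of_natDegree_lt h7] at h6
    exact hs h6.symm

theorem exists_coeff_weightedScaling_ne_zero {f : MvPolynomial σ ℂ} (hf : f ≠ 0) :
    ∃ k, (weightedScaling w f).coeff k ≠ 0 := by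
  by_contra! h
  apply hf
  rw [← MvPolynomial.sum_weightedHomogeneousComponent w f]
  simp [← coeff_weightedScaling, h]

theorem weightedTotalDegree_of_isWeightedHomogeneous {F : MvPolynomial σ ℂ} (hF : F ≠ 0) {D : ℕ}
    (h : MvPolynomial.IsWeightedHomogeneous w F D) : MvPolynomial.weightedTotalDegree w F = D := by
  have := h.weighted_total_degree hF
  rw [MvPolynomial.weightedTotalDegree_coe _ _ hF] at this
  exact_mod_cast this

end Scaling

/-! ### Generic specialisations of an irreducible polynomial -/

section GenericRoots

open Polynomial

variable {R : Type*} [CommRing R] [IsDomain R] [UniqueFactorizationMonoid R]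

/-- By Gauss's lemma F stays irreducible over the fraction field, and there it is coprime to q;
clearing denominators in a Bézout relation leaves a constant. A constant F is itself such a
constant. -/
theorem exists_bezout_of_irreducible {F q : R[X]} (hF : Irreducible F) (hq : ¬ F ∣ q) :
    ∃ r : R, r ≠ 0 ∧ ∃ u v : R[X], u * F + v * q = C r := by
  by_cases hdeg : F.natDegree = 0
  · obtain ⟨a, rfl⟩ := natDegree_eq_zero.mp hdeg
    refine ⟨a, ?_, 1, 0, by simp⟩
    rintro rfl
    exact hF.ne_zero C_0
  let K := FractionRing R
  have hRK := IsFractionRing.injective R K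
  have hcop : IsCoprime (F.map (algebraMap R K)) (q.map (algebraMap R K)) := by
    have hprim := hF.isPrimitive hdeg
    rw [Irreducible.coprime_iff_not_dvd
      ((hprim.irreducible_iff_irreducible_map_fraction_map (K := K)).mp hF)]
    rintro ⟨h, hh⟩
    obtain ⟨d, H, hd, hH⟩ := exists_clear_denominators R h
    have h1 : C d * q = F * H := by
      apply Polynomial.map_injective _ hRK
      rw [Polynomial.map_mul, Polynomial.map_mul, Polynomial.map_C, hH, hh]
      ring
    rcases hF.prime.dvd_or_dvd ⟨H, h1⟩ with h2 | h2
    · have := natDegree_le_of_dvd h2 (by simpa using hd)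
      rw [natDegree_C] at this
      omega
    · exact hq h2
  obtain ⟨u, v, h⟩ := hcop
  obtain ⟨du, U, hdu, hU⟩ := exists_clear_denominators R u
  obtain ⟨dv, V, hdv, hV⟩ := exists_clear_denominators R v
  refine ⟨du * dv, mul_ne_zero hdu hdv, C dv * U, C du * V, Polynomial.map_injective _ hRK ?_⟩
  simp only [Polynomial.map_add, Polynomial.map_mul, Polynomial.map_C, map_mul, hU, hV]
  linear_combination C (algebraMap R K du) * C (algebraMap R K dv) * h

theorem exists_separability_constant [CharZero R] {F : R[X]} (hF : Irreducible F) :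
    ∃ r : R, r ≠ 0 ∧ ∃ u v : R[X], u * F + v * derivative F = C r := by
  by_cases hdeg : F.natDegree = 0
  · obtain ⟨a, rfl⟩ := natDegree_eq_zero.mp hdeg
    refine ⟨a, ?_, 1, 0, by simp⟩
    rintro rfl
    exact hF.ne_zero C_0
  refine exists_bezout_of_irreducible hF fun h => ?_
  have h1 : (derivative F).natDegree < F.natDegree := natDegree_derivative_lt hdeg
  have h2 := natDegree_le_of_dvd h fun h0 => hdeg (derivative_eq_zero.mp h0)
  omega

/-- For generic values of the coefficients, an irreducible polynomial has as many roots as its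
degree, and none of them is a root of a given polynomial that it does not divide. -/
theorem exists_generic_roots [CharZero R] {F q : R[X]} (hF : Irreducible F) (hq : ¬ F ∣ q) :
    ∃ r : R, r ≠ 0 ∧ ∀ φ : R →+* ℂ, φ r ≠ 0 →
      (F.map φ).roots.toFinset.card = F.natDegree ∧ F.map φ ≠ 0 ∧
      ∀ t, (F.map φ).eval t = 0 → (q.map φ).eval t ≠ 0 := by
  obtain ⟨r₁, hr₁, u₁, v₁, h₁⟩ := exists_bezout_of_irreducible hF hq
  obtain ⟨r₂, hr₂, u₂, v₂, h₂⟩ := exists_separability_constant hF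
  -- `r₁` keeps the roots of F away from those of q, `r₂` keeps them simple, and the leading
  -- coefficient keeps their number.
  refine ⟨r₁ * r₂ * F.leadingCoeff, mul_ne_zero (mul_ne_zero hr₁ hr₂)
    (leadingCoeff_ne_zero.mpr hF.ne_zero), fun φ hφ => ?_⟩
  rw [map_mul, map_mul] at hφ
  have hφlc := right_ne_zero_of_mul hφ
  have hφ₁ := left_ne_zero_of_mul (left_ne_zero_of_mul hφ)
  have hφ₂ := right_ne_zero_of_mul (left_ne_zero_of_mul hφ)
  have hdeg : (F.map φ).natDegree = F.natDegree := natDegree_map_of_leadingCoeff_ne_zero _ hφlc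
  have hsep : (F.map φ).Separable := by
    have h' := congrArg (Polynomial.map φ) h₂
    simp only [Polynomial.map_add, Polynomial.map_mul, ← derivative_map, Polynomial.map_C] at h'
    refine ⟨C (φ r₂)⁻¹ * u₂.map φ, C (φ r₂)⁻¹ * v₂.map φ, ?_⟩
    rw [mul_assoc, mul_assoc, ← mul_add, h', ← C_mul, inv_mul_cancel₀ hφ₂, C_1]
  refine ⟨?_, ?_, fun t ht hqt => hφ₁ ?_⟩
  · rw [Multiset.toFinset_card_of_nodup (nodup_roots hsep), ← hdeg]
    exact (IsAlgClosed.splits _).natDegree_eq_card_roots.symm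
  · intro h
    apply hφlc
    rw [← coeff_natDegree, ← coeff_map, h, coeff_zero]
  · have h' := congrArg (fun p => (Polynomial.map φ p).eval t) h₁
    simp only [Polynomial.map_add, Polynomial.map_mul, eval_add, eval_mul, ht, hqt, mul_zero,
      add_zero, Polynomial.map_C, eval_C] at h'
    exact h'.symm

end GenericRoots

/-! ### Polynomials in one distinguished variable -/

section IsolatedVariable

variable {σ : Type*} (v₀ : σ)

open Classical in
/-- Polynomials in the variables `σ` as polynomials in the variable `v₀`. -/
noncomputable def isolateVariable :
    MvPolynomial σ ℂ ≃ₐ[ℂ] Polynomial (MvPolynomial {v : σ // v ≠ v₀} ℂ) :=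
  (MvPolynomial.renameEquiv ℂ (Equiv.optionSubtypeNe v₀).symm).trans
    (MvPolynomial.optionEquivLeft ℂ _)

@[simp]
theorem isolateVariable_X_self : isolateVariable v₀ (MvPolynomial.X v₀) = Polynomial.X := by
  simp [isolateVariable]

@[simp]
theorem isolateVariable_rename (G : MvPolynomial {v : σ // v ≠ v₀} ℂ) :
    isolateVariable v₀ (MvPolynomial.rename Subtype.val G) = Polynomial.C G := by
  classical
  have : (isolateVariable v₀).toAlgHom.comp (MvPolynomial.rename Subtype.val) =
      IsScalarTower.toAlgHom ℂ (MvPolynomial {v : σ // v ≠ v₀} ℂ) (Polynomial _) := by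
    refine MvPolynomial.algHom_ext fun v => ?_
    simp [isolateVariable, Equiv.optionSubtypeNe_symm_of_ne v.2]
  exact DFunLike.congr_fun this G

theorem eval_isolateVariable (c : σ → ℂ) (F : MvPolynomial σ ℂ) :
    ((isolateVariable v₀ F).map (MvPolynomial.eval fun v : {v : σ // v ≠ v₀} => c v)).eval (c v₀) =
      MvPolynomial.eval c F := by
  rw [Polynomial.eval_map]
  induction F using MvPolynomial.induction_on with
  | C a =>
    have := isolateVariable_rename v₀ (MvPolynomial.C a)
    rw [MvPolynomial.rename_C] at this
    simp [this]
  | add p q hp hq => rw [map_add, Polynomial.eval₂_add, hp, hq, map_add]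
  | mul_X p v hp =>
    rw [map_mul, Polynomial.eval₂_mul, hp, map_mul, MvPolynomial.eval_X]
    by_cases hv : v = v₀
    · rw [hv, isolateVariable_X_self, Polynomial.eval₂_X]
    · have := isolateVariable_rename v₀ (MvPolynomial.X ⟨v, hv⟩)
      rw [MvPolynomial.rename_X] at this
      rw [this, Polynomial.eval₂_C, MvPolynomial.eval_X]

theorem eval_congr_of_vars {c c' : σ → ℂ} {F : MvPolynomial σ ℂ} (h : ∀ v ∈ F.vars, c v = c' v) :
    MvPolynomial.eval c F = MvPolynomial.eval c' F :=
  MvPolynomial.eval₂Hom_congr' rfl (fun v hv _ => h v hv) rfl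

/-- The degree in `v₀` of a weighted homogeneous polynomial whose leading coefficient in `v₀` is
free of weighted variables. -/
theorem natDegree_isolateVariable_of_leadingCoeff {w : σ → ℕ} (hw : w v₀ = 1)
    {f : MvPolynomial σ ℂ} (hf : f ≠ 0) {D : ℕ} (hD : MvPolynomial.IsWeightedHomogeneous w f D)
    (hlc : ∀ v ∈ (isolateVariable v₀ f).leadingCoeff.vars, w v.1 = 0) :
    (isolateVariable v₀ f).natDegree = D := by
  classical
  set F := isolateVariable v₀ f with hF
  have hF0 : F ≠ 0 := by simpa [hF] using hf
  obtain ⟨x, hx⟩ : ∃ x, MvPolynomial.eval x F.leadingCoeff ≠ 0 := by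
    by_contra! h
    exact Polynomial.leadingCoeff_ne_zero.mpr hF0 (MvPolynomial.funext (by simpa using h))
  have hhom (c : σ → ℂ) : MvPolynomial.eval (fun v => 2 ^ w v * c v) f =
      2 ^ D * MvPolynomial.eval c f := by
    rw [← eval_weightedScaling, weightedScaling_of_isWeightedHomogeneous w hD]
    simp [mul_comm]
  -- In the top degree d in `v₀`, scaling by 2 contributes 2 ^ d on the left, since the leading
  -- coefficient does not notice the scaling, and 2 ^ D on the right by homogeneity. The number 2
  -- serves only because its powers are distinct.
  have hpoly : (F.map (MvPolynomial.eval fun v => 2 ^ w v.1 * x v)).comp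
      (Polynomial.C 2 * Polynomial.X) =
      Polynomial.C (2 ^ D) * F.map (MvPolynomial.eval x) := by
    refine Polynomial.funext fun t => ?_
    let c : σ → ℂ := fun v => if h : v = v₀ then t else x ⟨v, h⟩
    have h0 : c v₀ = t := dif_pos rfl
    have h1 : (fun v : {v : σ // v ≠ v₀} => c v) = x := funext fun v => dif_neg v.2
    have h2 := eval_isolateVariable v₀ c f
    have h3 := eval_isolateVariable v₀ (fun v => 2 ^ w v * c v) f
    rw [h1, h0] at h2
    simp only [hw, h0, pow_one] at h3
    have h4 : (fun v : {v : σ // v ≠ v₀} => 2 ^ w v.1 * c v) = fun v => 2 ^ w v.1 * x v := by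
      rw [← h1]
    rw [h4, hhom, ← h2] at h3
    simpa [Polynomial.eval_comp] using h3
  have hc := congrArg (fun p => p.coeff F.natDegree) hpoly
  simp only [Polynomial.comp_C_mul_X_coeff, Polynomial.coeff_map, Polynomial.coeff_natDegree,
    Polynomial.coeff_C_mul] at hc
  rw [eval_congr_of_vars (c' := x) (by intro v hv; simp [hlc v hv]), mul_comm] at hc
  have h2 : (2 : ℂ) ^ F.natDegree = 2 ^ D := mul_right_cancel₀ hx hc
  exact Nat.pow_right_injective le_rfl (by exact_mod_cast h2)

end IsolatedVariable

/-! ### Homogeneity and the leading coefficient of the equation of R -/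

section Degree

variable {n : ℕ} {κ : Fin (n + 1) → Type*} [∀ i, Fintype (κ i)] {P : Type*}
  {Z : ∀ i, (κ i → ℂ) → P → Prop} (i : Fin (n + 1))

/-- The variables of all the groups except the `i`-th. -/
abbrev otherVars : (Σ j : Fin n, κ (i.succAbove j)) → Σ i, κ i :=
  fun v => ⟨i.succAbove v.1, v.2⟩

theorem otherVars_injective : Function.Injective (otherVars (κ := κ) i) := by
  rintro ⟨j, k⟩ ⟨j', k'⟩ h
  obtain rfl : j = j' := i.succAbove_right_injective (congrArg Sigma.fst h)
  simpa using h

theorem mem_commonZeros_iff_succAbove {c : (Σ i, κ i) → ℂ} {p : P} :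
    p ∈ commonZeros Z c ↔ Z i (fun k => c ⟨i, k⟩) p ∧
      p ∈ commonZeros (fun j => Z (i.succAbove j)) (c ∘ otherVars i) :=
  Fin.forall_iff_succAbove i

namespace AffineAtlas

theorem Z_smul (S : AffineAtlas Z n) {i : Fin (n + 1)} {c : κ i → ℂ} {p : P} (h : Z i c p) (t : ℂ) :
    Z i (fun k => t * c k) p := by
  obtain ⟨a, ψ, rfl⟩ := S.cover p
  rw [(S.chart a).zero_iff] at h ⊢
  simp only [mul_assoc, ← Finset.mul_sum, h, mul_zero]

/-- Multiplying one section by a constant preserves its zeros, so at a consistent system the scaled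
polynomial vanishes for all t, and with it each coefficient. -/
theorem coeff_weightedScaling_mem (S : AffineAtlas Z n) {F : MvPolynomial (Σ i, κ i) ℂ}
    (hF : F ∈ consistencyIdeal Z) (k : ℕ) :
    (weightedScaling (LinearSeries.entryWeight i) F).coeff k ∈ consistencyIdeal Z := by
  refine MvPolynomial.mem_vanishingIdeal_iff.mpr fun c hc => ?_
  obtain ⟨p, hp⟩ := hc
  have h0 : (weightedScaling (LinearSeries.entryWeight i) F).map (MvPolynomial.eval c) = 0 := by
    refine Polynomial.funext fun t => ?_
    rw [eval_weightedScaling, Polynomial.eval_zero]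
    refine MvPolynomial.mem_vanishingIdeal_iff.mp hF _ ⟨p, fun j => ?_⟩
    -- The weight of a variable depends only on its group, so any member of group `j` can represent
    -- it.
    have := S.Z_smul (hp j) (t ^ LinearSeries.entryWeight (κ := κ) i ⟨j, S.chart S.base |>.k₀ j⟩)
    exact this
  have := congrArg (fun p => p.coeff k) h0
  rwa [Polynomial.coeff_map, Polynomial.coeff_zero] at this

/-- Some homogeneous component of f is nonzero, and it lies in the ideal generated by f; so f
divides a homogeneous polynomial. -/
theorem exists_isWeightedHomogeneous (S : AffineAtlas Z n) {f : MvPolynomial (Σ i, κ i) ℂ}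
    (hf : f ≠ 0) (hJ : consistencyIdeal Z = Ideal.span {f}) :
    ∃ D, MvPolynomial.IsWeightedHomogeneous (LinearSeries.entryWeight i) f D := by
  obtain ⟨k, hk⟩ := exists_coeff_weightedScaling_ne_zero (LinearSeries.entryWeight i) hf
  have h := S.coeff_weightedScaling_mem i (F := f) (hJ ▸ Ideal.mem_span_singleton_self f) k
  rw [hJ, Ideal.mem_span_singleton] at h
  refine isWeightedHomogeneous_of_dvd (LinearSeries.entryWeight i) (k := k) hk ?_ h
  rw [coeff_weightedScaling]
  exact MvPolynomial.weightedHomogeneousComponent_isWeightedHomogeneous (w := LinearSeries.entryWeight i) k f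

end AffineAtlas

section LeadingCoefficient

variable {A : Type*} [CommRing A] [Algebra ℂ A] {k₀ : ∀ i, κ i} {g : ∀ i, κ i → A}

theorem rename_incidenceHom (F : MvPolynomial (Σ j : Fin n, κ (i.succAbove j)) ℂ) :
    MvPolynomial.rename
      (fun v : FreeVars (fun j => k₀ (i.succAbove j)) => (⟨otherVars i v.1, v.2⟩ : FreeVars k₀))
      (incidenceHom (fun j => k₀ (i.succAbove j)) (fun j => g (i.succAbove j)) F) =
    incidenceHom k₀ g (MvPolynomial.rename (otherVars i) F) := by
  induction F using MvPolynomial.induction_on with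
  | C a =>
    have h1 := (incidenceHom k₀ g).commutes a
    have h2 := (incidenceHom (fun j => k₀ (i.succAbove j)) (fun j => g (i.succAbove j))).commutes a
    rw [MvPolynomial.algebraMap_eq, MvPolynomial.algebraMap_apply] at h1 h2
    rw [MvPolynomial.rename_C, h1, h2, MvPolynomial.rename_C]
  | add p q hp hq => simp only [map_add, hp, hq]
  | mul_X p v hp =>
    rw [map_mul, map_mul, hp, map_mul, map_mul, MvPolynomial.rename_X]
    congr 1
    by_cases hv : v.2 = k₀ (i.succAbove v.1)
    · obtain ⟨j, k⟩ := v
      obtain rfl : k = k₀ (i.succAbove j) := hv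
      rw [incidenceHom_X_base (k₀ := fun j => k₀ (i.succAbove j)), incidenceHom_X_base]
      simp
    · rw [incidenceHom_X_free (k₀ := fun j => k₀ (i.succAbove j)) ⟨v, hv⟩,
        incidenceHom_X_free ⟨otherVars i v, hv⟩, MvPolynomial.rename_X]

/-- If the incidence variety of the other groups dominates their space of coefficients, then
`X_{i,k₀ i}` satisfies an equation in the incidence algebra whose leading coefficient only
involves the other groups. -/
theorem exists_equation_of_injective [IsDomain A] (hA : Algebra.trdeg ℂ A ≤ n)
    (hker : RingHom.ker (incidenceHom (fun j => k₀ (i.succAbove j)) (fun j => g (i.succAbove j))) = ⊥) :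
    ∃ (h : MvPolynomial (Σ j : Fin n, κ (i.succAbove j)) ℂ) (s : ℕ)
      (F : MvPolynomial (Σ i, κ i) ℂ), h ≠ 0 ∧ F ∈ RingHom.ker (incidenceHom k₀ g) ∧
      (isolateVariable (⟨i, k₀ i⟩ : Σ i, κ i) F).leadingCoeff = MvPolynomial.rename
        (fun v => (⟨otherVars i v, fun h => i.succAbove_ne v.1 (congrArg Sigma.fst h)⟩ :
          {v : Σ i, κ i // v ≠ ⟨i, k₀ i⟩})) (h ^ s) := by
  classical
  set φ' := incidenceHom (fun j => k₀ (i.succAbove j)) (fun j => g (i.succAbove j)) with hφ'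
  let r : MvPolynomial (Σ j : Fin n, κ (i.succAbove j)) ℂ →ₐ[ℂ]
      MvPolynomial {v : Σ i, κ i // v ≠ ⟨i, k₀ i⟩} ℂ := MvPolynomial.rename
    fun v => ⟨otherVars i v, fun h => i.succAbove_ne v.1 (congrArg Sigma.fst h)⟩
  let Φ : MvPolynomial {v : Σ i, κ i // v ≠ ⟨i, k₀ i⟩} ℂ →ₐ[ℂ] MvPolynomial (FreeVars k₀) A :=
    (incidenceHom k₀ g).comp (MvPolynomial.rename Subtype.val)
  let ρ := MvPolynomial.rename (R := A)
      (fun v : FreeVars (fun j => k₀ (i.succAbove j)) => (⟨otherVars i v.1, v.2⟩ : FreeVars k₀))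
  have hρ (F) : ρ (φ' F) = Φ (r F) := by
    rw [rename_incidenceHom i F]
    simp only [Φ, r, AlgHom.comp_apply, MvPolynomial.rename_rename]
    rfl
  let _ : Algebra (MvPolynomial (Σ j : Fin n, κ (i.succAbove j)) ℂ)
    (MvPolynomial (FreeVars (fun j => k₀ (i.succAbove j))) A) := φ'.toRingHom.toAlgebra
  have : IsScalarTower ℂ (MvPolynomial (Σ j : Fin n, κ (i.succAbove j)) ℂ)
    (MvPolynomial (FreeVars (fun j => k₀ (i.succAbove j))) A) := IsScalarTower.of_algHom φ'
  have : FaithfulSMul (MvPolynomial (Σ j : Fin n, κ (i.succAbove j)) ℂ)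
      (MvPolynomial (FreeVars (fun j => k₀ (i.succAbove j))) A) :=
    (faithfulSMul_iff_algebraMap_injective _ _).mpr ((RingHom.injective_iff_ker_eq_bot _).mpr hker)
  have : Algebra.IsAlgebraic (MvPolynomial (Σ j : Fin n, κ (i.succAbove j)) ℂ)
      (MvPolynomial (FreeVars (fun j => k₀ (i.succAbove j))) A) :=
    isAlgebraic_of_trdeg_le (d := Fintype.card (Σ j : Fin n, κ (i.succAbove j)))
      (trdeg_incidence_le hA (by simp [add_comm])) (by simp)
  -- By dominance and the dimension count, the incidence ring of the other groups is algebraic over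
  -- their polynomial ring, so a single `h` makes all the `g i k` integral.
  obtain ⟨h, hh, hint⟩ := Algebra.IsAlgebraic.exists_integral_multiples
    (MvPolynomial (Σ j : Fin n, κ (i.succAbove j)) ℂ)
    (Finset.univ.image fun k => (MvPolynomial.C (g i k) :
      MvPolynomial (FreeVars (fun j => k₀ (i.succAbove j))) A))
  let _ : Algebra (MvPolynomial {v : Σ i, κ i // v ≠ ⟨i, k₀ i⟩} ℂ)
    (MvPolynomial (FreeVars k₀) A) := Φ.toRingHom.toAlgebra
  have hint' (k : κ i) : IsIntegral (MvPolynomial {v : Σ i, κ i // v ≠ ⟨i, k₀ i⟩} ℂ)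
      (Φ (r h) * MvPolynomial.C (g i k) : MvPolynomial (FreeVars k₀) A) := by
    have h1 := hint (MvPolynomial.C (g i k)) (Finset.mem_image_of_mem _ (Finset.mem_univ k))
    have h2 := h1.map_of_comp_eq r.toRingHom ρ.toRingHom (by
      refine RingHom.ext fun F => ?_
      exact (hρ F).symm)
    have h3 : ρ.toRingHom (h • MvPolynomial.C (g i k)) = Φ (r h) * MvPolynomial.C (g i k) := by
      rw [← hρ]
      change ρ (φ' h * MvPolynomial.C (g i k)) = _
      rw [map_mul, MvPolynomial.rename_C]
    rwa [h3] at h2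
  have hT : IsIntegral (MvPolynomial {v : Σ i, κ i // v ≠ ⟨i, k₀ i⟩} ℂ)
      (Φ (r h) * incidenceHom k₀ g (MvPolynomial.X ⟨i, k₀ i⟩)) := by
    rw [incidenceHom_X_base, mul_neg, Finset.mul_sum]
    refine IsIntegral.neg (IsIntegral.sum _ fun k _ => ?_)
    rw [← mul_assoc]
    refine (hint' k).mul ?_
    have : (MvPolynomial.X ⟨⟨i, k⟩, k.2⟩ : MvPolynomial (FreeVars k₀) A) =
        algebraMap (MvPolynomial {v : Σ i, κ i // v ≠ ⟨i, k₀ i⟩} ℂ) _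
          (MvPolynomial.X ⟨⟨i, k⟩, fun h => k.2 (by simpa using h)⟩) := by
      change _ = incidenceHom k₀ g (MvPolynomial.rename Subtype.val (MvPolynomial.X _))
      rw [MvPolynomial.rename_X, incidenceHom_X_free ⟨⟨i, k.1⟩, k.2⟩]
    rw [this]
    exact isIntegral_algebraMap
  obtain ⟨p, hpm, hp⟩ := hT
  -- The monic equation p of `h X_{i,k₀ i}`, read as a polynomial in `X_{i,k₀ i}`, has leading
  -- coefficient `h ^ deg p`.
  refine ⟨h, p.natDegree, p.eval₂ (MvPolynomial.rename Subtype.val).toRingHom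
    (MvPolynomial.rename Subtype.val (r h) * MvPolynomial.X ⟨i, k₀ i⟩), hh, ?_, ?_⟩
  · rw [RingHom.mem_ker, ← AlgHom.coe_toRingHom, Polynomial.hom_eval₂, ← hp]
    congr 1
    exact map_mul (incidenceHom k₀ g) _ _
  · have h1 : isolateVariable ⟨i, k₀ i⟩ (p.eval₂ (MvPolynomial.rename Subtype.val).toRingHom
        (MvPolynomial.rename Subtype.val (r h) * MvPolynomial.X ⟨i, k₀ i⟩)) =
        p.comp (Polynomial.C (r h) * Polynomial.X) := by
      rw [Polynomial.comp, ← isolateVariable_rename, ← isolateVariable_X_self, ← map_mul]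
      have := Polynomial.hom_eval₂ p (MvPolynomial.rename Subtype.val).toRingHom
        (isolateVariable (⟨i, k₀ i⟩ : Σ i, κ i)).toRingEquiv.toRingHom
        (MvPolynomial.rename Subtype.val (r h) * MvPolynomial.X ⟨i, k₀ i⟩)
      refine this.trans ?_
      congr 1
      refine RingHom.ext fun G => ?_
      exact isolateVariable_rename _ G
    have hr : r h ≠ 0 := by
      refine (map_ne_zero_iff _ (MvPolynomial.rename_injective _ fun v w hvw => ?_)).mpr hh
      exact otherVars_injective i (congrArg Subtype.val hvw)
    rw [h1, Polynomial.leadingCoeff_comp (by rw [Polynomial.natDegree_C_mul_X _ hr]; exact one_ne_zero),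
      hpm.leadingCoeff, one_mul, Polynomial.leadingCoeff_C_mul_X, ← map_pow]

end LeadingCoefficient

end Degree

/-! ### Counting roots: D m = N -/

section Degree

variable {n : ℕ} {κ : Fin (n + 1) → Type*} [∀ i, Fintype (κ i)] {P : Type*}
  {Z : ∀ i, (κ i → ℂ) → P → Prop} (i : Fin (n + 1))

theorem entryWeight_otherVars (v : Σ j : Fin n, κ (i.succAbove j)) :
    LinearSeries.entryWeight i (otherVars i v) = 0 :=
  if_neg (i.succAbove_ne v.1)

namespace AffineAtlas

/-- f divides the equation supplied by `exists_equation_of_injective`, so its leading coefficient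
divides a power of a polynomial in the other groups and contains no variable of the i-th group. -/
theorem natDegree_isolateVariable (S : AffineAtlas Z n) {f : MvPolynomial (Σ i, κ i) ℂ}
    (hf : f ≠ 0) (hJ : consistencyIdeal Z = Ideal.span {f})
    (hJ' : consistencyIdeal (fun j => Z (i.succAbove j)) = ⊥) {D : ℕ}
    (hD : MvPolynomial.IsWeightedHomogeneous (LinearSeries.entryWeight i) f D) :
    (isolateVariable (⟨i, (S.chart S.base).k₀ i⟩ : Σ i, κ i) f).natDegree = D := by
  set C := S.chart S.base with hC
  have hker : RingHom.ker (incidenceHom (fun j => C.k₀ (i.succAbove j))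
      (fun j => C.g (i.succAbove j))) = ⊥ := ((S.comp i.succAbove).ker_inc S.base).trans hJ'
  obtain ⟨h, s, F, hh, hF, hlc⟩ := exists_equation_of_injective i (S.trdeg_le S.base) hker
  replace hF : F ∈ RingHom.ker C.inc := hF
  rw [S.ker_inc, hJ, Ideal.mem_span_singleton] at hF
  obtain ⟨d, rfl⟩ := hF
  rw [map_mul, Polynomial.leadingCoeff_mul] at hlc
  have hinj : Function.Injective fun v : Σ j : Fin n, κ (i.succAbove j) =>
      (⟨otherVars i v, fun h => i.succAbove_ne v.1 (congrArg Sigma.fst h)⟩ :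
          {v : Σ i, κ i // v ≠ ⟨i, (S.chart S.base).k₀ i⟩}) := fun v w hvw =>
    otherVars_injective i (congrArg Subtype.val hvw)
  have hw : LinearSeries.entryWeight i (⟨i, C.k₀ i⟩ : Σ i, κ i) = 1 := if_pos rfl
  refine natDegree_isolateVariable_of_leadingCoeff _ hw hf hD fun v hv => ?_
  by_contra hvw
  have hvi : v.1.1 = i := by
    by_contra h
    exact hvw (if_neg h)
  refine notMem_vars_of_dvd ?_ (Dvd.intro _ hlc) (fun hv => ?_) hv
  · exact (map_ne_zero_iff _ (MvPolynomial.rename_injective _ hinj)).mpr (pow_ne_zero s hh)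
  · obtain ⟨u, -, rfl⟩ := MvPolynomial.mem_vars_rename _ _ hv
    exact i.succAbove_ne u.1 hvi

/-- A nonzero relation on consistent systems of the other groups also holds on R. It is then a
multiple of f, so f contains no variable of the i-th group. -/
theorem degree_eq_zero_of_ne_bot {f : MvPolynomial (Σ i, κ i) ℂ}
    (hJ : consistencyIdeal Z = Ideal.span {f})
    (hJ' : consistencyIdeal (fun j => Z (i.succAbove j)) ≠ ⊥) :
    MvPolynomial.IsWeightedHomogeneous (LinearSeries.entryWeight i) f 0 := by
  obtain ⟨q, hq, hq0⟩ := (Submodule.ne_bot_iff _).mp hJ'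
  have h1 : MvPolynomial.rename (otherVars i) q ∈ consistencyIdeal Z := by
    refine MvPolynomial.mem_vanishingIdeal_iff.mpr fun c hc => ?_
    obtain ⟨p, hp⟩ := hc
    rw [MvPolynomial.aeval_rename]
    exact MvPolynomial.mem_vanishingIdeal_iff.mp hq _
      ⟨p, ((mem_commonZeros_iff_succAbove i).mp hp).2⟩
  rw [hJ, Ideal.mem_span_singleton] at h1
  intro m hm
  rw [Finsupp.weight_apply]
  refine Finset.sum_eq_zero fun v hv => ?_
  have hvf : v ∈ f.vars := (MvPolynomial.mem_vars_iff_mem_support v).mpr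
    ⟨m, MvPolynomial.mem_support_iff.mpr hm, hv⟩
  by_cases hvq : v ∈ (MvPolynomial.rename (otherVars i) q).vars
  · obtain ⟨u, -, rfl⟩ := MvPolynomial.mem_vars_rename _ _ hvq
    simp only [entryWeight_otherVars, smul_zero]
  · refine absurd hvf (notMem_vars_of_dvd ?_ h1 hvq)
    exact (map_ne_zero_iff _ (MvPolynomial.rename_injective _ (otherVars_injective i))).mpr hq0

/-- The roots of the other n sections are sorted by the unique value of `X_{i,k₀ i}` that makes the
i-th section vanish too. These values are the D roots of a specialisation of f, each of which
accounts for m points. -/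
theorem exists_degree_mul_eq (S : AffineAtlas Z n) {f : MvPolynomial (Σ i, κ i) ℂ}
    (hf : Irreducible f) (hJ : consistencyIdeal Z = Ideal.span {f})
    {m : ℕ} {q : MvPolynomial (Σ i, κ i) ℂ} (hq : ¬ f ∣ q)
    (hm : ∀ c, MvPolynomial.eval c f = 0 → MvPolynomial.eval c q ≠ 0 →
      (commonZeros Z c).Finite ∧ (commonZeros Z c).ncard = m)
    {N : ℕ} {q' : MvPolynomial (Σ j : Fin n, κ (i.succAbove j)) ℂ} (hq' : q' ≠ 0)
    (hN : ∀ c, MvPolynomial.eval c q' ≠ 0 →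
      (commonZeros (fun j => Z (i.succAbove j)) c).ncard = N) :
    ∃ D, MvPolynomial.IsWeightedHomogeneous (LinearSeries.entryWeight i) f D ∧ D * m = N := by
  classical
  by_cases hJ' : consistencyIdeal (fun j => Z (i.succAbove j)) = ⊥
  swap
  -- The other n sections generically have no common zero, so N is 0 together with D.
  · refine ⟨0, degree_eq_zero_of_ne_bot i hJ hJ', ?_⟩
    obtain ⟨q₁, hq₁, h0⟩ := (Submodule.ne_bot_iff _).mp hJ'
    obtain ⟨c, hc⟩ : ∃ c, MvPolynomial.eval c (q' * q₁) ≠ 0 := by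
      by_contra! h
      exact mul_ne_zero hq' h0 (MvPolynomial.funext (by simpa using h))
    rw [map_mul] at hc
    rw [← hN c (left_ne_zero_of_mul hc), zero_mul, Set.not_nonempty_iff_eq_empty.mp fun h =>
      right_ne_zero_of_mul hc (MvPolynomial.mem_vanishingIdeal_iff.mp hq₁ c h), Set.ncard_empty]
  obtain ⟨D, hD⟩ := S.exists_isWeightedHomogeneous i hf.ne_zero hJ
  refine ⟨D, hD, ?_⟩
  have hdeg := S.natDegree_isolateVariable i hf.ne_zero hJ hJ' hD
  obtain ⟨N₂, q₂, hq₂, h₂⟩ := (S.comp i.succAbove).exists_generic_ncard_of_eq_bot (by simp) hJ'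
  replace h₂ : ∀ c, MvPolynomial.eval c q₂ ≠ 0 →
    commonZeros (fun j => Z (i.succAbove j)) c ⊆ Set.range (S.chart S.base).pt :=
      fun c hc => (h₂ c hc).1
  set C := S.chart S.base
  set v₀ : Σ i, κ i := ⟨i, C.k₀ i⟩ with hv₀
  let emb (v : Σ j : Fin n, κ (i.succAbove j)) : {v : Σ i, κ i // v ≠ v₀} :=
    ⟨otherVars i v, fun h => i.succAbove_ne v.1 (congrArg Sigma.fst h)⟩
  have hemb : Function.Injective emb := fun v w hvw =>
    otherVars_injective i (congrArg Subtype.val hvw)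
  obtain ⟨r, hr, hroots⟩ := exists_generic_roots (F := isolateVariable v₀ f)
    (q := isolateVariable v₀ q) ((MulEquiv.irreducible_iff (isolateVariable v₀)).mpr hf)
    (fun h => hq ((map_dvd_iff (isolateVariable v₀)).mp h))
  -- Values of all variables except `v₀`: `r` makes the roots of f simple and keeps them off q, `q'`
  -- gives N roots of the other sections, and `q₂` places them in the base chart.
  obtain ⟨c'', hc''⟩ : ∃ c, MvPolynomial.eval c (r * MvPolynomial.rename emb (q' * q₂)) ≠ 0 := by
    by_contra! h
    exact mul_ne_zero hr ((map_ne_zero_iff _ (MvPolynomial.rename_injective _ hemb)).mpr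
      (mul_ne_zero hq' hq₂)) (MvPolynomial.funext (by simpa using h))
  rw [map_mul, MvPolynomial.eval_rename, map_mul] at hc''
  have hcr := left_ne_zero_of_mul hc''
  have hcq' := left_ne_zero_of_mul (right_ne_zero_of_mul hc'')
  have hcq₂ := right_ne_zero_of_mul (right_ne_zero_of_mul hc'')
  obtain ⟨hcard, hF0, hqt⟩ := hroots (MvPolynomial.eval c'') hcr
  let ext (t : ℂ) (v : Σ i, κ i) : ℂ := if h : v = v₀ then t else c'' ⟨v, h⟩
  have hext₀ (t : ℂ) : ext t v₀ = t := dif_pos rfl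
  have hext₁ (t : ℂ) : (fun v : {v : Σ i, κ i // v ≠ v₀} => ext t v) = c'' :=
    funext fun v => dif_neg v.2
  have hext (t : ℂ) : ext t ∘ otherVars i = c'' ∘ emb :=
    funext fun v => congrFun (hext₁ t) (emb v)
  have heval (t : ℂ) (G : MvPolynomial (Σ i, κ i) ℂ) : MvPolynomial.eval (ext t) G =
      ((isolateVariable v₀ G).map (MvPolynomial.eval c'')).eval t := by
    rw [← eval_isolateVariable v₀, hext₁, hext₀]
  -- The coefficient of t is `g i (k₀ i) = 1`, so the i-th equation determines t; `ext 0` expresses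
  -- the remaining terms.
  have hsum (t : ℂ) (ψ : C.A →ₐ[ℂ] ℂ) : Z i (fun k => ext t ⟨i, k⟩) (C.pt ψ) ↔
      t = - ∑ k, ext 0 ⟨i, k⟩ * ψ (C.g i k) := by
    have h (k : κ i) : ext t ⟨i, k⟩ * ψ (C.g i k) =
        ext 0 ⟨i, k⟩ * ψ (C.g i k) + if k = C.k₀ i then t else 0 := by
      by_cases hk : k = C.k₀ i
      · rw [hk, C.g_base, ← hv₀, hext₀, hext₀, if_pos rfl, map_one]
        ring
      · have hk' : (⟨i, k⟩ : Σ i, κ i) ≠ v₀ := fun h => hk (by simpa [hv₀] using h)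
        simp [ext, hk, hk']
    rw [C.zero_iff, Finset.sum_congr rfl fun k _ => h k, Finset.sum_add_distrib,
      Finset.sum_ite_eq' , if_pos (Finset.mem_univ _), eq_neg_iff_add_eq_zero, add_comm]
  set roots := ((isolateVariable v₀ f).map (MvPolynomial.eval c'')).roots.toFinset with hroots'
  have hmem (t : ℂ) : t ∈ roots ↔ MvPolynomial.eval (ext t) f = 0 := by
    rw [hroots', Multiset.mem_toFinset, Polynomial.mem_roots hF0, heval, Polynomial.IsRoot]
  have hzt (t : ℂ) (ht : t ∈ roots) := hm (ext t) ((hmem t).mp ht) (by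
    rw [heval]
    exact hqt t (by rw [← heval, ← hmem]; exact ht))
  have hunion : commonZeros (fun j => Z (i.succAbove j)) (c'' ∘ emb) =
      ⋃ t ∈ roots, commonZeros Z (ext t) := by
    ext p
    rw [Set.mem_iUnion₂]
    constructor
    · intro hp
      obtain ⟨ψ, rfl⟩ := h₂ _ hcq₂ hp
      have hp' : C.pt ψ ∈ commonZeros Z (ext (- ∑ k, ext 0 ⟨i, k⟩ * ψ (C.g i k))) := by
        rw [mem_commonZeros_iff_succAbove i, hsum, hext]
        exact ⟨rfl, hp⟩
      refine ⟨_, ?_, hp'⟩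
      rw [hmem]
      have hfJ : f ∈ consistencyIdeal Z := hJ ▸ Ideal.mem_span_singleton_self f
      exact MvPolynomial.mem_vanishingIdeal_iff.mp hfJ _ ⟨_, hp'⟩
    · rintro ⟨t, -, hp⟩
      rw [mem_commonZeros_iff_succAbove i, hext] at hp
      exact hp.2
  have hdisj {t t' : ℂ} {p : P} (h : p ∈ commonZeros Z (ext t)) (h' : p ∈ commonZeros Z (ext t')) :
      t = t' := by
    have hp := ((mem_commonZeros_iff_succAbove i).mp h).2
    rw [hext] at hp
    obtain ⟨ψ, rfl⟩ := h₂ _ hcq₂ hp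
    rw [(hsum t ψ).mp (h i), (hsum t' ψ).mp (h' i)]
  have hfin : ∀ t : roots, (commonZeros Z (ext t)).Finite := fun t => (hzt t t.2).1
  have hset : commonZeros (fun j => Z (i.succAbove j)) (c'' ∘ emb) =
      (Finset.univ.biUnion fun t : roots => (hfin t).toFinset : Finset P) := by
    rw [hunion]
    ext p
    simp
  rw [← hN _ hcq', hset, Set.ncard_coe_finset, Finset.card_biUnion]
  · rw [Finset.sum_congr rfl fun t _ =>
      ((Set.ncard_eq_toFinset_card _ (hfin t)).symm.trans (hzt t t.2).2), Finset.sum_const,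
      Finset.card_univ, Fintype.card_coe, hcard, hdeg, smul_eq_mul]
  · intro t _ t' _ htt'
    rw [Function.onFun, Finset.disjoint_left]
    intro p hp hp'
    rw [Set.Finite.mem_toFinset] at hp hp'
    exact htt' (Subtype.ext (hdisj hp hp'))

end AffineAtlas

end Degree

/-! ### Closed points as algebra homomorphisms to ℂ -/

namespace LinearSeries

section Functions

variable {X : Scheme.{0}} [X.Over (Spec (.of ℂ))]

/-- The regular functions on an open subset form a complex algebra. -/
noncomputable instance algebraFunctions (U : X.Opens) : Algebra ℂ Γ(X, U) where
  toSMul := (instModuleFunctions X U).toSMul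
  algebraMap := scalars X U
  commutes' _ _ := mul_comm _ _
  smul_def' _ _ := rfl

theorem map_scalars {U V : X.Opens} (h : V ≤ U) (t : ℂ) :
    X.presheaf.map (homOfLE h).op (scalars X U t) = scalars X V t := by
  simp only [scalars, CommRingCat.hom_comp, RingHom.comp_apply]
  rw [← CommRingCat.comp_apply, ← Functor.map_comp]
  rfl

theorem finiteType_functions [LocallyOfFiniteType (X ↘ Spec (.of ℂ))] {U : X.Opens}
    (hU : IsAffineOpen U) : Algebra.FiniteType ℂ Γ(X, U) := by
  have h1 := (X ↘ Spec (.of ℂ)).finiteType_appLE (isAffineOpen_top _) hU le_top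
  exact h1.comp (RingHom.FiniteType.of_surjective (Scheme.ΓSpecIso (.of ℂ)).inv.hom
    (ConcreteCategory.bijective_of_isIso (Scheme.ΓSpecIso (.of ℂ)).inv).2)

theorem ringKrullDim_functions_le {U : X.Opens} (hU : IsAffineOpen U) :
    ringKrullDim Γ(X, U) ≤ topologicalKrullDim X := by
  rw [← PrimeSpectrum.topologicalKrullDim_eq_ringKrullDim Γ(X, U)]
  change topologicalKrullDim (Spec Γ(X, U)) ≤ _
  rw [← IsHomeomorph.topologicalKrullDim_eq _ hU.isoSpec.hom.homeomorph.isHomeomorph]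
  exact topologicalKrullDim_subspace_le X U

/-- The point of an affine open subset at which the functions take the values `ψ`. -/
noncomputable def pointOfAlgHom {U : X.Opens} (hU : IsAffineOpen U) (ψ : Γ(X, U) →ₐ[ℂ] ℂ) : X :=
  hU.fromSpec (⟨RingHom.ker ψ, RingHom.ker_isPrime _⟩ : PrimeSpectrum Γ(X, U))

variable {U : X.Opens} (hU : IsAffineOpen U)

theorem pointOfAlgHom_mem (ψ : Γ(X, U) →ₐ[ℂ] ℂ) : pointOfAlgHom hU ψ ∈ U := by
  have : pointOfAlgHom hU ψ ∈ Set.range hU.fromSpec := ⟨_, rfl⟩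
  rwa [hU.range_fromSpec] at this

theorem pointOfAlgHom_mem_basicOpen_iff (ψ : Γ(X, U) →ₐ[ℂ] ℂ) (f : Γ(X, U)) :
    pointOfAlgHom hU ψ ∈ X.basicOpen f ↔ ψ f ≠ 0 := by
  have : pointOfAlgHom hU ψ ∈ X.basicOpen f ↔
      (⟨RingHom.ker ψ, RingHom.ker_isPrime _⟩ : PrimeSpectrum Γ(X, U)) ∈
        hU.fromSpec ⁻¹ᵁ X.basicOpen f := Iff.rfl
  rw [this, hU.fromSpec_preimage_basicOpen]
  exact Iff.rfl

theorem algHom_surjective {A : Type*} [CommRing A] [Algebra ℂ A] (ψ : A →ₐ[ℂ] ℂ) :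
    Function.Surjective ψ := fun t => ⟨algebraMap ℂ A t, ψ.commutes t⟩

theorem pointOfAlgHom_injective : Function.Injective (pointOfAlgHom hU) := by
  intro ψ ψ' h
  have h1 := congrArg PrimeSpectrum.asIdeal (hU.fromSpec.isOpenEmbedding.injective h)
  replace h1 : RingHom.ker ψ = RingHom.ker ψ' := h1
  refine AlgHom.ext fun f => ?_
  have h2 : f - algebraMap ℂ _ (ψ f) ∈ RingHom.ker ψ := by simp [RingHom.mem_ker]
  rw [h1, RingHom.mem_ker, map_sub, AlgHom.commutes, sub_eq_zero] at h2
  exact h2.symm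

variable [LocallyOfFiniteType (X ↘ Spec (.of ℂ))]

theorem jacobsonSpace : JacobsonSpace X :=
  LocallyOfFiniteType.jacobsonSpace (X ↘ Spec (.of ℂ))

theorem pointOfAlgHom_mem_closedPoints (ψ : Γ(X, U) →ₐ[ℂ] ℂ) :
    pointOfAlgHom hU ψ ∈ closedPoints X := by
  have := jacobsonSpace (X := X)
  have h := hU.fromSpec.isOpenEmbedding.preimage_closedPoints
  refine (Set.ext_iff.mp h (⟨RingHom.ker ψ, RingHom.ker_isPrime _⟩ : PrimeSpectrum Γ(X, U))).mpr ?_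
  refine (PrimeSpectrum.isClosed_singleton_iff_isMaximal
    (⟨RingHom.ker ψ, RingHom.ker_isPrime _⟩ : PrimeSpectrum Γ(X, U))).mpr ?_
  exact RingHom.ker_isMaximal_of_surjective _ (algHom_surjective ψ)

/-- In a Jacobson space the closed points of U are the closed points of X in U. Such a point is a
maximal ideal, with residue field ℂ by the Nullstellensatz. -/
theorem exists_pointOfAlgHom_eq {p : X} (hp : p ∈ closedPoints X) (hpU : p ∈ U) :
    ∃ ψ, pointOfAlgHom hU ψ = p := by
  have := jacobsonSpace (X := X)
  have := finiteType_functions hU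
  have hmem : p ∈ Set.range hU.fromSpec := by rwa [hU.range_fromSpec]
  obtain ⟨y, rfl⟩ := hmem
  have h := hU.fromSpec.isOpenEmbedding.preimage_closedPoints
  rw [← Set.mem_preimage, h, mem_closedPoints_iff] at hp
  have hmax : (y : PrimeSpectrum Γ(X, U)).asIdeal.IsMaximal :=
    (PrimeSpectrum.isClosed_singleton_iff_isMaximal (y : PrimeSpectrum Γ(X, U))).mp hp
  set m := (y : PrimeSpectrum Γ(X, U)).asIdeal with hm
  have : Algebra.FiniteType ℂ (Γ(X, U) ⧸ m) :=
    Algebra.FiniteType.of_surjective (Ideal.Quotient.mkₐ ℂ m) Ideal.Quotient.mk_surjective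
  obtain ⟨ψ, -⟩ := exists_algHom_apply_ne_zero (one_ne_zero (α := Γ(X, U) ⧸ m))
  refine ⟨ψ.comp (Ideal.Quotient.mkₐ ℂ m), ?_⟩
  refine congrArg hU.fromSpec (PrimeSpectrum.ext (hmax.eq_of_le ?_ ?_).symm)
  · exact (RingHom.ker_isPrime _).ne_top
  · intro f hf
    change ψ (Ideal.Quotient.mk m f) = 0
    rw [Ideal.Quotient.eq_zero_iff_mem.mpr hf, map_zero]

theorem eq_top_of_closedPoints_subset {U : X.Opens} (h : closedPoints X ⊆ U) : U = ⊤ := by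
  have := jacobsonSpace (X := X)
  by_contra hne
  have h1 : ((U : Set X)ᶜ).Nonempty := by
    rw [Set.nonempty_compl]
    exact fun h => hne (TopologicalSpace.Opens.ext h)
  obtain ⟨p, hp, hpc⟩ := nonempty_inter_closedPoints h1 U.isOpen.isClosed_compl.isLocallyClosed
  exact hp (h hpc)

end Functions

end LinearSeries

/-! ### Frames of line bundles and charts of a system -/

namespace LinearSeries

section Frames

variable {X : Scheme.{0}} (L : X.Modules)

theorem res_res {U V W : X.Opens} (h : V ≤ U) (h' : W ≤ V) (s : Γ(L, U)) :
    res L h' (res L h s) = res L (h'.trans h) s := by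
  simp only [res]
  rw [← ConcreteCategory.comp_apply, ← Functor.map_comp]
  rfl

theorem res_self {U : X.Opens} (s : Γ(L, U)) : res L le_rfl s = s := by
  have := L.presheaf.map_id (.op U)
  exact congrArg (fun f => (ConcreteCategory.hom f) s) this

theorem res_smul {U V : X.Opens} (h : V ≤ U) (f : Γ(X, U)) (s : Γ(L, U)) :
    res L h (f • s) = X.presheaf.map (homOfLE h).op f • res L h s :=
  Scheme.Modules.map_smul L _ _ _

theorem res_sum {ι : Type*} (t : Finset ι) {U V : X.Opens} (h : V ≤ U) (s : ι → Γ(L, U)) :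
    res L h (∑ i ∈ t, s i) = ∑ i ∈ t, res L h (s i) :=
  map_sum (L.presheaf.map (homOfLE h).op).hom s t

theorem IsFrame.res {U V : X.Opens} {e : Γ(L, U)} (he : IsFrame L e) (h : V ≤ U) :
    IsFrame L (res L h e) := by
  intro W hW
  simp only [res_res]
  exact he W (hW.trans h)

variable {L} {U : X.Opens} {e : Γ(L, U)} (he : IsFrame L e)

theorem frameCoord_eq_iff {s : Γ(L, ⊤)} {f : Γ(X, U)} :
    frameCoord L he s = f ↔ f • e = res L le_top s := by
  have h := frameCoord_smul L he s
  rw [res_self] at h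
  constructor
  · rintro rfl
    exact h
  · intro hf
    refine (he U le_rfl).injective ?_
    simp only [res_self]
    rw [h, hf]

theorem frameCoord_res {V : X.Opens} (h : V ≤ U) (s : Γ(L, ⊤)) :
    frameCoord L (he.res L h) s = X.presheaf.map (homOfLE h).op (frameCoord L he s) := by
  rw [frameCoord_eq_iff, ← res_smul, (frameCoord_eq_iff he).mp rfl, res_res]

theorem IsFrame.exists_unit_smul_eq (he : IsFrame L e) {e' : Γ(L, U)} (he' : IsFrame L e') :
    ∃ u : Γ(X, U)ˣ, e' = (u : Γ(X, U)) • e := by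
  obtain ⟨u, hu⟩ := (he U le_rfl).surjective e'
  obtain ⟨v, hv⟩ := (he' U le_rfl).surjective e
  simp only [res_self] at hu hv
  refine ⟨⟨u, v, ?_, ?_⟩, hu.symm⟩
  · refine (he' U le_rfl).injective ?_
    simp only [res_self]
    rw [mul_smul, hv, hu, one_smul]
  · refine (he U le_rfl).injective ?_
    simp only [res_self]
    rw [mul_smul, hu, hv, one_smul]

/-- Two frames differ by a unit on their overlap, so vanishing can be tested in any one frame. -/
theorem vanishesAt_iff {p : X} (hp : p ∈ U) (s : Γ(L, ⊤)) :
    VanishesAt L s p ↔ p ∉ X.basicOpen (frameCoord L he s) := by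
  refine ⟨?_, fun h => ⟨U, e, he, hp, h⟩⟩
  rintro ⟨U', e', he', hp', h'⟩ h
  refine h' ?_
  have hW : U ⊓ U' ≤ U := inf_le_left
  have hW' : U ⊓ U' ≤ U' := inf_le_right
  obtain ⟨u, hu⟩ := (he.res L hW).exists_unit_smul_eq (he'.res L hW')
  have h1 : frameCoord L (he.res L hW) s = frameCoord L (he'.res L hW') s * u := by
    rw [frameCoord_eq_iff, mul_smul, ← hu, (frameCoord_eq_iff _).mp rfl]
  have h2 : p ∈ X.basicOpen (frameCoord L (he.res L hW) s) := by
    rw [frameCoord_res he, Scheme.basicOpen_res]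
    exact ⟨⟨hp, hp'⟩, h⟩
  rw [h1, Scheme.basicOpen_mul, frameCoord_res he', Scheme.basicOpen_res] at h2
  exact h2.1.2

variable [X.Over (Spec (.of ℂ))]

theorem frameCoord_sum_smul {κ : Type*} [Fintype κ] (c : κ → ℂ) (s : κ → Γ(L, ⊤)) :
    frameCoord L he (∑ k, c k • s k) = ∑ k, c k • frameCoord L he (s k) := by
  rw [frameCoord_eq_iff, Finset.sum_smul, res_sum]
  refine Finset.sum_congr rfl fun k _ => ?_
  have h1 : c k • s k = scalars X ⊤ (c k) • s k := rfl
  have h2 : c k • frameCoord L he (s k) = scalars X U (c k) * frameCoord L he (s k) := rfl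
  rw [h1, h2, res_smul, mul_smul, (frameCoord_eq_iff he).mp rfl, map_scalars]

end Frames

section Charts

theorem isUnit_map_of_le_basicOpen {X : Scheme.{0}} {U V : X.Opens} (h : V ≤ U) (f : Γ(X, U))
    (hV : V ≤ X.basicOpen f) : IsUnit (X.presheaf.map (homOfLE h).op f) := by
  have heq : X.presheaf.map (homOfLE h).op = X.presheaf.map (homOfLE (X.basicOpen_le f)).op ≫
      X.presheaf.map (homOfLE hV).op := by
    rw [← Functor.map_comp]
    rfl
  rw [heq, CommRingCat.comp_apply]
  exact (X.toRingedSpace.isUnit_res_basicOpen f).map (X.presheaf.map (homOfLE hV).op).hom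

variable {X : Scheme.{0}} [X.Over (Spec (.of ℂ))] {ι : Type} (E : ι → LinearSystem X)
  {κ : ι → Type*} [∀ i, Fintype (κ i)] (b : ∀ i, Module.Basis (κ i) ℂ (E i).sections)

/-- An affine open subset with frames of all the line bundles and, in each of the linear series, a
basis section without zeros on the open subset. -/
structure SystemChart where
  U : X.Opens
  isAffineOpen : IsAffineOpen U
  nonempty : Nonempty U
  e : ∀ i, Γ((E i).L, U)
  isFrame : ∀ i, IsFrame (E i).L (e i)
  k₀ : ∀ i, κ i
  isUnit : ∀ i, IsUnit (frameCoord (E i).L (isFrame i) (b i (k₀ i) : Γ((E i).L, ⊤)))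

variable {E b}

theorem system_eq (c : (Σ i, κ i) → ℂ) (i : ι) :
    (system E b c i : Γ((E i).L, ⊤)) = ∑ k, c ⟨i, k⟩ • (b i k : Γ((E i).L, ⊤)) := by
  simp [system]

/-- Vanishing at p puts a coordinate in the maximal ideal of the local ring; if all basis sections
vanished, so would all their linear combinations. -/
theorem exists_basis_not_vanishesAt (hE : ∀ i, (E i).IsBasePointFree) {p : X}
    (hp : p ∈ closedPoints X) (i : ι) :
    ∃ k, ¬ VanishesAt (E i).L (b i k : Γ((E i).L, ⊤)) p := by
  obtain ⟨s, hs, hsp⟩ := hE i p hp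
  by_contra! h
  refine hsp ?_
  obtain ⟨U, e, hpU, he⟩ := (E i).isLineBundle p
  have hsum : s = ∑ k, (b i).repr ⟨s, hs⟩ k • (b i k : Γ((E i).L, ⊤)) := by
    have := congrArg Subtype.val ((b i).sum_repr ⟨s, hs⟩)
    rw [Submodule.coe_sum] at this
    exact this.symm
  simp only [vanishesAt_iff he hpU] at h ⊢
  rw [hsum, frameCoord_sum_smul]
  rw [Scheme.mem_basicOpen _ _ _ hpU, map_sum]
  refine (IsLocalRing.mem_maximalIdeal _).mp (Ideal.sum_mem _ fun k _ => ?_)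
  rw [Algebra.smul_def, map_mul]
  refine Ideal.mul_mem_left _ _ ((IsLocalRing.mem_maximalIdeal _).mpr fun hu => ?_)
  exact h k ((Scheme.mem_basicOpen _ _ _ hpU).mpr hu)

theorem exists_systemChart [Finite ι] (hE : ∀ i, (E i).IsBasePointFree) {p : X}
    (hp : p ∈ closedPoints X) : ∃ C : SystemChart E b, p ∈ C.U := by
  choose k hk using exists_basis_not_vanishesAt (b := b) hE hp
  choose U e hpU he using fun i => (E i).isLineBundle p
  simp only [fun i => vanishesAt_iff (he i) (hpU i), not_not] at hk
  let W : X.Opens := ⟨⋂ i, X.basicOpen (frameCoord (E i).L (he i) (b i (k i) : Γ((E i).L, ⊤))),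
    isOpen_iInter_of_finite fun i => (X.basicOpen _).isOpen⟩
  have hpW : p ∈ W := Set.mem_iInter.mpr hk
  obtain ⟨V, hV, hpV, hVW⟩ := exists_isAffineOpen_mem_and_subset hpW
  have hVW' (i : ι) : V ≤ X.basicOpen (frameCoord (E i).L (he i) (b i (k i) : Γ((E i).L, ⊤))) :=
    fun x hx => Set.mem_iInter.mp (hVW hx) i
  have hVU (i : ι) : V ≤ U i := (hVW' i).trans (X.basicOpen_le _)
  refine ⟨⟨V, hV, ⟨p, hpV⟩, fun i => res (E i).L (hVU i) (e i), fun i => (he i).res _ (hVU i), k,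
    fun i => ?_⟩, hpV⟩
  rw [frameCoord_res (he i)]
  exact isUnit_map_of_le_basicOpen _ _ (hVW' i)

end Charts

/-! ### The atlas of a base-point free system -/

section Atlas

variable {X : Scheme.{0}} [X.Over (Spec (.of ℂ))] {ι : Type} (E : ι → LinearSystem X)
  {κ : ι → Type*} [∀ i, Fintype (κ i)] (b : ∀ i, Module.Basis (κ i) ℂ (E i).sections)

/-- The section with the coordinates `c` vanishes at the point `p` of the variety. -/
def SectionVanishes (i : ι) (c : κ i → ℂ) (p : closedPoints X) : Prop :=
  VanishesAt (E i).L (∑ k, c k • (b i k : Γ((E i).L, ⊤))) p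

theorem zeroSet_eq (c : (Σ i, κ i) → ℂ) :
    zeroSet E (system E b c) = Subtype.val '' commonZeros (SectionVanishes E b) c := by
  ext p
  simp only [zeroSet, commonZeros, SectionVanishes, system_eq, Set.mem_ofPred_eq, Set.mem_image,
    Subtype.exists, exists_and_right, exists_eq_right]
  exact ⟨fun h => ⟨h.1, h.2⟩, fun h => ⟨h.1, h.2⟩⟩

theorem finite_zeroSet_iff (c : (Σ i, κ i) → ℂ) :
    (zeroSet E (system E b c)).Finite ↔ (commonZeros (SectionVanishes E b) c).Finite := by
  rw [zeroSet_eq, Set.finite_image_iff Subtype.val_injective.injOn]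

theorem ncard_zeroSet (c : (Σ i, κ i) → ℂ) :
    (zeroSet E (system E b c)).ncard = (commonZeros (SectionVanishes E b) c).ncard := by
  rw [zeroSet_eq, Set.ncard_image_of_injective _ Subtype.val_injective]

theorem vanishingIdeal_consistencyVariety :
    MvPolynomial.vanishingIdeal ℂ (consistencyVariety E b) =
      consistencyIdeal (SectionVanishes E b) := by
  have : Prod.snd '' incidenceVariety E b =
      {c | (commonZeros (SectionVanishes E b) c).Nonempty} := by
    ext c
    simp only [incidenceVariety, zeroSet_eq, Set.mem_image, Set.mem_ofPred_eq, Prod.exists,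
      exists_eq_right]
    exact ⟨fun ⟨p, q, hq, _⟩ => ⟨q, hq⟩, fun ⟨q, hq⟩ => ⟨q, q, hq, rfl⟩⟩
  rw [consistencyVariety, this, consistencyIdeal]
  exact (MvPolynomial.zeroLocus_vanishingIdeal_galoisConnection).u_l_u_eq_u _

variable {E b} [IsIntegral X] [LocallyOfFiniteType (X ↘ Spec (.of ℂ))]

/-- The affine chart of the closed points that is given by a chart of a system. -/
noncomputable def SystemChart.toAffineChart (C : SystemChart E b) :
    AffineChart (SectionVanishes E b) :=
  have := C.nonempty
  have := finiteType_functions C.isAffineOpen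
  { A := Γ(X, C.U)
    pt := fun ψ => ⟨pointOfAlgHom C.isAffineOpen ψ,
      pointOfAlgHom_mem_closedPoints C.isAffineOpen ψ⟩
    pt_injective := by
      intro ψ ψ' h
      have h' := congrArg Subtype.val h
      exact pointOfAlgHom_injective C.isAffineOpen h'
    k₀ := C.k₀
    -- Division by the unit coordinate of the distinguished basis section normalises its coefficient
    -- to 1 without changing the zeros.
    g := fun i k => frameCoord (E i).L (C.isFrame i) (b i k : Γ((E i).L, ⊤)) *
      ((C.isUnit i).unit⁻¹ : (Γ(X, C.U))ˣ)
    g_base := fun i => (C.isUnit i).mul_val_inv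
    zero_iff := by
      intro i c ψ
      rw [SectionVanishes, vanishesAt_iff (C.isFrame i) (pointOfAlgHom_mem _ ψ),
        pointOfAlgHom_mem_basicOpen_iff, not_not, frameCoord_sum_smul, map_sum]
      simp only [map_smul, map_mul, smul_eq_mul, ← mul_assoc, ← Finset.sum_mul]
      rw [mul_eq_zero_iff_right]
      exact ((C.isUnit i).unit⁻¹.isUnit.map ψ).ne_zero }

theorem mem_range_toAffineChart_pt (C : SystemChart E b) {p : closedPoints X} :
    p ∈ Set.range C.toAffineChart.pt ↔ p.1 ∈ C.U := by
  constructor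
  · rintro ⟨ψ, rfl⟩
    exact pointOfAlgHom_mem _ _
  · intro h
    obtain ⟨ψ, hψ⟩ := exists_pointOfAlgHom_eq C.isAffineOpen p.2 h
    exact ⟨ψ, Subtype.ext hψ⟩

/-- Finitely many charts suffice by quasi-compactness, they overlap densely by irreducibility, and
their dimension is bounded by that of X. -/
theorem nonempty_affineAtlas [QuasiCompact (X ↘ Spec (.of ℂ))] [Finite ι] {n : ℕ}
    (hn : topologicalKrullDim X = (n : WithBot ℕ∞)) (hE : ∀ i, (E i).IsBasePointFree) :
    Nonempty (AffineAtlas (SectionVanishes E b) n) := by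
  have hX := jacobsonSpace (X := X)
  have hXc : CompactSpace X := QuasiCompact.compactSpace_of_compactSpace (X ↘ Spec (.of ℂ))
  choose C hC using fun p : closedPoints X => exists_systemChart (b := b) hE p.2
  have htop : (⨆ p, (C p).U) = ⊤ := eq_top_of_closedPoints_subset fun p hp =>
    TopologicalSpace.Opens.mem_iSup.mpr ⟨⟨p, hp⟩, hC ⟨p, hp⟩⟩
  obtain ⟨t, ht⟩ := isCompact_univ.elim_finite_subcover (fun p => ((C p).U : Set X))
    (fun p => (C p).U.isOpen) fun p _ => by
      have : p ∈ ⨆ p, (C p).U := htop ▸ trivial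
      simpa using this
  obtain ⟨p₀, hp₀⟩ : (closedPoints X).Nonempty := by
    simpa using nonempty_inter_closedPoints (X := X) Set.univ_nonempty isClosed_univ.isLocallyClosed
  have hcover (p : closedPoints X) : ∃ a : t, p.1 ∈ (C a).U := by
    have := ht (Set.mem_univ p.1)
    simp only [Set.mem_iUnion] at this
    obtain ⟨a, ha, h⟩ := this
    exact ⟨⟨a, ha⟩, h⟩
  refine ⟨⟨t, (hcover ⟨p₀, hp₀⟩).choose, fun a => (C a).toAffineChart, fun p => ?_, fun a a' => ?_,
    fun a => ?_⟩⟩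
  · obtain ⟨a, ha⟩ := hcover p
    exact ⟨a, (mem_range_toAffineChart_pt _).mpr ha⟩
  · obtain ⟨p, hp, hp'⟩ := nonempty_preirreducible_inter (C a).U.isOpen (C a').U.isOpen
      ((Set.nonempty_coe_sort).mp (C a).nonempty) ((Set.nonempty_coe_sort).mp (C a').nonempty)
    obtain ⟨h, hle, hph⟩ := (C a).isAffineOpen.exists_basicOpen_le ⟨p, hp'⟩ hp
    refine ⟨h, ?_, fun ψ hψ => ?_⟩
    · intro h0
      have h1 : X.basicOpen h = ⊥ := (congrArg X.basicOpen h0).trans (X.basicOpen_zero _)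
      rw [h1] at hph
      exact hph
    · rw [mem_range_toAffineChart_pt]
      exact hle ((pointOfAlgHom_mem_basicOpen_iff _ ψ h).mpr hψ)
  · have := (C a).nonempty
    have := finiteType_functions (C a).isAffineOpen
    exact trdeg_le_of_ringKrullDim_le ((ringKrullDim_functions_le (C a).isAffineOpen).trans hn.le)

end Atlas

end LinearSeries

/-! ### The ideal of the consistency variety and existence of resultants -/

namespace LinearSeries

/-- A single member of the ideal that is nonzero somewhere on R already cuts out an admissible
exceptional set. -/
theorem holdsGenerically_iff {σ : Type*} {R : Set (σ → ℂ)} {Q : (σ → ℂ) → Prop} :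
    HoldsGenerically R Q ↔ ∃ q ∉ MvPolynomial.vanishingIdeal ℂ R,
      ∀ c ∈ R, MvPolynomial.eval c q ≠ 0 → Q c := by
  constructor
  · rintro ⟨I, hI, hQ⟩
    obtain ⟨c, hc, hcI⟩ := Set.not_subset.mp hI
    rw [MvPolynomial.mem_zeroLocus_iff] at hcI
    push Not at hcI
    obtain ⟨q, hq, hqc⟩ := hcI
    refine ⟨q, fun h => hqc (MvPolynomial.mem_vanishingIdeal_iff.mp h c hc), fun c' hc' h => ?_⟩
    exact hQ c' hc' fun h' => h (MvPolynomial.mem_zeroLocus_iff.mp h' q hq)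
  · rintro ⟨q, hq, hQ⟩
    have h (c : σ → ℂ) : c ∈ MvPolynomial.zeroLocus ℂ (Ideal.span {q}) ↔
        MvPolynomial.eval c q = 0 := by
      rw [MvPolynomial.zeroLocus_span]
      simp
    refine ⟨Ideal.span {q}, fun hR => hq ?_, fun c hc h' => hQ c hc fun h0 => h' ((h c).mpr h0)⟩
    exact MvPolynomial.mem_vanishingIdeal_iff.mpr fun c hc => (h c).mp (hR hc)

theorem vanishingIdeal_univ {σ : Type*} :
    MvPolynomial.vanishingIdeal ℂ (Set.univ : Set (σ → ℂ)) = ⊥ := by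
  rw [eq_bot_iff]
  intro F hF
  refine MvPolynomial.funext fun c => ?_
  rw [map_zero]
  exact MvPolynomial.mem_vanishingIdeal_iff.mp hF c (Set.mem_univ c)

theorem zeroLocus_span_singleton {σ : Type*} (f : MvPolynomial σ ℂ) :
    MvPolynomial.zeroLocus ℂ (Ideal.span {f}) = {c | MvPolynomial.eval c f = 0} := by
  rw [MvPolynomial.zeroLocus_span]
  ext c
  simp

section Resultant

variable {X : Scheme.{0}} [X.Over (Spec (.of ℂ))] {ι : Type} {E : ι → LinearSystem X}
  {κ : ι → Type*} [∀ i, Fintype (κ i)] {b : ∀ i, Module.Basis (κ i) ℂ (E i).sections}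

theorem zeroLocus_consistencyIdeal :
    MvPolynomial.zeroLocus ℂ (consistencyIdeal (SectionVanishes E b)) = consistencyVariety E b := by
  rw [← vanishingIdeal_consistencyVariety, consistencyVariety]
  exact (MvPolynomial.zeroLocus_vanishingIdeal_galoisConnection).l_u_l_eq_l _

theorem consistencyIdeal_eq_span [Finite ι] {f : MvPolynomial (Σ i, κ i) ℂ} (hf : Irreducible f)
    (h : {c | MvPolynomial.eval c f = 0} = consistencyVariety E b) :
    consistencyIdeal (SectionVanishes E b) = Ideal.span {f} := by
  have : (Ideal.span {f}).IsPrime := (Ideal.span_singleton_prime hf.ne_zero).mpr hf.prime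
  rw [← vanishingIdeal_consistencyVariety, ← h, ← zeroLocus_span_singleton,
    MvPolynomial.IsPrime.vanishingIdeal_zeroLocus]

theorem exists_isIntersectionIndex [Fintype ι] {n : ℕ} (hι : n ≤ Fintype.card ι)
    (S : AffineAtlas (SectionVanishes E b) n) : ∃ N, IsIntersectionIndex E b N := by
  obtain ⟨N, q, hq, h⟩ := S.exists_generic_ncard_of_le_card hι
  refine ⟨N, holdsGenerically_iff.mpr ⟨q, by simpa [vanishingIdeal_univ] using hq, fun c _ hc => ?_⟩⟩
  rw [finite_zeroSet_iff, ncard_zeroSet]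
  exact h c hc

/-- The ideal of R is a prime of height one in a factorial ring, hence principal; its generator and
the generic number of roots over R give a resultant. -/
theorem exists_isResultant [Fintype ι] {n : ℕ} (hι : n + 1 ≤ Fintype.card ι)
    (S : AffineAtlas (SectionVanishes E b) n) (hcodim : codim (consistencyVariety E b) = 1) :
    ∃ F, IsResultant E b F := by
  have hprime := S.isPrime_consistencyIdeal
  rw [codim, vanishingIdeal_consistencyVariety] at hcodim
  obtain ⟨f, hf⟩ : ∃ f, consistencyIdeal (SectionVanishes E b) = Ideal.span {f} :=
    (UniqueFactorizationMonoid.isPrincipal_of_height_eq_one hcodim).principal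
  have hf0 : f ≠ 0 := by
    rintro rfl
    rw [hf] at hcodim
    simp at hcodim
  have hirr : Irreducible f := by
    rw [hf, Ideal.span_singleton_prime hf0] at hprime
    exact hprime.irreducible
  obtain ⟨m, q, hq, h⟩ := S.exists_generic_ncard_of_eq_span hι hirr hf
  refine ⟨MvPolynomial.C 1 * f ^ m, f, m, 1, hirr, ?_, ?_, one_ne_zero, rfl⟩
  · rw [← zeroLocus_consistencyIdeal, hf, zeroLocus_span_singleton]
  · refine holdsGenerically_iff.mpr ⟨q, ?_, fun c hc hqc => ?_⟩
    · rwa [vanishingIdeal_consistencyVariety, hf, Ideal.mem_span_singleton]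
    · rw [finite_zeroSet_iff, ncard_zeroSet]
      rw [← zeroLocus_consistencyIdeal, hf, zeroLocus_span_singleton] at hc
      exact h c hc hqc

end Resultant

section Degree

variable {X : Scheme.{0}} [X.Over (Spec (.of ℂ))] {n : ℕ} {E : Fin (n + 1) → LinearSystem X}
  {κ : Fin (n + 1) → Type*} [∀ i, Fintype (κ i)]
  {b : ∀ i, Module.Basis (κ i) ℂ (E i).sections}

/-- Any f and m allowed by the definition work: f generates the ideal of R by the Nullstellensatz,
and the counting argument accepts any generic counts, giving `f ^ m` the degree m D = N. -/
theorem IsResultant.isWeightedHomogeneous (S : AffineAtlas (SectionVanishes E b) n)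
    {F : MvPolynomial (Σ i, κ i) ℂ} (hF : IsResultant E b F) (i : Fin (n + 1)) {N : ℕ}
    (hN : IsIntersectionIndex (fun j : Fin n => E (i.succAbove j))
      (fun j : Fin n => b (i.succAbove j)) N) :
    F.IsWeightedHomogeneous (entryWeight i) N ∧ entryDegree i F = N := by
  obtain ⟨f, m, a, hf, hR, hm, ha, rfl⟩ := hF
  have hJ := consistencyIdeal_eq_span hf hR
  obtain ⟨q, hq, hm⟩ := holdsGenerically_iff.mp hm
  obtain ⟨q', hq', hN⟩ := holdsGenerically_iff.mp hN
  rw [vanishingIdeal_consistencyVariety, hJ, Ideal.mem_span_singleton] at hq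
  rw [vanishingIdeal_univ, Ideal.mem_bot] at hq'
  simp only [← hR, finite_zeroSet_iff, ncard_zeroSet] at hm
  simp only [finite_zeroSet_iff, ncard_zeroSet] at hN
  obtain ⟨D, hD, hDm⟩ := S.exists_degree_mul_eq i hf hJ hq hm hq' fun c hc =>
    (hN c (Set.mem_univ c) hc).2
  have hF : (MvPolynomial.C a * f ^ m).IsWeightedHomogeneous (entryWeight i) N := by
    have := (MvPolynomial.isWeightedHomogeneous_C (entryWeight i) a).mul (hD.pow m)
    rwa [zero_add, smul_eq_mul, mul_comm m, hDm] at this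
  refine ⟨hF, weightedTotalDegree_of_isWeightedHomogeneous _ ?_ hF⟩
  exact mul_ne_zero ((map_ne_zero_iff _ (MvPolynomial.C_injective _ _)).mpr ha)
    (pow_ne_zero m hf.ne_zero)

end Degree

end LinearSeries

/-! ### Chains of irreducible closed subsets -/

section Chains

open TopologicalSpace

theorem Subalgebra.eval_mem {Y : Type*} (B : Subalgebra ℂ (Y → ℂ)) {σ : Type*} {x : σ → Y → ℂ}
    (hx : ∀ i, x i ∈ B) (G : MvPolynomial σ ℂ) :
    (fun y => MvPolynomial.eval (fun i => x i y) G) ∈ B := by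
  induction G using MvPolynomial.induction_on with
  | C a =>
    simp only [MvPolynomial.eval_C]
    exact B.algebraMap_mem a
  | add p q hp hq =>
    simp only [map_add]
    exact B.add_mem hp hq
  | mul_X p i hp =>
    simp only [map_mul, MvPolynomial.eval_X]
    exact B.mul_mem hp (hx i)

theorem Polynomial.exists_eq_X_pow_mul {R : Type*} [CommRing R] [IsDomain R] {p : Polynomial R}
    (hp : p ≠ 0) : ∃ (e : ℕ) (q : Polynomial R), p = X ^ e * q ∧ q.coeff 0 ≠ 0 := by
  obtain ⟨q, hq, hdvd⟩ := exists_eq_pow_rootMultiplicity_mul_and_not_dvd p hp 0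
  rw [C_0, sub_zero] at hq hdvd
  exact ⟨_, q, hq, fun h => hdvd (X_dvd_iff.mpr h)⟩

variable {Y : Type*} [TopologicalSpace Y]

/-- Functions that separate the members of a chain of irreducible closed subsets are algebraically
independent. -/
theorem exists_eval_ne_zero_of_chain {W : Set Y} (hW : IsOpen W) {B : Subalgebra ℂ (Y → ℂ)}
    (hopen : ∀ f ∈ B, IsOpen {y | y ∈ W ∧ f y ≠ 0})
    (hsep : ∀ (Z : Set Y), IsClosed Z → ∀ y ∈ W, y ∉ Z → ∃ f ∈ B, f y ≠ 0 ∧ ∀ z ∈ Z ∩ W, f z = 0)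
    {Z : ℕ → Set Y} (hZ : ∀ k, IsClosed (Z k)) (hirr : ∀ k, IsPreirreducible (Z k))
    (h0 : (Z 0 ∩ W).Nonempty) (r : ℕ) (hlt : ∀ k < r, Z k ⊂ Z (k + 1)) :
    ∃ x : Fin r → Y → ℂ, (∀ i, x i ∈ B) ∧ ∀ G : MvPolynomial (Fin r) ℂ, G ≠ 0 →
      ∃ y ∈ Z r ∩ W, MvPolynomial.eval (fun i => x i y) G ≠ 0 := by
  induction r with
  | zero =>
    refine ⟨Fin.elim0, fun i => i.elim0, fun G hG => ?_⟩
    obtain ⟨y, hy⟩ := h0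
    refine ⟨y, hy, fun h => hG ?_⟩
    rw [MvPolynomial.eq_C_of_isEmpty G, MvPolynomial.eval_C] at h
    rw [MvPolynomial.eq_C_of_isEmpty G, h, map_zero]
  | succ r ih =>
    obtain ⟨x, hx, hG⟩ := ih fun k hk => hlt k (hk.trans (Nat.lt_succ_self r))
    have hlt := hlt r (Nat.lt_succ_self r)
    have hWr : (Z (r + 1) ∩ W).Nonempty := by
      obtain ⟨y, hy, -⟩ := hG 1 one_ne_zero
      exact ⟨y, hlt.1 hy.1, hy.2⟩
    obtain ⟨z, hz, hzr⟩ := Set.exists_of_ssubset hlt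
    obtain ⟨w, hwZ, hwW, hwr⟩ := hirr (r + 1) W (Z r)ᶜ hW (hZ r).isOpen_compl hWr ⟨z, hz, hzr⟩
    obtain ⟨f, hf, hfw, hf0⟩ := hsep (Z r) (hZ r) w hwW hwr
    refine ⟨Fin.cons f x, fun i => ?_, fun G hG0 => ?_⟩
    · refine Fin.cases ?_ (fun i => ?_) i
      · exact hf
      · exact hx i
    have heval (G : MvPolynomial (Fin (r + 1)) ℂ) (y : Y) :
        MvPolynomial.eval (fun i => (Fin.cons f x : Fin (r + 1) → Y → ℂ) i y) G =
          Polynomial.eval (f y) (Polynomial.map (MvPolynomial.eval fun i => x i y)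
            (MvPolynomial.finSuccEquiv ℂ r G)) := by
      rw [← MvPolynomial.eval_eq_eval_mv_eval']
      congr 2
      funext i
      refine Fin.cases ?_ (fun i => ?_) i <;> simp
    -- Powers of the new variable, which stands for f, are split off from G. On `Z r`, where f = 0,
    -- the cofactor q reduces to its constant term, nonzero somewhere by induction. Irreducibility
    -- of `Z (r + 1)` then gives a point where neither f nor q vanishes.
    obtain ⟨e, q, hq, hq0⟩ := Polynomial.exists_eq_X_pow_mul
      (p := MvPolynomial.finSuccEquiv ℂ r G) (by simpa using hG0)
    obtain ⟨y, hy, hyq⟩ := hG _ hq0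
    set Q := (MvPolynomial.finSuccEquiv ℂ r).symm q with hQ
    have hQy : MvPolynomial.eval (fun i => (Fin.cons f x : Fin (r + 1) → Y → ℂ) i y) Q ≠ 0 := by
      rw [heval, hf0 y hy, hQ, AlgEquiv.apply_symm_apply, ← Polynomial.coeff_zero_eq_eval_zero,
        Polynomial.coeff_map]
      exact hyq
    have hQB := B.eval_mem (x := (Fin.cons f x : Fin (r + 1) → Y → ℂ)) (fun i => by
      refine Fin.cases ?_ (fun i => ?_) i
      · exact hf
      · exact hx i) Q
    obtain ⟨u, huZ, hu1, hu2⟩ := hirr (r + 1) _ _ (hopen _ hf) (hopen _ hQB)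
      ⟨w, hwZ, hwW, hfw⟩ ⟨y, hlt.1 hy.1, hy.2, hQy⟩
    refine ⟨u, ⟨huZ, hu1.1⟩, ?_⟩
    rw [heval, hq, Polynomial.map_mul, Polynomial.map_pow, Polynomial.map_X, Polynomial.eval_mul,
      Polynomial.eval_pow, Polynomial.eval_X]
    refine mul_ne_zero (pow_ne_zero e hu1.2) ?_
    have := hu2.2
    rwa [heval, hQ, AlgEquiv.apply_symm_apply] at this

/-- Every chain of irreducible closed subsets of `T` has less than `m` steps. -/
def ChainsShorter (T : Set Y) (m : ℕ) : Prop :=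
  ∀ p : LTSeries (IrreducibleCloseds Y), (p.last : Set Y) ⊆ T → p.length < m

theorem ChainsShorter.eq_empty {T : Set Y} (h : ChainsShorter T 0) (hT : IsClosed T) : T = ∅ := by
  rw [← Set.not_nonempty_iff_eq_empty]
  rintro ⟨y, hy⟩
  exact absurd (h (RelSeries.singleton _ ⟨closure {y}, isIrreducible_singleton.closure,
    isClosed_closure⟩) (hT.closure_subset_iff.mpr (by simpa using hy))) (Nat.not_lt_zero _)

/-- A closed subset of a Noetherian space contains finitely many points such that the length of
chains drops on passing to a closed subset that avoids these points. -/
theorem ChainsShorter.exists_finset [NoetherianSpace Y] {T : Set Y} (hT : IsClosed T) {m : ℕ}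
    (h : ChainsShorter T (m + 1)) :
    ∃ s : Finset Y, ∀ D : Set Y, (∀ y ∈ s, y ∉ D) → ChainsShorter (T ∩ D) m := by
  classical
  obtain ⟨S, hfin, hcl, hirr, rfl⟩ := NoetherianSpace.exists_finite_set_isClosed_irreducible hT
  lift S to Finset (Set Y) using hfin
  -- One point from each irreducible piece of T. A chain in T ∩ D ends inside some piece and misses
  -- its chosen point, so the piece itself can be appended.
  choose y hy using fun t : S => (hirr t t.2).nonempty
  refine ⟨Finset.univ.image y, fun D hD p hp => ?_⟩
  obtain ⟨t, ht, hpt⟩ := isIrreducible_iff_sUnion_isClosed.mp p.last.isIrreducible S hcl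
    (hp.trans Set.inter_subset_left)
  have hlt : p.last < ⟨t, hirr t ht, hcl t ht⟩ := by
    refine lt_of_le_of_ne hpt fun heq => hD (y ⟨t, ht⟩) (Finset.mem_image_of_mem y (Finset.mem_univ _)) ?_
    have h1 : (p.last : Set Y) = t := congrArg (fun Z : IrreducibleCloseds Y => (Z : Set Y)) heq
    exact (hp (h1.symm ▸ hy ⟨t, ht⟩)).2
  have := h (p.snoc _ hlt) (by
    rw [RelSeries.last_snoc]
    exact Set.subset_sUnion_of_mem ht)
  rw [RelSeries.snoc_length] at this
  omega

end Chains

/-! ### Product series and Kodaira images in charts -/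

namespace LinearSeries

section ProductSeries

variable {X : Scheme.{0}} [X.Over (Spec (.of ℂ))]

theorem smul_functions_eq {U : X.Opens} (a : ℂ) (f : Γ(X, U)) : a • f = scalars X U a * f := rfl

theorem frameCoord_eq_mul_unit {L : X.Modules} {U : X.Opens} {e e' : Γ(L, U)} (he : IsFrame L e)
    (he' : IsFrame L e') :
    ∃ u : Γ(X, U)ˣ, ∀ s, frameCoord L he s = frameCoord L he' s * u := by
  obtain ⟨u, hu⟩ := he.exists_unit_smul_eq he'
  refine ⟨u, fun s => ?_⟩
  rw [frameCoord_eq_iff, mul_smul, ← hu, (frameCoord_eq_iff _).mp rfl]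

variable {ι : Type} {E : ι → LinearSystem X} {J : Finset ι}

/-- The transition unit is the product of those of the factors and is the same for all t, so these
families of coordinates transform like sections of one line bundle. -/
theorem exists_unit_map_eq (F F' : LocalFrames E J) :
    ∃ u : Γ(X, F.U ⊓ F'.U)ˣ, ∀ t ∈ productSeries E J,
      X.presheaf.map (homOfLE (inf_le_left : F.U ⊓ F'.U ≤ F.U)).op (t F) =
        X.presheaf.map (homOfLE (inf_le_right : F.U ⊓ F'.U ≤ F'.U)).op (t F') * u := by
  choose u hu using fun j : J => frameCoord_eq_mul_unit
    ((F.isFrame j).res _ (inf_le_left : F.U ⊓ F'.U ≤ F.U))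
    ((F'.isFrame j).res _ (inf_le_right : F.U ⊓ F'.U ≤ F'.U))
  refine ⟨∏ j, u j, fun t ht => ?_⟩
  induction ht using Submodule.span_induction with
  | mem t ht =>
    obtain ⟨s, rfl⟩ := ht
    simp only [tensorSection, map_prod, Units.coe_prod, ← Finset.prod_mul_distrib]
    refine Finset.prod_congr rfl fun j _ => ?_
    rw [← frameCoord_res (F.isFrame j), ← frameCoord_res (F'.isFrame j)]
    exact hu j _
  | zero => simp
  | add t t' _ _ h h' => rw [Pi.add_apply, Pi.add_apply, map_add, map_add, h, h', add_mul]
  | smul a t _ h =>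
    rw [Pi.smul_apply, Pi.smul_apply, smul_functions_eq, smul_functions_eq, map_mul, map_mul,
      map_scalars, map_scalars, h, mul_assoc]

theorem productVanishesAt_iff {t : ∀ F : LocalFrames E J, Γ(X, F.U)} (ht : t ∈ productSeries E J)
    {p : X} (F : LocalFrames E J) (hp : p ∈ F.U) :
    ProductVanishesAt E J t p ↔ p ∉ X.basicOpen (t F) := by
  refine ⟨fun h => h F hp, fun h F' hp' hF' => h ?_⟩
  obtain ⟨u, hu⟩ := exists_unit_map_eq F' F
  have h1 : p ∈ X.basicOpen (X.presheaf.map (homOfLE (inf_le_left : F'.U ⊓ F.U ≤ F'.U)).op (t F')) := by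
    rw [Scheme.basicOpen_res]
    exact ⟨⟨hp', hp⟩, hF'⟩
  rw [hu t ht, Scheme.basicOpen_mul, Scheme.basicOpen_res] at h1
  exact h1.1.2

variable {κ : ι → Type*} [∀ i, Fintype (κ i)] (b : ∀ i, Module.Basis (κ i) ℂ (E i).sections)

theorem tensorSection_eq_sum [DecidableEq ι] (s : ∀ j : J, (E j).sections) : tensorSection E J s =
    ∑ k : ∀ j : J, κ j, (∏ j : J, (b j).repr (s j) (k j)) •
      tensorSection E J (fun j : J => b j (k j)) := by
  funext F
  have h (j : J) : frameCoord (E j).L (F.isFrame j) (s j : Γ((E j).L, ⊤)) =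
      ∑ k, (b j).repr (s j) k • frameCoord (E j).L (F.isFrame j) (b j k : Γ((E j).L, ⊤)) := by
    rw [← frameCoord_sum_smul]
    congr 1
    have := congrArg Subtype.val ((b j).sum_repr (s j))
    rw [Submodule.coe_sum] at this
    exact this.symm
  rw [Finset.sum_apply]
  simp only [tensorSection, h, Pi.smul_apply]
  rw [Finset.prod_univ_sum, Fintype.piFinset_univ]
  refine Finset.sum_congr rfl fun k _ => ?_
  simp only [smul_functions_eq, map_prod, Finset.prod_mul_distrib]

/-- Multilinearity reduces the spanning set to products of basis sections. Finite dimension lets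
linear forms on the dual be read as sections, as `SystemChart.pull` does. -/
theorem finite_productSeries (b : ∀ i, Module.Basis (κ i) ℂ (E i).sections) :
    Module.Finite ℂ (productSeries E J) := by
  classical
  have := Module.Finite.span_of_finite ℂ
    (Set.finite_range fun k : ∀ j : J, κ j => tensorSection E J fun j : J => b j (k j))
  refine Submodule.finiteDimensional_of_le (S₂ := Submodule.span ℂ
    (Set.range fun k : ∀ j : J, κ j => tensorSection E J fun j : J => b j (k j))) ?_
  refine Submodule.span_le.mpr ?_
  rintro _ ⟨s, rfl⟩
  rw [tensorSection_eq_sum b]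
  exact Submodule.sum_mem _ fun k _ => Submodule.smul_mem _ _ (Submodule.subset_span ⟨k, rfl⟩)

variable {b}

/-- The frames of a chart for the line bundles in a subcollection. -/
abbrev SystemChart.localFrames (C : SystemChart E b) (J : Finset ι) : LocalFrames E J :=
  ⟨C.U, fun j => C.e j, fun j => C.isFrame j⟩

/-- The coordinate in a chart of the sections of the product series. -/
def SystemChart.coord (C : SystemChart E b) (J : Finset ι) : productSeries E J →ₗ[ℂ] Γ(X, C.U) where
  toFun t := t.1 (C.localFrames J)
  map_add' _ _ := rfl
  map_smul' _ _ := rfl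

/-- The value at a point of a chart of the sections of the product series. -/
noncomputable def SystemChart.evalAt (C : SystemChart E b) (J : Finset ι)
    (ψ : Γ(X, C.U) →ₐ[ℂ] ℂ) : Module.Dual ℂ (productSeries E J) :=
  ψ.toLinearMap ∘ₗ C.coord J

theorem isKodairaImage_iff (C : SystemChart E b) {ψ : Γ(X, C.U) →ₐ[ℂ] ℂ}
    {y : ℙ ℂ (Module.Dual ℂ (productSeries E J))} :
    IsKodairaImage E J (pointOfAlgHom C.isAffineOpen ψ) y ↔
      ∀ t, y.rep t = 0 ↔ C.evalAt J ψ t = 0 := by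
  refine forall_congr' fun t => ?_
  refine iff_congr Iff.rfl ?_
  refine (productVanishesAt_iff t.2 (C.localFrames J)
    (pointOfAlgHom_mem C.isAffineOpen ψ)).trans ?_
  refine (not_congr (pointOfAlgHom_mem_basicOpen_iff C.isAffineOpen ψ _)).trans ?_
  rw [not_not]
  rfl

theorem SystemChart.evalAt_tensorSection (C : SystemChart E b) (ψ : Γ(X, C.U) →ₐ[ℂ] ℂ)
    (s : ∀ j : J, (E j).sections) :
    C.evalAt J ψ ⟨tensorSection E J s, Submodule.subset_span ⟨s, rfl⟩⟩ =
      ∏ j : J, ψ (frameCoord (E j).L (C.isFrame j) (s j : Γ((E j).L, ⊤))) :=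
  map_prod ψ _ _

theorem SystemChart.evalAt_ne_zero (C : SystemChart E b) (ψ : Γ(X, C.U) →ₐ[ℂ] ℂ) :
    C.evalAt J ψ ≠ 0 := by
  intro h
  have h1 := C.evalAt_tensorSection ψ fun j : J => b j (C.k₀ j)
  rw [h, LinearMap.zero_apply, eq_comm, Finset.prod_eq_zero_iff] at h1
  obtain ⟨j, -, hj⟩ := h1
  exact ((C.isUnit j).map ψ).ne_zero hj

theorem exists_smul_eq_of_forall_eq_zero_iff {V : Type*} [AddCommGroup V] [Module ℂ V]
    {f g : Module.Dual ℂ V} (hg : g ≠ 0) (h : ∀ t, f t = 0 ↔ g t = 0) :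
    ∃ a : ℂ, a ≠ 0 ∧ f = a • g := by
  obtain ⟨t₀, ht₀⟩ : ∃ t₀, g t₀ ≠ 0 := by
    by_contra! h0
    exact hg (LinearMap.ext h0)
  have key (t : V) : f t = (f t₀ / g t₀) * g t := by
    have h1 : g (t - (g t / g t₀) • t₀) = 0 := by
      rw [map_sub, map_smul, smul_eq_mul, div_mul_cancel₀ _ ht₀, sub_self]
    have h2 := (h _).mpr h1
    rw [map_sub, map_smul, smul_eq_mul, sub_eq_zero] at h2
    rw [h2]
    ring
  exact ⟨f t₀ / g t₀, div_ne_zero (fun h0 => ht₀ ((h t₀).mp h0)) ht₀, LinearMap.ext key⟩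

theorem IsKodairaImage.rep_eq (C : SystemChart E b) {ψ : Γ(X, C.U) →ₐ[ℂ] ℂ}
    {y : ℙ ℂ (Module.Dual ℂ (productSeries E J))}
    (h : IsKodairaImage E J (pointOfAlgHom C.isAffineOpen ψ) y) :
    ∃ a : ℂ, a ≠ 0 ∧ y.rep = a • C.evalAt J ψ :=
  exists_smul_eq_of_forall_eq_zero_iff (C.evalAt_ne_zero ψ)
    ((isKodairaImage_iff C).mp h)

theorem isKodairaImage_mk (C : SystemChart E b) (ψ : Γ(X, C.U) →ₐ[ℂ] ℂ) :
    IsKodairaImage E J (pointOfAlgHom C.isAffineOpen ψ)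
      (Projectivization.mk ℂ (C.evalAt J ψ) (C.evalAt_ne_zero ψ)) := by
  rw [isKodairaImage_iff]
  intro t
  obtain ⟨a, ha⟩ := Projectivization.exists_smul_eq_mk_rep ℂ _ (C.evalAt_ne_zero (J := J) ψ)
  rw [← ha, LinearMap.smul_apply, smul_eq_zero_iff_eq]

/-- The coordinate in a chart of a homogeneous polynomial in the linear forms on the dual of the
product series. -/
noncomputable def SystemChart.pull (C : SystemChart E b) (J : Finset ι)
    [Module.Finite ℂ (productSeries E J)]
    (P : MvPolynomial (Module.Dual ℂ (Module.Dual ℂ (productSeries E J))) ℂ) : Γ(X, C.U) :=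
  MvPolynomial.aeval
    (fun φ => C.coord J ((Module.evalEquiv ℂ (productSeries E J)).symm φ)) P

variable [Module.Finite ℂ (productSeries E J)]

theorem SystemChart.apply_pull (C : SystemChart E b) (ψ : Γ(X, C.U) →ₐ[ℂ] ℂ)
    (P : MvPolynomial (Module.Dual ℂ (Module.Dual ℂ (productSeries E J))) ℂ) :
    ψ (C.pull J P) = MvPolynomial.eval (fun φ => φ (C.evalAt J ψ)) P := by
  have : ψ.comp (MvPolynomial.aeval (fun φ =>
      C.coord J ((Module.evalEquiv ℂ (productSeries E J)).symm φ))) =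
      MvPolynomial.aeval (fun φ => φ (C.evalAt J ψ)) := by
    refine MvPolynomial.algHom_ext fun φ => ?_
    rw [AlgHom.comp_apply, MvPolynomial.aeval_X, MvPolynomial.aeval_X]
    exact Module.apply_evalEquiv_symm_apply _ _ (C.evalAt J ψ) φ
  exact DFunLike.congr_fun this P

theorem eval_smul_of_isHomogeneous {V : Type*} [AddCommGroup V] [Module ℂ V]
    {P : MvPolynomial (Module.Dual ℂ V) ℂ} {d : ℕ} (hP : P.IsHomogeneous d) (a : ℂ) (v : V) :
    MvPolynomial.eval (fun φ => φ (a • v)) P = a ^ d * MvPolynomial.eval (fun φ => φ v) P := by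
  have h := eval_weightedScaling 1 P (fun φ : Module.Dual ℂ V => φ v) a
  rw [weightedScaling_of_isWeightedHomogeneous _ hP] at h
  simp only [map_smul, smul_eq_mul]
  simpa [mul_comm] using h.symm

theorem IsKodairaImage.eval_ne_zero_iff (C : SystemChart E b) {ψ : Γ(X, C.U) →ₐ[ℂ] ℂ}
    {y : ℙ ℂ (Module.Dual ℂ (productSeries E J))}
    (h : IsKodairaImage E J (pointOfAlgHom C.isAffineOpen ψ) y)
    {P : MvPolynomial (Module.Dual ℂ (Module.Dual ℂ (productSeries E J))) ℂ} {d : ℕ}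
    (hP : P.IsHomogeneous d) :
    MvPolynomial.eval (fun φ => φ y.rep) P ≠ 0 ↔
      pointOfAlgHom C.isAffineOpen ψ ∈ X.basicOpen (C.pull J P) := by
  obtain ⟨a, ha, hy⟩ := h.rep_eq
  rw [pointOfAlgHom_mem_basicOpen_iff, C.apply_pull, hy, eval_smul_of_isHomogeneous hP]
  simp [ha]

end ProductSeries

end LinearSeries

/-! ### Zariski topology and regular functions on Kodaira images -/

namespace LinearSeries

attribute [local instance] projectiveZariskiTopology

section ProjectiveSubsets

variable {V : Type*} [AddCommGroup V] [Module ℂ V]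

theorem isOpen_setOf_eval_ne_zero {P : MvPolynomial (Module.Dual ℂ V) ℂ} {d : ℕ}
    (hP : P.IsHomogeneous d) :
    IsOpen {y : ℙ ℂ V | MvPolynomial.eval (fun φ => φ y.rep) P ≠ 0} :=
  TopologicalSpace.isOpen_generateFrom_of_mem ⟨P, d, hP, rfl⟩

theorem exists_isHomogeneous_of_isOpen {O : Set (ℙ ℂ V)} (hO : IsOpen O) {y : ℙ ℂ V} (hy : y ∈ O) :
    ∃ (P : MvPolynomial (Module.Dual ℂ V) ℂ) (d : ℕ), P.IsHomogeneous d ∧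
      MvPolynomial.eval (fun φ => φ y.rep) P ≠ 0 ∧
      ∀ z : ℙ ℂ V, MvPolynomial.eval (fun φ => φ z.rep) P ≠ 0 → z ∈ O := by
  have hbasis := TopologicalSpace.isTopologicalBasis_of_subbasis_of_inter
    (t := projectiveZariskiTopology V) rfl (by
      rintro _ ⟨P, d, hP, rfl⟩ _ ⟨Q, e, hQ, rfl⟩
      refine ⟨P * Q, d + e, hP.mul hQ, ?_⟩
      ext y
      simp)
  obtain ⟨U, hU, hyU, hUO⟩ := hbasis.exists_subset_of_mem_open hy hO
  obtain rfl | ⟨P, d, hP, rfl⟩ := hU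
  · exact ⟨1, 0, MvPolynomial.isHomogeneous_one _ _, by simp, fun z _ => hUO (Set.mem_univ z)⟩
  · exact ⟨P, d, hP, hyU, fun z hz => hUO hz⟩

/-- The functions on a subset of a projective space that are, where the linear form `φ₀` does not
vanish, quotients of homogeneous polynomials by powers of `φ₀`. -/
def regularFunctions (Y : Set (ℙ ℂ V)) (φ₀ : Module.Dual ℂ V) : Subalgebra ℂ (Y → ℂ) where
  carrier := {f | ∃ (P : MvPolynomial (Module.Dual ℂ V) ℂ) (d : ℕ), P.IsHomogeneous d ∧
    ∀ y : Y, φ₀ y.1.rep ≠ 0 → f y = MvPolynomial.eval (fun φ => φ y.1.rep) P / φ₀ y.1.rep ^ d}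
  mul_mem' := by
    rintro f g ⟨P, d, hP, hf⟩ ⟨Q, e, hQ, hg⟩
    refine ⟨P * Q, d + e, hP.mul hQ, fun y hy => ?_⟩
    rw [Pi.mul_apply, hf y hy, hg y hy, map_mul, pow_add, div_mul_div_comm]
  add_mem' := by
    rintro f g ⟨P, d, hP, hf⟩ ⟨Q, e, hQ, hg⟩
    have h1 := hP.mul ((MvPolynomial.isHomogeneous_X ℂ φ₀).pow e)
    have h2 := hQ.mul ((MvPolynomial.isHomogeneous_X ℂ φ₀).pow d)
    rw [one_mul] at h1 h2
    rw [add_comm] at h2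
    refine ⟨_, d + e, h1.add h2, fun y hy => ?_⟩
    rw [Pi.add_apply, hf y hy, hg y hy]
    simp only [map_add, map_mul, map_pow, MvPolynomial.eval_X]
    field_simp
    ring
  algebraMap_mem' a := by
    refine ⟨MvPolynomial.C a, 0, MvPolynomial.isHomogeneous_C _ _, fun y _ => ?_⟩
    simp

theorem isOpen_setOf_regularFunctions_ne_zero {Y : Set (ℙ ℂ V)} {φ₀ : Module.Dual ℂ V} {f : Y → ℂ}
    (hf : f ∈ regularFunctions Y φ₀) : IsOpen {y : Y | φ₀ y.1.rep ≠ 0 ∧ f y ≠ 0} := by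
  obtain ⟨P, d, hP, hf⟩ := hf
  have h := (isOpen_setOf_eval_ne_zero (hP.mul (MvPolynomial.isHomogeneous_X ℂ φ₀))).preimage
    (continuous_subtype_val (p := (· ∈ Y)))
  convert h using 1
  ext y
  simp only [Set.mem_ofPred_eq, Set.preimage_ofPred_eq, map_mul, MvPolynomial.eval_X, mul_ne_zero_iff]
  constructor
  · rintro ⟨h1, h2⟩
    rw [hf y h1, div_ne_zero_iff] at h2
    exact ⟨h2.1, h1⟩
  · rintro ⟨h2, h1⟩
    rw [hf y h1, div_ne_zero_iff]
    exact ⟨h1, h2, pow_ne_zero d h1⟩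

theorem exists_regularFunctions_separating {Y : Set (ℙ ℂ V)} (φ₀ : Module.Dual ℂ V) {Z : Set Y}
    (hZ : IsClosed Z) {y : Y} (hy : φ₀ y.1.rep ≠ 0) (hyZ : y ∉ Z) :
    ∃ f ∈ regularFunctions Y φ₀, f y ≠ 0 ∧ ∀ z ∈ Z, f z = 0 := by
  obtain ⟨O, hO, hOZ⟩ := isOpen_induced_iff.mp hZ.isOpen_compl
  have hyO : y.1 ∈ O := by
    have : y ∈ Subtype.val ⁻¹' O := hOZ ▸ hyZ
    exact this
  obtain ⟨P, d, hP, hPy, hPO⟩ := exists_isHomogeneous_of_isOpen hO hyO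
  refine ⟨fun z => MvPolynomial.eval (fun φ => φ z.1.rep) P / φ₀ z.1.rep ^ d,
    ⟨P, d, hP, fun z _ => rfl⟩, div_ne_zero hPy (pow_ne_zero d hy), fun z hz => ?_⟩
  rw [div_eq_zero_iff]
  left
  by_contra h
  have : z ∈ Zᶜ := hOZ ▸ (hPO z.1 h : z ∈ Subtype.val ⁻¹' O)
  exact this hz

/-- A chain of irreducible closed subsets of a subset of a projective space gives algebraically
independent regular functions. -/
theorem exists_regularFunctions_of_ltSeries {Y : Set (ℙ ℂ V)}
    (p : LTSeries (TopologicalSpace.IrreducibleCloseds Y)) :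
    ∃ (φ₀ : Module.Dual ℂ V) (x : Fin p.length → Y → ℂ), (∀ i, x i ∈ regularFunctions Y φ₀) ∧
      ∀ G : MvPolynomial (Fin p.length) ℂ, G ≠ 0 →
        ∃ y : Y, φ₀ y.1.rep ≠ 0 ∧ MvPolynomial.eval (fun i => x i y) G ≠ 0 := by
  -- The chain is continued by its last member so as to be indexed by ℕ. `φ₀` is then chosen nonzero
  -- at a point of the smallest member.
  let Z (k : ℕ) : TopologicalSpace.IrreducibleCloseds Y :=
    p ⟨min k p.length, Nat.lt_succ_of_le (min_le_right _ _)⟩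
  obtain ⟨z, hz⟩ := (Z 0).isIrreducible.nonempty
  obtain ⟨φ₀, hφ₀⟩ : ∃ φ₀ : Module.Dual ℂ V, φ₀ z.1.rep ≠ 0 := by
    by_contra! h
    exact z.1.rep_nonzero ((Module.forall_dual_apply_eq_zero_iff ℂ _).mp h)
  have hW : IsOpen {y : Y | φ₀ y.1.rep ≠ 0} := by
    simpa using isOpen_setOf_regularFunctions_ne_zero (one_mem (regularFunctions Y φ₀))
  obtain ⟨x, hx, hG⟩ := exists_eval_ne_zero_of_chain (W := {y : Y | φ₀ y.1.rep ≠ 0}) hW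
    (B := regularFunctions Y φ₀) (fun f hf => isOpen_setOf_regularFunctions_ne_zero hf)
    (fun Z hZ y hy hyZ => by
      obtain ⟨f, hf, hfy, hfZ⟩ := exists_regularFunctions_separating φ₀ hZ hy hyZ
      exact ⟨f, hf, hfy, fun z hz => hfZ z hz.1⟩)
    (Z := fun k => (Z k : Set Y)) (fun k => (Z k).isClosed) (fun k => (Z k).isIrreducible.2)
    ⟨z, hz, hφ₀⟩ p.length (fun k hk => by
      refine SetLike.coe_ssubset_coe.mpr (p.strictMono ?_)
      rw [Fin.mk_lt_mk]
      omega)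
  refine ⟨φ₀, x, hx, fun G hG0 => ?_⟩
  obtain ⟨y, hy, hGy⟩ := hG G hG0
  exact ⟨y, hy.2, hGy⟩

end ProjectiveSubsets

/-! ### The Kodaira map on closed points -/

section KodairaMap

variable {X : Scheme.{0}} [X.Over (Spec (.of ℂ))] [LocallyOfFiniteType (X ↘ Spec (.of ℂ))]
  {ι : Type} [Finite ι] {E : ι → LinearSystem X} (hE : ∀ i, (E i).IsBasePointFree) (J : Finset ι)

theorem exists_pointOfAlgHom_of_mem_closedPoints {κ : ι → Type*} [∀ i, Fintype (κ i)]
    (b : ∀ i, Module.Basis (κ i) ℂ (E i).sections)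
    (hE : ∀ i, (E i).IsBasePointFree) {p : X} (hp : p ∈ closedPoints X) :
    ∃ (C : SystemChart E b) (ψ : Γ(X, C.U) →ₐ[ℂ] ℂ), pointOfAlgHom C.isAffineOpen ψ = p := by
  obtain ⟨C, hpC⟩ := exists_systemChart (b := b) hE hp
  exact ⟨C, exists_pointOfAlgHom_eq C.isAffineOpen hp hpC⟩

theorem exists_isKodairaImage (hE : ∀ i, (E i).IsBasePointFree) (J : Finset ι) {p : X}
    (hp : p ∈ closedPoints X) :
    ∃ y, IsKodairaImage E J p y := by
  have (i : ι) := (E i).finiteDimensional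
  obtain ⟨C, ψ, rfl⟩ := exists_pointOfAlgHom_of_mem_closedPoints
    (fun i => Module.finBasis ℂ (E i).sections) hE hp
  exact ⟨_, isKodairaImage_mk C ψ⟩

theorem IsKodairaImage.eq (hE : ∀ i, (E i).IsBasePointFree) {J : Finset ι} {p : X}
    (hp : p ∈ closedPoints X) {y z : ℙ ℂ (Module.Dual ℂ (productSeries E J))}
    (hy : IsKodairaImage E J p y) (hz : IsKodairaImage E J p z) : y = z := by
  have (i : ι) := (E i).finiteDimensional
  obtain ⟨C, ψ, rfl⟩ := exists_pointOfAlgHom_of_mem_closedPoints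
    (fun i => Module.finBasis ℂ (E i).sections) hE hp
  obtain ⟨a, ha, hy⟩ := hy.rep_eq C
  obtain ⟨a', ha', hz⟩ := hz.rep_eq C
  rw [← y.mk_rep, ← z.mk_rep, Projectivization.mk_eq_mk_iff', hy, hz]
  exact ⟨a / a', by rw [smul_smul, div_mul_cancel₀ _ ha']⟩

/-- The Kodaira map from the closed points onto its image. -/
noncomputable def kodairaMap (p : closedPoints X) : kodairaImage E J :=
  ⟨(exists_isKodairaImage hE J p.2).choose, p, p.2, (exists_isKodairaImage hE J p.2).choose_spec⟩

theorem isKodairaImage_kodairaMap (p : closedPoints X) :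
    IsKodairaImage E J p (kodairaMap hE J p).1 :=
  (exists_isKodairaImage hE J p.2).choose_spec

theorem surjective_kodairaMap : Function.Surjective (kodairaMap hE J) := by
  rintro ⟨y, p, hp, hy⟩
  exact ⟨⟨p, hp⟩, Subtype.ext ((isKodairaImage_kodairaMap hE J ⟨p, hp⟩).eq hE hp hy)⟩

theorem continuous_kodairaMap : Continuous (kodairaMap hE J) := by
  have (i : ι) := (E i).finiteDimensional
  have := finite_productSeries (J := J) fun i => Module.finBasis ℂ (E i).sections
  refine continuous_induced_rng.mpr (continuous_generateFrom_iff.mpr ?_)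
  rintro _ ⟨P, d, hP, rfl⟩
  refine isOpen_iff_forall_mem_open.mpr fun p hp => ?_
  obtain ⟨C, hpC⟩ := exists_systemChart (b := fun i => Module.finBasis ℂ (E i).sections) hE p.2
  have key (q : closedPoints X) (hq : q.1 ∈ C.U) :
      MvPolynomial.eval (fun φ => φ (kodairaMap hE J q).1.rep) P ≠ 0 ↔
        q.1 ∈ X.basicOpen (C.pull J P) := by
    obtain ⟨ψ, hψ⟩ := exists_pointOfAlgHom_eq C.isAffineOpen q.2 hq
    have h := isKodairaImage_kodairaMap hE J q
    rw [← hψ] at h ⊢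
    exact h.eval_ne_zero_iff C hP
  refine ⟨Subtype.val ⁻¹' (X.basicOpen (C.pull J P)), fun q hq => ?_,
    (X.basicOpen _).isOpen.preimage continuous_subtype_val, (key p hpC).mp hp⟩
  exact (key q (X.basicOpen_le _ hq)).mpr hq

/-- By irreducibility the preimage of O meets the chart, and the Jacobson property supplies a closed
point there. One chart thus suffices to detect nonvanishing on the Kodaira image. -/
theorem exists_kodairaMap_mem [IsIntegral X] {κ : ι → Type*} [∀ i, Fintype (κ i)]
    {b : ∀ i, Module.Basis (κ i) ℂ (E i).sections} (C : SystemChart E b)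
    {O : Set (kodairaImage E J)} (hO : IsOpen O) (hne : O.Nonempty) :
    ∃ ψ : Γ(X, C.U) →ₐ[ℂ] ℂ, kodairaMap hE J ⟨pointOfAlgHom C.isAffineOpen ψ,
      pointOfAlgHom_mem_closedPoints C.isAffineOpen ψ⟩ ∈ O := by
  have hX := jacobsonSpace (X := X)
  obtain ⟨y, hy⟩ := hne
  obtain ⟨p, rfl⟩ := surjective_kodairaMap hE J y
  obtain ⟨O', hO', hOO'⟩ := isOpen_induced_iff.mp (hO.preimage (continuous_kodairaMap hE J))
  have hpO : p.1 ∈ O' := by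
    have : p ∈ Subtype.val ⁻¹' O' := hOO' ▸ hy
    exact this
  have hne := nonempty_preirreducible_inter hO' C.U.isOpen ⟨p, hpO⟩
    ((Set.nonempty_coe_sort).mp C.nonempty)
  obtain ⟨q, hq, hqc⟩ := nonempty_inter_closedPoints hne (hO'.inter C.U.isOpen).isLocallyClosed
  obtain ⟨ψ, hψ⟩ := exists_pointOfAlgHom_eq C.isAffineOpen hqc hq.2
  refine ⟨ψ, ?_⟩
  change _ ∈ kodairaMap hE J ⁻¹' O
  rw [← hOO']
  change pointOfAlgHom C.isAffineOpen ψ ∈ O'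
  rw [hψ]
  exact hq.1

end KodairaMap

end LinearSeries

/-! ### Kodaira images have dimension at most n -/

theorem trdeg_localizationAway_le {A : Type} [CommRing A] [IsDomain A] [Algebra ℂ A] {n : ℕ}
    (h : Algebra.trdeg ℂ A ≤ n) {a : A} (ha : a ≠ 0) :
    Algebra.trdeg ℂ (Localization.Away a) ≤ n := by
  have hle : Submonoid.powers a ≤ nonZeroDivisors A := powers_le_nonZeroDivisors_of_noZeroDivisors ha
  have : IsDomain (Localization.Away a) := IsLocalization.isDomain_localization hle
  have : FaithfulSMul A (Localization.Away a) := (faithfulSMul_iff_algebraMap_injective _ _).mpr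
    (IsLocalization.injective _ hle)
  have : Algebra.IsAlgebraic A (Localization.Away a) :=
    IsLocalization.isAlgebraic _ (Submonoid.powers a)
  rw [← trdeg_add_eq ℂ A (A := Localization.Away a), (trdeg_eq_zero : Algebra.trdeg A (Localization.Away a) = 0), add_zero]
  exact h

/-- Quotients that are generically independent as functions are algebraically independent. -/
theorem card_le_of_eval_div_ne_zero {A : Type} [CommRing A] [IsDomain A] [Algebra ℂ A] {n r : ℕ}
    (h : Algebra.trdeg ℂ A ≤ n) (a : A) (f : Fin r → A) (d : Fin r → ℕ)
    (hG : ∀ G : MvPolynomial (Fin r) ℂ, G ≠ 0 → ∃ ψ : A →ₐ[ℂ] ℂ, ψ a ≠ 0 ∧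
      MvPolynomial.eval (fun i => ψ (f i) / ψ a ^ d i) G ≠ 0) : r ≤ n := by
  have ha : a ≠ 0 := by
    rintro rfl
    obtain ⟨ψ, hψ, -⟩ := hG 1 one_ne_zero
    exact hψ (map_zero ψ)
  let x (i : Fin r) : Localization.Away a := algebraMap _ _ (f i) *
    IsLocalization.Away.invSelf a ^ d i
  have hind : AlgebraicIndependent ℂ x := by
    rw [algebraicIndependent_iff]
    intro G hGx
    by_contra hG0
    obtain ⟨ψ, hψa, hψG⟩ := hG G hG0
    have hunit (s : Submonoid.powers a) : IsUnit (ψ s) := by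
      obtain ⟨_, k, rfl⟩ := s
      rw [map_pow]
      exact (isUnit_iff_ne_zero.mpr hψa).pow k
    let ψ' : Localization.Away a →ₐ[ℂ] ℂ := IsLocalization.liftAlgHom (f := ψ) hunit
    have hψ' (f) : ψ' (algebraMap _ _ f) = ψ f := IsLocalization.lift_eq _ f
    have hinv : ψ' (IsLocalization.Away.invSelf a) = (ψ a)⁻¹ := by
      have h1 := congrArg ψ' (IsLocalization.Away.mul_invSelf (S := Localization.Away a) a)
      rw [map_mul, hψ', map_one] at h1
      exact eq_inv_of_mul_eq_one_right h1
    have hx : (fun i => ψ (f i) / ψ a ^ d i) = fun i => ψ' (x i) := by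
      funext i
      rw [map_mul, map_pow, hψ', hinv, inv_pow, div_eq_mul_inv]
    have h2 := congrArg ψ' hGx
    rw [map_zero, MvPolynomial.comp_aeval_apply] at h2
    rw [hx] at hψG
    exact hψG h2
  simpa using hind.cardinalMk_le_trdeg.trans (trdeg_localizationAway_le h ha)

namespace LinearSeries

attribute [local instance] projectiveZariskiTopology

section Dimension

variable {X : Scheme.{0}} [X.Over (Spec (.of ℂ))] [LocallyOfFiniteType (X ↘ Spec (.of ℂ))]
  [IsIntegral X]
  {ι : Type} [Finite ι] {E : ι → LinearSystem X}

theorem IsKodairaImage.eval_div_eq {κ : ι → Type*} [∀ i, Fintype (κ i)]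
    {b : ∀ i, Module.Basis (κ i) ℂ (E i).sections} {J : Finset ι}
    [Module.Finite ℂ (productSeries E J)] (C : SystemChart E b) {ψ : Γ(X, C.U) →ₐ[ℂ] ℂ}
    {y : ℙ ℂ (Module.Dual ℂ (productSeries E J))}
    (h : IsKodairaImage E J (pointOfAlgHom C.isAffineOpen ψ) y)
    (φ₀ : Module.Dual ℂ (Module.Dual ℂ (productSeries E J)))
    {P : MvPolynomial (Module.Dual ℂ (Module.Dual ℂ (productSeries E J))) ℂ} {d : ℕ}
    (hP : P.IsHomogeneous d) :
    MvPolynomial.eval (fun φ => φ y.rep) P / φ₀ y.rep ^ d =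
      ψ (C.pull J P) / ψ (C.pull J (MvPolynomial.X φ₀)) ^ d := by
  obtain ⟨c, hc, hr⟩ := h.rep_eq C
  rw [C.apply_pull, C.apply_pull, MvPolynomial.eval_X, hr, eval_smul_of_isHomogeneous hP, map_smul,
    smul_eq_mul, mul_pow, mul_div_mul_left _ _ (pow_ne_zero _ hc)]

theorem IsKodairaImage.apply_pull_X_ne_zero {κ : ι → Type*} [∀ i, Fintype (κ i)]
    {b : ∀ i, Module.Basis (κ i) ℂ (E i).sections} {J : Finset ι}
    [Module.Finite ℂ (productSeries E J)] (C : SystemChart E b) {ψ : Γ(X, C.U) →ₐ[ℂ] ℂ}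
    {y : ℙ ℂ (Module.Dual ℂ (productSeries E J))}
    (h : IsKodairaImage E J (pointOfAlgHom C.isAffineOpen ψ) y)
    {φ₀ : Module.Dual ℂ (Module.Dual ℂ (productSeries E J))} (hφ₀ : φ₀ y.rep ≠ 0) :
    ψ (C.pull J (MvPolynomial.X φ₀)) ≠ 0 := by
  obtain ⟨c, hc, hr⟩ := h.rep_eq C
  rw [C.apply_pull, MvPolynomial.eval_X]
  rw [hr, map_smul] at hφ₀
  exact right_ne_zero_of_mul hφ₀

-- A chain yields as many independent quotients of forms on the image; pulled back to the chart they
-- remain independent in a localisation of `Γ(X, U)`, whose transcendence degree is at most n.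
set_option maxHeartbeats 1000000 in
theorem SystemChart.length_le (hE : ∀ i, (E i).IsBasePointFree) {J : Finset ι} {n : ℕ}
    (hn : topologicalKrullDim X = (n : WithBot ℕ∞)) {κ : ι → Type*} [∀ i, Fintype (κ i)]
    {b : ∀ i, Module.Basis (κ i) ℂ (E i).sections} (C : SystemChart E b)
    [Module.Finite ℂ (productSeries E J)]
    (p : LTSeries (TopologicalSpace.IrreducibleCloseds (kodairaImage E J))) : p.length ≤ n := by
  obtain ⟨φ₀, x, hx, hG⟩ := exists_regularFunctions_of_ltSeries p
  have := C.nonempty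
  have := finiteType_functions C.isAffineOpen
  have htr : Algebra.trdeg ℂ Γ(X, C.U) ≤ n :=
    trdeg_le_of_ringKrullDim_le ((ringKrullDim_functions_le C.isAffineOpen).trans hn.le)
  choose P d hP hxP using id hx
  refine card_le_of_eval_div_ne_zero htr (C.pull J (MvPolynomial.X φ₀)) (fun i => C.pull J (P i)) d
    fun G hG0 => ?_
  obtain ⟨y₁, hy₁, hGy₁⟩ := hG G hG0
  have hO := isOpen_setOf_regularFunctions_ne_zero
    (Subalgebra.eval_mem (regularFunctions (kodairaImage E J) φ₀) hx G)
  obtain ⟨ψ, hψ0, hψG⟩ := exists_kodairaMap_mem hE J C hO ⟨y₁, hy₁, hGy₁⟩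
  have hy := isKodairaImage_kodairaMap hE J ⟨pointOfAlgHom C.isAffineOpen ψ,
    pointOfAlgHom_mem_closedPoints C.isAffineOpen ψ⟩
  refine ⟨ψ, hy.apply_pull_X_ne_zero C hψ0, ?_⟩
  have hrep (i) := (hxP i _ hψ0).trans (hy.eval_div_eq C φ₀ (hP i))
  simpa only [hrep] using hψG

theorem length_le_of_ltSeries_kodairaImage (hE : ∀ i, (E i).IsBasePointFree) (J : Finset ι) {n : ℕ}
    (hn : topologicalKrullDim X = (n : WithBot ℕ∞))
    (p : LTSeries (TopologicalSpace.IrreducibleCloseds (kodairaImage E J))) : p.length ≤ n := by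
  have (i : ι) := (E i).finiteDimensional
  have := finite_productSeries (J := J) fun i => Module.finBasis ℂ (E i).sections
  obtain ⟨z, hz⟩ := p.head.isIrreducible.nonempty
  obtain ⟨q, hq⟩ := surjective_kodairaMap hE J z
  obtain ⟨C, -⟩ := exists_systemChart (b := fun i => Module.finBasis ℂ (E i).sections) hE q.2
  exact C.length_le hE hn p

end Dimension

end LinearSeries

/-! ### General sections have no excess intersection -/

theorem MvPolynomial.exists_eval_ne_zero {σ : Type*} {F : MvPolynomial σ ℂ} (hF : F ≠ 0) :
    ∃ c, MvPolynomial.eval c F ≠ 0 := by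
  by_contra! h
  exact hF (MvPolynomial.funext fun c => by rw [h c, map_zero])

/-- General members of `m` families of closed subsets, each of which is in general position to every
point, have no common points on a subset of dimension less than `m`. -/
theorem ChainsShorter.exists_disjoint {Y : Type*} [TopologicalSpace Y]
    [TopologicalSpace.NoetherianSpace Y] {ι : Type*} {κ : ι → Type*}
    {D : ∀ i, (κ i → ℂ) → Set Y} (hD : ∀ i c, IsClosed (D i c)) {S : Finset ι}
    (hℓ : ∀ i ∈ S, ∀ y, ∃ ℓ : MvPolynomial (Σ i, κ i) ℂ, ℓ ≠ 0 ∧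
      ∀ c, MvPolynomial.eval c ℓ ≠ 0 → y ∉ D i fun k => c ⟨i, k⟩)
    {T : Set Y} (hT : IsClosed T) (hTS : ChainsShorter T S.card)
    {F : MvPolynomial (Σ i, κ i) ℂ} {c₀ : (Σ i, κ i) → ℂ} (hc₀ : MvPolynomial.eval c₀ F ≠ 0) :
    ∃ c, MvPolynomial.eval c F ≠ 0 ∧ (∀ v, v.1 ∉ S → c v = c₀ v) ∧
      ∀ y ∈ T, ∃ i ∈ S, y ∉ D i fun k => c ⟨i, k⟩ := by
  classical
  induction S using Finset.induction_on generalizing T c₀ with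
  | empty =>
    rw [Finset.card_empty] at hTS
    refine ⟨c₀, hc₀, fun _ _ => rfl, fun y hy => ?_⟩
    rw [hTS.eq_empty hT] at hy
    exact hy.elim
  | insert a S ha ih =>
    rw [Finset.card_insert_of_notMem ha] at hTS
    obtain ⟨s, hs⟩ := hTS.exists_finset hT
    choose ℓ hℓ0 hℓ' using hℓ a (Finset.mem_insert_self a S)
    -- F with every group but `a` frozen at `c₀`; it is nonzero because its value at `c₀` is that of
    -- F. Group `a` can thus be moved off the finitely many bad hyperplane-like conditions while F
    -- stays nonzero, and the mixed point starts the induction.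
    let H : MvPolynomial (Σ i, κ i) ℂ := MvPolynomial.aeval
      (fun v : Σ i, κ i => if v.1 = a then MvPolynomial.X v else MvPolynomial.C (c₀ v)) F
    have hH (c) : MvPolynomial.eval c H =
        MvPolynomial.eval (fun v => if v.1 = a then c v else c₀ v) F := by
      rw [← MvPolynomial.coe_aeval_eq_eval, ← MvPolynomial.coe_aeval_eq_eval, RingHom.coe_coe,
        RingHom.coe_coe, MvPolynomial.comp_aeval_apply]
      congr 2
      funext v
      split_ifs <;> simp
    have hH0 : H ≠ 0 := by
      intro h
      refine hc₀ ?_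
      have := hH c₀
      rw [h, map_zero] at this
      simpa using this.symm
    obtain ⟨c, hc⟩ := MvPolynomial.exists_eval_ne_zero
      (mul_ne_zero hH0 (Finset.prod_ne_zero_iff.mpr fun y (_ : y ∈ s) => hℓ0 y))
    rw [map_mul, map_prod, mul_ne_zero_iff, Finset.prod_ne_zero_iff, hH] at hc
    obtain ⟨c', hc', hcS, hcT⟩ := ih (fun i hi => hℓ i (Finset.mem_insert_of_mem hi))
      (hT.inter (hD a fun k => c ⟨a, k⟩)) (hs _ fun y hy => hℓ' y c (hc.2 y hy)) hc.1
    refine ⟨c', hc', fun v hv => ?_, fun y hy => ?_⟩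
    · rw [Finset.mem_insert, not_or] at hv
      rw [hcS v hv.2, if_neg hv.1]
    · by_cases hya : y ∈ D a fun k => c ⟨a, k⟩
      · obtain ⟨i, hi, hyi⟩ := hcT y ⟨hy, hya⟩
        exact ⟨i, Finset.mem_insert_of_mem hi, hyi⟩
      · refine ⟨a, Finset.mem_insert_self a S, ?_⟩
        have : (fun k => c' ⟨a, k⟩) = fun k => c ⟨a, k⟩ := by
          funext k
          rw [hcS _ ha, if_pos rfl]
        rwa [this]

/-! ### Essential subcollections and vanishing of the index -/

namespace LinearSeries

attribute [local instance] projectiveZariskiTopology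

section SectionLocus

variable {X : Scheme.{0}} [X.Over (Spec (.of ℂ))]
  {ι : Type} {E : ι → LinearSystem X} (J : Finset ι)

/-- The points of the image of the Kodaira map at which all the products with the given factor
vanish. -/
def sectionLocus (i : ι) (s : (E i).sections) : Set (kodairaImage E J) :=
  {y | ∀ s' : ∀ j : J, (E j).sections, (∀ hi : i ∈ J, s' ⟨i, hi⟩ = s) →
    y.1.rep ⟨tensorSection E J s', Submodule.subset_span ⟨s', rfl⟩⟩ = 0}

theorem isClosed_sectionLocus (i : ι) (s : (E i).sections) : IsClosed (sectionLocus J i s) := by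
  simp only [sectionLocus, Set.ofPred_forall]
  refine isClosed_iInter fun s' => isClosed_iInter fun _ => ?_
  have h := (isOpen_setOf_eval_ne_zero (MvPolynomial.isHomogeneous_X ℂ (Module.Dual.eval ℂ
    (productSeries E J) ⟨tensorSection E J s', Submodule.subset_span ⟨s', rfl⟩⟩))).preimage
    (continuous_subtype_val (p := (· ∈ kodairaImage E J)))
  rw [← isOpen_compl_iff]
  convert h using 1
  ext y
  simp

variable [LocallyOfFiniteType (X ↘ Spec (.of ℂ))] [Finite ι] {J}

/-- With the zero-free basis sections of a chart as the other factors, a product vanishes only where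
`s` does. Divisors of single sections thus descend to the Kodaira image of the product. -/
theorem kodairaMap_mem_sectionLocus (hE : ∀ i, (E i).IsBasePointFree) {i : ι} (hi : i ∈ J)
    (s : (E i).sections) (p : closedPoints X) :
    kodairaMap hE J p ∈ sectionLocus J i s ↔ VanishesAt (E i).L (s : Γ((E i).L, ⊤)) p := by
  classical
  have (i : ι) := (E i).finiteDimensional
  let b (i : ι) := Module.finBasis ℂ (E i).sections
  obtain ⟨p, hp⟩ := p
  obtain ⟨C, ψ, rfl⟩ := exists_pointOfAlgHom_of_mem_closedPoints b hE hp
  have h := (isKodairaImage_iff C).mp (isKodairaImage_kodairaMap hE J ⟨_, hp⟩)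
  rw [vanishesAt_iff (C.isFrame i) (pointOfAlgHom_mem C.isAffineOpen ψ),
    pointOfAlgHom_mem_basicOpen_iff, not_not]
  constructor
  · intro h1
    have h2 := h1 (Function.update (fun j : J => b j (C.k₀ j)) ⟨i, hi⟩ s)
      fun hi => Function.update_self _ _ _
    rw [h, C.evalAt_tensorSection, Finset.prod_eq_zero_iff] at h2
    obtain ⟨j, -, hj⟩ := h2
    by_cases hji : j = ⟨i, hi⟩
    · subst hji
      rwa [Function.update_self] at hj
    · rw [Function.update_of_ne hji] at hj
      exact absurd hj ((C.isUnit j).map ψ).ne_zero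
  · intro h1 s' hs'
    rw [h, C.evalAt_tensorSection]
    refine Finset.prod_eq_zero (Finset.mem_univ ⟨i, hi⟩) ?_
    rw [hs' hi]
    exact h1

/-- The value of the general section at p is a linear form in its coefficients, nonzero by
base-point freeness. -/
theorem exists_linearForm_not_vanishesAt {κ : ι → Type*} [∀ i, Fintype (κ i)]
    (b : ∀ i, Module.Basis (κ i) ℂ (E i).sections) (hE : ∀ i, (E i).IsBasePointFree) (i : ι) {p : X}
    (hp : p ∈ closedPoints X) :
    ∃ ℓ : MvPolynomial (Σ i, κ i) ℂ, ℓ ≠ 0 ∧ ∀ c, MvPolynomial.eval c ℓ ≠ 0 →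
      ¬ VanishesAt (E i).L (system E b c i : Γ((E i).L, ⊤)) p := by
  classical
  obtain ⟨C, ψ, rfl⟩ := exists_pointOfAlgHom_of_mem_closedPoints b hE hp
  let g (k : κ i) : ℂ := ψ (frameCoord (E i).L (C.isFrame i) (b i k : Γ((E i).L, ⊤)))
  refine ⟨∑ k, g k • MvPolynomial.X ⟨i, k⟩, fun h => ?_, fun c hc => ?_⟩
  · have h1 := congrArg (MvPolynomial.eval (Pi.single ⟨i, C.k₀ i⟩ 1)) h
    rw [map_zero, map_sum, Finset.sum_eq_single (C.k₀ i)] at h1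
    · simp only [MvPolynomial.smul_eval, MvPolynomial.eval_X, Pi.single_eq_same, mul_one] at h1
      exact ((C.isUnit i).map ψ).ne_zero h1
    · intro k _ hk
      simp [hk]
    · simp
  · rw [vanishesAt_iff (C.isFrame i) (pointOfAlgHom_mem C.isAffineOpen ψ),
      pointOfAlgHom_mem_basicOpen_iff, not_not, system_eq, frameCoord_sum_smul, map_sum]
    simpa only [map_sum, map_smul, smul_eq_mul, MvPolynomial.smul_eval, MvPolynomial.eval_X, mul_comm]
      using hc

theorem noetherianSpace_kodairaImage [CompactSpace X] (hE : ∀ i, (E i).IsBasePointFree)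
    (J : Finset ι) : TopologicalSpace.NoetherianSpace (kodairaImage E J) := by
  have : IsLocallyNoetherian X := LocallyOfFiniteType.isLocallyNoetherian (X ↘ Spec (.of ℂ))
  have : IsNoetherian X := {}
  exact TopologicalSpace.noetherianSpace_of_surjective _ (continuous_kodairaMap hE J)
    (surjective_kodairaMap hE J)

/-- The generic system whose subsystem `J` consists of more equations than the dimension of the
image of the Kodaira map of `E_J` has no roots. -/
theorem exists_forall_exists_not_vanishesAt [CompactSpace X] {κ : ι → Type*} [∀ i, Fintype (κ i)]
    (b : ∀ i, Module.Basis (κ i) ℂ (E i).sections) (hE : ∀ i, (E i).IsBasePointFree)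
    (hJ : ∀ p : LTSeries (TopologicalSpace.IrreducibleCloseds (kodairaImage E J)),
      p.length < J.card) {F : MvPolynomial (Σ i, κ i) ℂ} (hF : F ≠ 0) :
    ∃ c, MvPolynomial.eval c F ≠ 0 ∧
      ∀ p ∈ closedPoints X, ∃ i ∈ J, ¬ VanishesAt (E i).L (system E b c i : Γ((E i).L, ⊤)) p := by
  have := noetherianSpace_kodairaImage hE J
  obtain ⟨c₀, hc₀⟩ := MvPolynomial.exists_eval_ne_zero hF
  obtain ⟨c, hc, -, hcJ⟩ := ChainsShorter.exists_disjoint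
    (D := fun i c => sectionLocus J i (∑ k, c k • b i k)) (fun i c => isClosed_sectionLocus J i _)
    (S := J) (fun i hi y => by
      obtain ⟨p, rfl⟩ := surjective_kodairaMap hE J y
      obtain ⟨ℓ, hℓ, h⟩ := exists_linearForm_not_vanishesAt b hE i p.2
      exact ⟨ℓ, hℓ, fun c hc => (not_congr (kodairaMap_mem_sectionLocus hE hi _ p)).mpr (h c hc)⟩)
    isClosed_univ (fun p _ => hJ p) hc₀
  refine ⟨c, hc, fun p hp => ?_⟩
  obtain ⟨i, hi, h⟩ := hcJ (kodairaMap hE J ⟨p, hp⟩) (Set.mem_univ _)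
  exact ⟨i, hi, (not_congr (kodairaMap_mem_sectionLocus hE hi _ _)).mp h⟩

end SectionLocus

section Tau

variable {X : Scheme.{0}} [X.Over (Spec (.of ℂ))] [LocallyOfFiniteType (X ↘ Spec (.of ℂ))]
  [IsIntegral X]
  {ι : Type} [Finite ι] {E : ι → LinearSystem X}

theorem topologicalKrullDim_kodairaImage_le (hE : ∀ i, (E i).IsBasePointFree) (J : Finset ι) {n : ℕ}
    (hn : topologicalKrullDim X = (n : WithBot ℕ∞)) :
    topologicalKrullDim (kodairaImage E J) ≤ n :=
  iSup_le fun p => by exact_mod_cast length_le_of_ltSeries_kodairaImage hE J hn p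

theorem tau_le (hE : ∀ i, (E i).IsBasePointFree) (J : Finset ι) {n : ℕ}
    (hn : topologicalKrullDim X = (n : WithBot ℕ∞)) : tau E J ≤ n := by
  have h := topologicalKrullDim_kodairaImage_le hE J hn
  unfold tau
  generalize topologicalKrullDim (kodairaImage E J) = d at h
  induction d with
  | bot => simp
  | coe d =>
    rw [WithBot.unbotD_coe]
    exact ENat.toNat_le_of_le_natCast (by exact_mod_cast h)

/-- The bound by n excludes infinite dimension and the chain itself excludes dimension ⊥, so no
default value enters `tau`. -/
theorem length_le_tau (hE : ∀ i, (E i).IsBasePointFree) (J : Finset ι) {n : ℕ}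
    (hn : topologicalKrullDim X = (n : WithBot ℕ∞))
    (p : LTSeries (TopologicalSpace.IrreducibleCloseds (kodairaImage E J))) :
    p.length ≤ tau E J := by
  have h := topologicalKrullDim_kodairaImage_le hE J hn
  have hp : (p.length : WithBot ℕ∞) ≤ topologicalKrullDim (kodairaImage E J) :=
    Order.LTSeries.length_le_krullDim p
  unfold tau
  generalize topologicalKrullDim (kodairaImage E J) = d at h hp
  induction d with
  | bot => simp at hp
  | coe d =>
    have hd : d ≤ n := by exact_mod_cast h
    lift d to ℕ using ne_top_of_le_ne_top (ENat.natCast_ne_top n) hd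
    rw [WithBot.unbotD_coe, ENat.toNat_natCast]
    exact_mod_cast hp

/-- The full collection has defect at most n - |ι| < 0, and the defect of J is no larger. -/
theorem IsEssential.tau_lt [Fintype ι] (hE : ∀ i, (E i).IsBasePointFree) {J : Finset ι} {n : ℕ}
    (hJ : IsEssential E J) (hn : topologicalKrullDim X = (n : WithBot ℕ∞)) (hι : n < Fintype.card ι) :
    tau E J < J.card := by
  have h1 : minimalDefect E ≤ defect E Finset.univ := Finset.inf'_le _ (Finset.mem_univ _)
  have h2 := tau_le hE Finset.univ hn
  rw [← hJ.1, defect, defect, Finset.card_univ] at h1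
  omega

end Tau

theorem IsEssential.eq_zero_of_isIntersectionIndex {X : Scheme.{0}} [X.Over (Spec (.of ℂ))]
    [LocallyOfFiniteType (X ↘ Spec (.of ℂ))] [IsIntegral X] [CompactSpace X] {n : ℕ}
    (hn : topologicalKrullDim X = (n : WithBot ℕ∞)) {E : Fin (n + 1) → LinearSystem X}
    (hE : ∀ i, (E i).IsBasePointFree) {κ : Fin (n + 1) → Type*} [∀ i, Fintype (κ i)]
    {b : ∀ i, Module.Basis (κ i) ℂ (E i).sections} {J : Finset (Fin (n + 1))}
    (hJ : IsEssential E J) {i : Fin (n + 1)} (hi : i ∉ J) {N : ℕ}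
    (hN : IsIntersectionIndex (fun j : Fin n => E (i.succAbove j))
      (fun j : Fin n => b (i.succAbove j)) N) : N = 0 := by
  obtain ⟨q, hq, h⟩ := holdsGenerically_iff.mp hN
  rw [vanishingIdeal_univ, Ideal.mem_bot] at hq
  have hlt := hJ.tau_lt hE hn (by simp)
  obtain ⟨c, hc, hcJ⟩ := exists_forall_exists_not_vanishesAt b hE
    (fun p => (length_le_tau hE J hn p).trans_lt hlt)
    -- A J-system without roots is sought among those whose other n groups are generic for the
    -- index; as i ∉ J, the equations of J are among these n.
    (F := MvPolynomial.rename (otherVars i) q)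
    ((map_ne_zero_iff _ (MvPolynomial.rename_injective _ (otherVars_injective i))).mpr hq)
  rw [MvPolynomial.eval_rename] at hc
  rw [← (h _ (Set.mem_univ _) hc).2]
  convert Set.ncard_empty X
  refine Set.eq_empty_iff_forall_notMem.mpr fun p hp => ?_
  obtain ⟨j, hj, hjp⟩ := hcJ p hp.1
  obtain ⟨j, rfl⟩ := Fin.exists_succAbove_eq (ne_of_mem_of_not_mem hj hi)
  exact hjp (hp.2 j)

end LinearSeries

theorem mainTheorem11
    (X : Scheme.{0}) [X.Over (Spec (.of ℂ))] [IsIntegral X]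
    [IsSeparated (X ↘ Spec (.of ℂ))] [LocallyOfFiniteType (X ↘ Spec (.of ℂ))]
    [QuasiCompact (X ↘ Spec (.of ℂ))]
    (n : ℕ) (hn : topologicalKrullDim X = (n : WithBot ℕ∞))
    (E : Fin (n + 1) → LinearSeries.LinearSystem X)
    (hE : ∀ i, (E i).IsBasePointFree)
    {κ : Fin (n + 1) → Type*} [∀ i, Fintype (κ i)]
    (b : ∀ i, Module.Basis (κ i) ℂ (E i).sections)
    (hcodim : LinearSeries.codim (LinearSeries.consistencyVariety E b) = 1) :
    (∃ F, LinearSeries.IsResultant E b F) ∧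
    (∀ i : Fin (n + 1),
      LinearSeries.IsIntersectionIndex (fun j : Fin n => E (i.succAbove j))
        (fun j : Fin n => b (i.succAbove j))
        (LinearSeries.intersectionIndex (fun j : Fin n => E (i.succAbove j))
          (fun j : Fin n => b (i.succAbove j)))) ∧
    ∀ F : MvPolynomial (Σ i, κ i) ℂ, LinearSeries.IsResultant E b F →
      (∀ i : Fin (n + 1),
        F.IsWeightedHomogeneous (LinearSeries.entryWeight i) (LinearSeries.entryDegree i F) ∧
        LinearSeries.entryDegree i F =
          LinearSeries.intersectionIndex (fun j : Fin n => E (i.succAbove j))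
            (fun j : Fin n => b (i.succAbove j))) ∧
      ∀ J : Finset (Fin (n + 1)), LinearSeries.IsEssential E J →
        ∀ i : Fin (n + 1), i ∉ J → LinearSeries.entryDegree i F = 0 := by
  obtain ⟨S⟩ := LinearSeries.nonempty_affineAtlas (E := E) (b := b) hn hE
  -- The infimum of a nonempty set of natural numbers belongs to it, so existence of an index makes
  -- the defined one an index.
  have hidx (i : Fin (n + 1)) :=
    Nat.sInf_mem (LinearSeries.exists_isIntersectionIndex (E := fun j : Fin n => E (i.succAbove j))
      (b := fun j : Fin n => b (i.succAbove j)) (by simp) (S.comp i.succAbove))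
  refine ⟨LinearSeries.exists_isResultant (by simp) S hcodim, hidx, fun F hF => ⟨fun i => ?_, ?_⟩⟩
  · obtain ⟨h1, h2⟩ := hF.isWeightedHomogeneous S i (hidx i)
    rw [h2]
    exact ⟨h1, rfl⟩
  · intro J hJ i hi
    have : CompactSpace X := (quasiCompact_iff_compactSpace (f := X ↘ Spec (.of ℂ))).mp
      inferInstance
    rw [(hF.isWeightedHomogeneous S i (hidx i)).2]
    exact hJ.eq_zero_of_isIntersectionIndex hn hE hi (hidx i)
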